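/- **Setting.** Let $\{\zeta_j\}_{j\in\mathbb Z}$ be i.i.d. real random variables with mean $0$, variance $1$ and $E\zeta_0^4<\infty$; let $(a_k)_{k\ge 0}$ be real with $\sum_k a_k^2<\infty$, and let $X_j=\sum_{k\ge0}a_k\zeta_{j-k}$, $j\in\mathbb Z$ (convergence in $L^2$). Put $\Pi=[-\pi,\pi]$, let $A_X(u)=\sum_{k\ge0}e^{-iku}a_k$ be the ($2\pi$-periodic) transfer function (convergence in $L^2(\Pi)$) and $f_X=|A_X|^2/(2\pi)$ the spectral density. For $n\ge1$ let $u_j=2\pi j/n$, $\nu=[n/2]-1$, $I_X(u)=(2\pi n)^{-1}\bigl|\sum_{t=1}^n e^{itu}X_t\bigr|^2$, and define $I_\zeta$ in the same way. For real weights $b_{n,j}$ put, with all sums and maxima over $1\le j\le\nu$ (and equal to $0$ if $\nu\le 0$), $$Q_{n,X}=\sum_j b_{n,j}I_X(u_j),\qquad Q_{n,\zeta}=\sum_j b_{n,j}f_X(u_j)\,2\pi I_\zeta(u_j),\qquad r_n=Q_{n,X}-Q_{n,\zeta}-E[Q_{n,X}-Q_{n,\zeta}],$$ $$B_n^2=\sum_j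 b_{n,j}^2,\qquad b_{f,n}=\max_j|b_{n,j}|f_X(u_j),\qquad B_{f,n}=\Bigl(\sum_j (b_{n,j}f_X(u_j))^2\Bigr)^{1/2},$$ $$v_n^2=B_{f,n}^2+\mathrm{Cum}_4(\zeta_0)\,\frac1n\Bigl(\sum_j b_{n,j}f_X(u_j)\Bigr)^2.$$ Let $\Lambda_\beta(\Pi)$ be the class of complex functions on $\Pi$ with $|h(u)-h(v)|\le C|u-v|^\beta$, and $\mathcal C(\Pi)$ the class of continuous complex functions on $\Pi$. Write $\varepsilon_{n,h}=n^{-1}\log^2 n$ if $h\in\Lambda_1(\Pi)$; $\varepsilon_{n,h}=n^{-\beta}$ if $h\in\Lambda_\beta(\Pi)$, $0<\beta<1$; and, if $h\in\mathcal C(\Pi)$, $\varepsilon_{n,h}=\delta_n$ for some sequence $\delta_n\to0$ not depending on the weights. The constants $C$ below depend neither on $n$ nor on the weights. **Lemma 3.1.** In all cases $E r_n^2<\infty$, and the following hold. (i) If $A_X\in\Lambda_\beta(\Pi)$ with $0<\beta\le1$, or $A_X\in\mathcal C(\Pi)$, then $$E r_n^2\le C\,\varepsilon_{n,A_X}B_n^2\qquad(n\ge1).$$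 If, in addition, $f_X$ is bounded away from $0$ and $\infty$ on $\Pi$ and $\mathrm{Var}(\zeta_0^2)>0$, then $\varepsilon_{n,A_X}B_n^2=o(v_n^2)$, and hence $E r_n^2=o(v_n^2)$. (ii) Let $|d|<1/2$ and $A_X(u)=h(u)G(u)$ for $0<|u|\le\pi$, where $h$ is differentiable on $\Pi\setminus\{0\}$ with $$C_1|u|^{-d}\le|h(u)|\le C_2|u|^{-d},\qquad |\dot h(u)|\le C_3|u|^{-1-d},\qquad 0<|u|\le\pi,$$ for some $0<C_1,C_2,C_3<\infty$, and where $G$ is bounded away from $0$ on $\Pi$ and either $G\in\mathcal C(\Pi)$ or $G\in\Lambda_\beta(\Pi)$, $0<\beta\le1$. Then $$E r_n^2\le C\bigl(\min(b_{f,n}^2\log^3 n,\ b_{f,n}B_{f,n})+\varepsilon_{n,G}B_{f,n}^2\bigr)\qquad(n\ge1),$$ and, if $G\in\Lambda_1(\Pi)$, $$E r_n^2\le C\min(b_{f,n}^2\log^3 n,\ b_{f,n}B_{f,n})\qquad(n\ge1).$$ If, in addition, $b_{f,n}/B_{f,n}\to0$ and $\mathrm{Var}(\zeta_0^2)>0$,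 then $E r_n^2=o(v_n^2)$. -/

import Mathlib

open MeasureTheory ProbabilityTheory Filter Topology Asymptotics
open scoped NNReal ENNReal

namespace Bartlett

noncomputable section

/-- The frequency interval `Π = [-π, π]`. -/
def PiInt : Set ℝ := Set.Icc (-Real.pi) Real.pi

/-- `ζ` is a sequence of i.i.d. standardized (mean `0`, variance `1`) random variables. -/
structure IsStandardIID {Ω : Type*} [MeasurableSpace Ω] (P : Measure Ω) (ζ : ℤ → Ω → ℝ) :
    Prop where
  measurable : ∀ j, Measurable (ζ j)
  indep : iIndepFun ζ P
  identDistrib : ∀ j, IdentDistrib (ζ j) (ζ 0) P P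
  mean_zero : ∫ ω, ζ 0 ω ∂P = 0
  variance_one : variance (ζ 0) P = 1

/-- `X j = ∑_{k ≥ 0} a k * ζ (j - k)`, with real square summable coefficients; the series
converges in `L²`. -/
structure IsLinearProcess {Ω : Type*} [MeasurableSpace Ω] (P : Measure Ω) (a : ℕ → ℝ)
    (ζ X : ℤ → Ω → ℝ) : Prop where
  summable_sq : Summable fun k => a k ^ 2
  memLp : ∀ j, MemLp (X j) 2 P
  tendsto : ∀ j : ℤ, Tendsto
    (fun N : ℕ => eLpNorm (fun ω => X j ω - ∑ k ∈ Finset.range N, a k * ζ (j - (k : ℤ)) ω) 2 P)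
    atTop (𝓝 0)

/-- `A` is (a version of) the transfer function `A(u) = ∑_{k ≥ 0} e^{-iku} a k`, a
`2π`-periodic function; for square summable `a` the series converges in `L²(Π)`. -/
structure IsTransferFunction (a : ℕ → ℝ) (A : ℝ → ℂ) : Prop where
  periodic : Function.Periodic A (2 * Real.pi)
  memLp : MemLp A 2 (volume.restrict PiInt)
  tendsto : Tendsto
    (fun N : ℕ => eLpNorm
      (fun u : ℝ => A u - ∑ k ∈ Finset.range N,
        Complex.exp (-(Complex.I * (k : ℂ) * (u : ℂ))) * (a k : ℂ)) 2
      (volume.restrict PiInt))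
    atTop (𝓝 0)

/-- The spectral density `f = |A|² / (2π)` (innovations have variance `1`). -/
def specDensity (A : ℝ → ℂ) (u : ℝ) : ℝ := ‖A u‖ ^ 2 / (2 * Real.pi)

/-- Fourier frequencies `u_j = 2πj/n`. -/
def freq (n j : ℕ) : ℝ := 2 * Real.pi * j / n

/-- The summation indices `1, …, ν` with `ν = [n/2] - 1` (no index when `n ≤ 3`). -/
def idx (n : ℕ) : Finset ℕ := Finset.Icc 1 (n / 2 - 1)

/-- Periodogram `I_X(u) = (2πn)⁻¹ |∑_{t=1}^n e^{itu} X_t|²`. -/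
def periodogram {Ω : Type*} (X : ℤ → Ω → ℝ) (n : ℕ) (u : ℝ) (ω : Ω) : ℝ :=
  (2 * Real.pi * n)⁻¹ *
    ‖∑ t ∈ Finset.Icc 1 n, Complex.exp (Complex.I * (t : ℂ) * (u : ℂ)) * (X (t : ℤ) ω : ℂ)‖ ^ 2

/-- `Q_{n,X} = ∑_{j=1}^ν b_j I_X(u_j)`. -/
def QX {Ω : Type*} (X : ℤ → Ω → ℝ) (b : ℕ → ℝ) (n : ℕ) (ω : Ω) : ℝ :=
  ∑ j ∈ idx n, b j * periodogram X n (freq n j) ω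

/-- `Q_{n,ζ} = ∑_{j=1}^ν b_j f_X(u_j) (2π) I_ζ(u_j)`. -/
def QZ {Ω : Type*} (ζ : ℤ → Ω → ℝ) (A : ℝ → ℂ) (b : ℕ → ℝ) (n : ℕ) (ω : Ω) : ℝ :=
  ∑ j ∈ idx n,
    b j * specDensity A (freq n j) * (2 * Real.pi * periodogram ζ n (freq n j) ω)

/-- The centered error `r_n = Q_{n,X} - Q_{n,ζ} - E[Q_{n,X} - Q_{n,ζ}]`. -/
def rErr {Ω : Type*} [MeasurableSpace Ω] (P : Measure Ω) (ζ X : ℤ → Ω → ℝ) (A : ℝ → ℂ)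
    (b : ℕ → ℝ) (n : ℕ) (ω : Ω) : ℝ :=
  QX X b n ω - QZ ζ A b n ω - ∫ ω', (QX X b n ω' - QZ ζ A b n ω') ∂P

/-- `E r_n²`. -/
def rMS {Ω : Type*} [MeasurableSpace Ω] (P : Measure Ω) (ζ X : ℤ → Ω → ℝ) (A : ℝ → ℂ)
    (b : ℕ → ℝ) (n : ℕ) : ℝ :=
  ∫ ω, rErr P ζ X A b n ω ^ 2 ∂P

/-- `B_n² = ∑_{j=1}^ν b_j²`. -/
def BSq (b : ℕ → ℝ) (n : ℕ) : ℝ := ∑ j ∈ idx n, b j ^ 2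

/-- `b_{f,n} = max_{j=1,…,ν} |b_j| f_X(u_j)` (equal to `0` if `ν ≤ 0`). -/
def bf (A : ℝ → ℂ) (b : ℕ → ℝ) (n : ℕ) : ℝ :=
  ⨆ j : idx n, |b j| * specDensity A (freq n j)

/-- `B_{f,n}² = ∑_{j=1}^ν (b_j f_X(u_j))²`. -/
def BfSq (A : ℝ → ℂ) (b : ℕ → ℝ) (n : ℕ) : ℝ :=
  ∑ j ∈ idx n, (b j * specDensity A (freq n j)) ^ 2

/-- `B_{f,n}`. -/
def Bf (A : ℝ → ℂ) (b : ℕ → ℝ) (n : ℕ) : ℝ := Real.sqrt (BfSq A b n)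

/-- The fourth cumulant `E(Z - EZ)⁴ - 3 (Var Z)²`. -/
def cum4 {Ω : Type*} [MeasurableSpace Ω] (P : Measure Ω) (Z : Ω → ℝ) : ℝ :=
  centralMoment Z 4 P - 3 * variance Z P ^ 2

/-- `v_n² = ∑_j (b_j f_X(u_j))² + Cum₄(ζ_0) n⁻¹ (∑_j b_j f_X(u_j))²`. -/
def vSq {Ω : Type*} [MeasurableSpace Ω] (P : Measure Ω) (ζ : ℤ → Ω → ℝ) (A : ℝ → ℂ)
    (b : ℕ → ℝ) (n : ℕ) : ℝ :=
  BfSq A b n + cum4 P (ζ 0) * (1 / (n : ℝ)) *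
    (∑ j ∈ idx n, b j * specDensity A (freq n j)) ^ 2

/-- The class `Λ_β(Π)`: `|h(u) - h(v)| ≤ C |u - v|^β` on `Π`. -/
def LipClass (β : ℝ≥0) (h : ℝ → ℂ) : Prop := ∃ C : ℝ≥0, HolderOnWith C β h PiInt

/-- The rate attached to `Λ_β(Π)`: `n⁻¹ log² n` if `β = 1`, and `n^{-β}` if `0 < β < 1`. -/
def lipRate (β : ℝ≥0) (n : ℕ) : ℝ :=
  if β = 1 then Real.log n ^ 2 / n else (n : ℝ) ^ (-(β : ℝ))

/-- `h` is differentiable on `Π \ {0}`, with `C₁|u|^{-d} ≤ |h(u)| ≤ C₂|u|^{-d}` and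
`|h'(u)| ≤ C|u|^{-1-d}` there. -/
def PowerSingular (d : ℝ) (h : ℝ → ℂ) : Prop :=
  ∃ (h' : ℝ → ℂ) (C C₁ C₂ : ℝ), 0 < C ∧ 0 < C₁ ∧ 0 < C₂ ∧
    ∀ u ∈ PiInt, u ≠ 0 →
      HasDerivWithinAt h (h' u) PiInt u ∧
      C₁ * |u| ^ (-d) ≤ ‖h u‖ ∧ ‖h u‖ ≤ C₂ * |u| ^ (-d) ∧
      ‖h' u‖ ≤ C * |u| ^ (-1 - d)

/-- `f_X` is bounded away from `0` and `∞` on `Π`. -/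
def SpecBounded (A : ℝ → ℂ) : Prop :=
  ∃ C₁ C₂ : ℝ, 0 < C₁ ∧ ∀ u ∈ PiInt, C₁ ≤ specDensity A u ∧ specDensity A u ≤ C₂

/-- `min (b_{f,n}² log³ n, b_{f,n} B_{f,n})`. -/
def minTerm (A : ℝ → ℂ) (b : ℕ → ℝ) (n : ℕ) : ℝ :=
  min (bf A b n ^ 2 * Real.log n ^ 3) (bf A b n * Bf A b n)

end

end Bartlett

/-! The difference Q_X - Q_ζ is a quadratic form in the innovations, so the second moment of its
centered version is at most a constant times the squared Hilbert-Schmidt norm of its matrix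
(`integral_quadForm_sq_le`). Infinitely many innovations are reached by truncation, L¹ convergence
and Fatou (`rErr_sq_le`). The matrix is (2πn)⁻¹ times the real part of Σ_j b_j (C_j ⊗ conj C_j -
|A(u_j)|² d_j ⊗ conj d_j), where C_j and d_j are the Fourier coefficients of A·D_n(· - u_j) and
D_n(· - u_j), with D_n the Dirichlet kernel. Since D_n concentrates at 0, C_j is close to A(u_j)
d_j.

Adding up these errors over j by the triangle inequality would lose too much. The kernels D_n(· -
u_j) at distinct Fourier frequencies are orthogonal, and multiplying them by g with |g| ≤ K leaves a
Riesz upper bound K²n (`sum_sq_fc_family_le`). A sum Σ_j v_j ⊗ conj w_j with one leg in such a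
family therefore costs only K²n Σ_j ‖v_j‖² (`sum_sq_tensor_le`). Write A = H g on (0, 2π), with H
carrying the singularity and g bounded, and split C_j = H(u_j)(p_j + e_j), e_j = q_j + f_j. Here e_j
comes from g D_n, p_j from (H/H(u_j) - 1) g D_n, q_j from (g - g(u_j)) D_n, and f_j = g(u_j) d_j.
Every term of the resulting matrix has a leg e_j or f_j, except p_j ⊗ conj p_j, for which the
triangle inequality is good enough (`sum_sq_kernelEntry_le`).

It remains to bound norms: ‖p_j‖² = O(n/j) by scaling at the singularity, and ‖q_j‖² = O(n δ_n +
n/j), where δ_n measures the modulus of continuity and n/j pays for a jump of g at 0 ≡ 2π. In (i), H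
= 1 and g = A is continuous on the circle, so only n δ_n survives. In (ii), with y_j = |b_j|
f_X(u_j), there remain Σ y_j²/j + (Σ y_j/j)², which the minimum dominates (`exists_sum_weights_le`).
The o(v_n²) claims follow because v_n² ≥ c B_{f,n}² with c > 0 (`exists_le_vSq`). -/

namespace Bartlett

/-! ### Second moments of quadratic forms in i.i.d. variables -/

section QuadraticForm

variable {Ω : Type*} [MeasurableSpace Ω] {P : Measure Ω} {ζ : ℤ → Ω → ℝ}

/-- The entries `ζ_s ζ_t - E ζ_s ζ_t` of a centered quadratic form in the innovations. -/
def centeredProd (ζ : ℤ → Ω → ℝ) (s t : ℤ) (ω : Ω) : ℝ :=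
  ζ s ω * ζ t ω - if s = t then 1 else 0

lemma memLp_four_innovation (hζ : IsStandardIID P ζ) (hζ4 : MemLp (ζ 0) 4 P) (j : ℤ) :
    MemLp (ζ j) 4 P :=
  (hζ.identDistrib j).symm.memLp_snd hζ4

instance holderTriple_four_four_two : ENNReal.HolderTriple 4 4 2 := by
  refine ⟨?_⟩
  rw [← ENNReal.toReal_eq_toReal_iff' (by simp) (by simp), ENNReal.toReal_add (by simp) (by simp)]
  simp only [ENNReal.toReal_inv, ENNReal.toReal_ofNat]
  norm_num

lemma integral_innovation (hζ : IsStandardIID P ζ) (j : ℤ) : ∫ ω, ζ j ω ∂P = 0 := by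
  rw [← hζ.mean_zero]
  exact (hζ.identDistrib j).integral_eq

lemma integral_innovation_sq (hζ : IsStandardIID P ζ) (j : ℤ) : ∫ ω, ζ j ω ^ 2 ∂P = 1 := by
  rw [← hζ.variance_one, variance_of_integral_eq_zero (hζ.measurable 0).aemeasurable hζ.mean_zero]
  exact (hζ.identDistrib j).sq.integral_eq

lemma integral_centeredProd_self_sq (hζ : IsStandardIID P ζ) (t : ℤ) :
    ∫ ω, centeredProd ζ t t ω ^ 2 ∂P = ∫ ω, (ζ 0 ω ^ 2 - 1) ^ 2 ∂P := by
  have h := ((hζ.identDistrib t).comp (u := fun x : ℝ => (x ^ 2 - 1) ^ 2) (by fun_prop)).integral_eq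
  simpa [centeredProd, sq] using h

/-- A function of `ζ_t` is independent of a function of `ζ_s`, `s ∈ S`, if `t ∉ S`. -/
lemma integral_mul_of_notMem (hζ : IsStandardIID P ζ) {S : Finset ℤ} {t : ℤ} (ht : t ∉ S)
    {g : ℝ → ℝ} (hg : Measurable g) {φ : (ℤ → ℝ) → ℝ} (hφ : Measurable φ)
    (hS : ∀ z z' : ℤ → ℝ, (∀ s ∈ S, z s = z' s) → φ z = φ z') :
    ∫ ω, g (ζ t ω) * φ (fun s => ζ s ω) ∂P =
      (∫ ω, g (ζ t ω) ∂P) * ∫ ω, φ (fun s => ζ s ω) ∂P := by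
  classical
  -- Independence concerns the restriction of the sequence to S, while φ takes whole sequences.
  -- Extension by zero bridges the two, as φ only sees the coordinates in S.
  let ext : (S → ℝ) → (ℤ → ℝ) := fun z s => if h : s ∈ S then z ⟨s, h⟩ else 0
  have hext : Measurable ext := by
    refine measurable_pi_iff.mpr fun s => ?_
    by_cases h : s ∈ S
    · simpa [ext, h] using measurable_pi_apply (⟨s, h⟩ : S)
    · simp [ext, h]
  have hind := hζ.indep.indepFun_finset {t} S (Finset.disjoint_singleton_left.mpr ht)
    hζ.measurable
  have h2 := hind.comp (φ := fun z : ({t} : Finset ℤ) → ℝ => g (z ⟨t, Finset.mem_singleton_self t⟩))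
    (ψ := fun z => φ (ext z)) (hg.comp (measurable_pi_apply _)) (hφ.comp hext)
  have hφe : ∀ ω, φ (ext fun i : S => ζ i ω) = φ fun s => ζ s ω := fun ω =>
    hS _ _ fun s hs => by simp [ext, hs]
  have hm : Measurable fun ω => φ fun s => ζ s ω :=
    hφ.comp (measurable_pi_iff.mpr hζ.measurable)
  have h3 := h2.integral_fun_mul_eq_mul_integral
    ((hg.comp (hζ.measurable t)).aestronglyMeasurable) (by
      refine hm.aestronglyMeasurable.congr (ae_of_all _ fun ω => ?_)
      simp [hφe])
  simpa [hφe] using h3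

variable [IsProbabilityMeasure P]

lemma memLp_two_innovation (hζ : IsStandardIID P ζ) (hζ4 : MemLp (ζ 0) 4 P) (j : ℤ) :
    MemLp (ζ j) 2 P :=
  (memLp_four_innovation hζ hζ4 j).mono_exponent (by norm_num)

lemma memLp_centeredProd (hζ : IsStandardIID P ζ) (hζ4 : MemLp (ζ 0) 4 P) (s t : ℤ) :
    MemLp (centeredProd ζ s t) 2 P :=
  ((memLp_four_innovation hζ hζ4 t).mul' (memLp_four_innovation hζ hζ4 s)).sub (memLp_const _)

lemma integral_centeredProd_self (hζ : IsStandardIID P ζ) (hζ4 : MemLp (ζ 0) 4 P) (t : ℤ) :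
    ∫ ω, centeredProd ζ t t ω ∂P = 0 := by
  have hi : Integrable (fun ω => ζ t ω ^ 2) P := (memLp_two_innovation hζ hζ4 t).integrable_sq
  have : ∀ ω, centeredProd ζ t t ω = ζ t ω ^ 2 - 1 := fun ω => by simp [centeredProd, sq]
  simp_rw [this]
  rw [integral_sub hi (integrable_const _), integral_innovation_sq hζ]
  simp

lemma integral_linear_sq (hζ : IsStandardIID P ζ) (hζ4 : MemLp (ζ 0) 4 P) (S : Finset ℤ)
    (c : ℤ → ℝ) : ∫ ω, (∑ s ∈ S, c s * ζ s ω) ^ 2 ∂P = ∑ s ∈ S, c s ^ 2 := by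
  have hm : ∀ s, MemLp (fun ω => c s * ζ s ω) 2 P := fun s =>
    (memLp_two_innovation hζ hζ4 s).const_mul _
  have h0 : ∫ ω, (∑ s ∈ S, fun ω => c s * ζ s ω) ω ∂P = 0 := by
    simp only [Finset.sum_apply]
    rw [integral_finsetSum _ fun s _ => (hm s).integrable (by norm_num)]
    exact Finset.sum_eq_zero fun s _ => by rw [integral_const_mul, integral_innovation hζ, mul_zero]
  have h1 := IndepFun.variance_sum (μ := P) (X := fun s ω => c s * ζ s ω) (s := S)
    (fun s _ => hm s) (fun s _ t _ hst => (hζ.indep.indepFun hst).comp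
      (measurable_const_mul (c s)) (measurable_const_mul (c t)))
  rw [variance_of_integral_eq_zero (Finset.aemeasurable_sum _ fun s _ => (hm s).aemeasurable) h0]
    at h1
  simp only [Finset.sum_apply] at h1
  rw [h1]
  refine Finset.sum_congr rfl fun s _ => ?_
  rw [variance_const_mul, (hζ.identDistrib s).variance_eq, hζ.variance_one, mul_one]

/-- Adding one index t to S adds the increment m_tt (ζ_t² - 1) + ζ_t l, with l linear in the earlier
variables. It is orthogonal to the old form because ζ_t² - 1 and ζ_t are centered and independent of
the variables in S, so second moments add. With V = E(ζ_0² - 1)², the increment has second moment at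
most 2 m_tt² V + 2 Σ (m_st + m_ts)², which explains the constant 4 + 2V. -/
lemma integral_quadForm_sq_le (hζ : IsStandardIID P ζ) (hζ4 : MemLp (ζ 0) 4 P)
    (m : ℤ → ℤ → ℝ) (S : Finset ℤ) :
    ∫ ω, (∑ s ∈ S, ∑ t ∈ S, m s t * centeredProd ζ s t ω) ^ 2 ∂P ≤
      (4 + 2 * ∫ ω, (ζ 0 ω ^ 2 - 1) ^ 2 ∂P) * ∑ s ∈ S, ∑ t ∈ S, m s t ^ 2 := by
  classical
  set V := ∫ ω, (ζ 0 ω ^ 2 - 1) ^ 2 ∂P with hV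
  have hV0 : 0 ≤ V := integral_nonneg fun _ => sq_nonneg _
  induction S using Finset.induction_on with
  | empty => simp
  | insert t S ht ih =>
    let Q : (ℤ → ℝ) → ℝ := fun z =>
      ∑ s ∈ S, ∑ r ∈ S, m s r * (z s * z r - if s = r then 1 else 0)
    let L : (ℤ → ℝ) → ℝ := fun z => ∑ s ∈ S, (m s t + m t s) * z s
    have hQm : Measurable Q := by fun_prop
    have hLm : Measurable L := by fun_prop
    have hQS : ∀ z z' : ℤ → ℝ, (∀ s ∈ S, z s = z' s) → Q z = Q z' := fun z z' h =>
      Finset.sum_congr rfl fun s hs => Finset.sum_congr rfl fun r hr => by rw [h s hs, h r hr]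
    have hLS : ∀ z z' : ℤ → ℝ, (∀ s ∈ S, z s = z' s) → L z = L z' := fun z z' h =>
      Finset.sum_congr rfl fun s hs => by rw [h s hs]
    let q : Ω → ℝ := fun ω => Q fun s => ζ s ω
    let l : Ω → ℝ := fun ω => L fun s => ζ s ω
    have hq : MemLp q 2 P := by
      refine memLp_finsetSum _ fun s _ => memLp_finsetSum _ fun r _ => ?_
      exact (memLp_centeredProd hζ hζ4 s r).const_mul _
    have hl : MemLp l 4 P :=
      memLp_finsetSum _ fun s _ => (memLp_four_innovation hζ hζ4 s).const_mul _
    have hl2 : MemLp l 2 P := hl.mono_exponent (by norm_num)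
    have hd : MemLp (centeredProd ζ t t) 2 P := memLp_centeredProd hζ hζ4 t t
    have hzl : MemLp (fun ω => ζ t ω * l ω) 2 P := hl.mul' (memLp_four_innovation hζ hζ4 t)
    have hdec : ∀ ω, ∑ s ∈ insert t S, ∑ r ∈ insert t S, m s r * centeredProd ζ s r ω
        = q ω + (m t t * centeredProd ζ t t ω + ζ t ω * l ω) := by
      intro ω
      have h1 : ∀ s ∈ S, m s t * centeredProd ζ s t ω = m s t * (ζ s ω * ζ t ω) := by
        intro s hs
        have : s ≠ t := fun h => ht (h ▸ hs)
        simp [centeredProd, this]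
      have h2 : ∀ s ∈ S, m t s * centeredProd ζ t s ω = m t s * (ζ s ω * ζ t ω) := by
        intro s hs
        have : t ≠ s := fun h => ht (h ▸ hs)
        simp [centeredProd, this, mul_comm]
      simp only [Finset.sum_insert ht, Finset.sum_add_distrib]
      rw [Finset.sum_congr rfl h1, Finset.sum_congr rfl h2]
      have h3 : ζ t ω * l ω =
          ∑ s ∈ S, m s t * (ζ s ω * ζ t ω) + ∑ s ∈ S, m t s * (ζ s ω * ζ t ω) := by
        simp only [l, L]
        rw [Finset.mul_sum, ← Finset.sum_add_distrib]
        exact Finset.sum_congr rfl fun s _ => by ring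
      rw [h3]
      simp only [q, Q, centeredProd]
      ring
    have hq1 : ∫ ω, centeredProd ζ t t ω * q ω ∂P = 0 := by
      have := integral_mul_of_notMem hζ ht (g := fun x => x * x - 1) (by fun_prop) hQm hQS
      have h0 := integral_centeredProd_self hζ hζ4 t
      simp only [centeredProd, if_true] at h0 ⊢
      rw [h0, zero_mul] at this
      exact this
    have hq2 : ∫ ω, ζ t ω * (l ω * q ω) ∂P = 0 := by
      have := integral_mul_of_notMem hζ ht (g := fun x => x) measurable_id
        (hLm.mul hQm) (fun z z' h => by simp only [Pi.mul_apply]; rw [hLS z z' h, hQS z z' h])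
      rw [integral_innovation hζ, zero_mul] at this
      exact this
    have hl0 : ∫ ω, (ζ t ω * l ω) ^ 2 ∂P = ∑ s ∈ S, (m s t + m t s) ^ 2 := by
      have := integral_mul_of_notMem hζ ht (g := fun x => x ^ 2) (by fun_prop)
        (hLm.pow_const 2) (fun z z' h => by rw [hLS z z' h])
      rw [integral_innovation_sq hζ, one_mul] at this
      simp_rw [mul_pow]
      exact this.trans (integral_linear_sq hζ hζ4 S _)
    have hcross : ∫ ω, q ω * (m t t * centeredProd ζ t t ω + ζ t ω * l ω) ∂P = 0 := by
      have h1 : Integrable (fun ω => m t t * (centeredProd ζ t t ω * q ω)) P :=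
        (hd.integrable_mul hq).const_mul _
      have h2 : Integrable (fun ω => ζ t ω * (l ω * q ω)) P := by
        refine (hzl.integrable_mul hq).congr (ae_of_all _ fun ω => ?_)
        simp only [Pi.mul_apply]; ring
      have : ∀ ω, q ω * (m t t * centeredProd ζ t t ω + ζ t ω * l ω) =
          m t t * (centeredProd ζ t t ω * q ω) + ζ t ω * (l ω * q ω) := fun ω => by ring
      simp_rw [this]
      rw [integral_add h1 h2, integral_const_mul, hq1, hq2]
      simp
    have hR : MemLp (fun ω => m t t * centeredProd ζ t t ω + ζ t ω * l ω) 2 P :=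
      (hd.const_mul _).add hzl
    have hR2 : ∫ ω, (m t t * centeredProd ζ t t ω + ζ t ω * l ω) ^ 2 ∂P ≤
        2 * m t t ^ 2 * V + 2 * ∑ s ∈ S, (m s t + m t s) ^ 2 := by
      have h1 : Integrable (fun ω => 2 * m t t ^ 2 * centeredProd ζ t t ω ^ 2) P :=
        hd.integrable_sq.const_mul _
      have h2 : Integrable (fun ω => 2 * (ζ t ω * l ω) ^ 2) P := hzl.integrable_sq.const_mul _
      calc _ ≤ ∫ ω, (2 * m t t ^ 2 * centeredProd ζ t t ω ^ 2 + 2 * (ζ t ω * l ω) ^ 2) ∂P := by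
            refine integral_mono hR.integrable_sq (h1.add h2) fun ω => ?_
            simp only
            nlinarith [sq_nonneg (m t t * centeredProd ζ t t ω - ζ t ω * l ω)]
        _ = _ := by
            rw [integral_add h1 h2, integral_const_mul, integral_const_mul, hl0,
              integral_centeredProd_self_sq hζ]
    have hmain : ∫ ω, (∑ s ∈ insert t S, ∑ r ∈ insert t S, m s r * centeredProd ζ s r ω) ^ 2 ∂P =
        ∫ ω, q ω ^ 2 ∂P + ∫ ω, (m t t * centeredProd ζ t t ω + ζ t ω * l ω) ^ 2 ∂P := by
      have : ∀ ω, (∑ s ∈ insert t S, ∑ r ∈ insert t S, m s r * centeredProd ζ s r ω) ^ 2 =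
          q ω ^ 2 + (m t t * centeredProd ζ t t ω + ζ t ω * l ω) ^ 2 +
            2 * (q ω * (m t t * centeredProd ζ t t ω + ζ t ω * l ω)) := fun ω => by
        rw [hdec]; ring
      simp_rw [this]
      have i1 : Integrable (fun ω => q ω ^ 2 +
          (m t t * centeredProd ζ t t ω + ζ t ω * l ω) ^ 2) P :=
        hq.integrable_sq.add hR.integrable_sq
      have i2 : Integrable (fun ω =>
          2 * (q ω * (m t t * centeredProd ζ t t ω + ζ t ω * l ω))) P :=
        (hq.integrable_mul hR).const_mul _
      rw [integral_add i1 i2, integral_add hq.integrable_sq hR.integrable_sq,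
        integral_const_mul, hcross]
      simp
    rw [hmain]
    have ih' : ∫ ω, q ω ^ 2 ∂P ≤ (4 + 2 * V) * ∑ s ∈ S, ∑ r ∈ S, m s r ^ 2 := ih
    have hsum : ∑ s ∈ S, (m s t + m t s) ^ 2 ≤
        2 * (∑ s ∈ S, m s t ^ 2) + 2 * ∑ s ∈ S, m t s ^ 2 := by
      rw [Finset.mul_sum, Finset.mul_sum, ← Finset.sum_add_distrib]
      exact Finset.sum_le_sum fun s _ => by nlinarith [sq_nonneg (m s t - m t s)]
    have hexp : ∑ s ∈ insert t S, ∑ r ∈ insert t S, m s r ^ 2 =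
        m t t ^ 2 + ∑ s ∈ S, m t s ^ 2 + (∑ s ∈ S, m s t ^ 2 + ∑ s ∈ S, ∑ r ∈ S, m s r ^ 2) := by
      simp only [Finset.sum_insert ht, Finset.sum_add_distrib]
    rw [hexp]
    have h1 : 0 ≤ ∑ s ∈ S, m t s ^ 2 := Finset.sum_nonneg fun _ _ => sq_nonneg _
    have h2 : 0 ≤ ∑ s ∈ S, m s t ^ 2 := Finset.sum_nonneg fun _ _ => sq_nonneg _
    nlinarith [mul_nonneg hV0 h1, mul_nonneg hV0 h2, sq_nonneg (m t t)]

lemma memLp_quadForm (hζ : IsStandardIID P ζ) (hζ4 : MemLp (ζ 0) 4 P)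
    (m : ℤ → ℤ → ℝ) (S : Finset ℤ) :
    MemLp (fun ω => ∑ s ∈ S, ∑ t ∈ S, m s t * centeredProd ζ s t ω) 2 P :=
  memLp_finsetSum _ fun s _ => memLp_finsetSum _ fun t _ =>
    (memLp_centeredProd hζ hζ4 s t).const_mul _

end QuadraticForm

/-! ### Fourier coefficients on (0, 2π) and the Dirichlet kernel -/

section FourierCoefficients

/-- The Dirichlet kernel `∑_{t=1}^n e^{ity}`. -/
noncomputable def dirichletKer (n : ℕ) (y : ℝ) : ℂ :=
  ∑ t ∈ Finset.Icc 1 n, Complex.exp (Complex.I * (t : ℂ) * (y : ℂ))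

/-- Fourier coefficients over `(0, 2π]`. -/
noncomputable def fc (F : ℝ → ℂ) (s : ℤ) : ℂ :=
  (2 * Real.pi : ℝ)⁻¹ * ∫ x in (0 : ℝ)..2 * Real.pi, Complex.exp (-(Complex.I * s * x)) * F x

/-- Square integrability over `(0, 2π]`. -/
def SqInt (F : ℝ → ℂ) : Prop := MemLp F 2 (volume.restrict (Set.Ioc 0 (2 * Real.pi)))

lemma fc_eq_fourierCoeffOn (F : ℝ → ℂ) (s : ℤ) : fc F s = fourierCoeffOn Real.two_pi_pos F s := by
  rw [fourierCoeffOn_eq_integral, fc]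
  simp only [sub_zero, one_div, Complex.real_smul, smul_eq_mul]
  congr 1
  refine intervalIntegral.integral_congr fun x _ => ?_
  simp only [fourier_coe_apply]
  congr 2
  have := Real.pi_ne_zero
  push_cast
  field_simp
  ring_nf

lemma hasSum_sq_fc {F : ℝ → ℂ} (hF : SqInt F) :
    HasSum (fun s => ‖fc F s‖ ^ 2) ((2 * Real.pi)⁻¹ * ∫ x in (0 : ℝ)..2 * Real.pi, ‖F x‖ ^ 2) := by
  simpa [fc_eq_fourierCoeffOn] using hasSum_sq_fourierCoeffOn Real.two_pi_pos hF

/-- Bessel's inequality. -/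
lemma sum_sq_fc_le {F : ℝ → ℂ} (hF : SqInt F) (S : Finset ℤ) :
    ∑ s ∈ S, ‖fc F s‖ ^ 2 ≤ (2 * Real.pi)⁻¹ * ∫ x in (0 : ℝ)..2 * Real.pi, ‖F x‖ ^ 2 :=
  sum_le_hasSum _ (fun _ _ => sq_nonneg _) (hasSum_sq_fc hF)

lemma SqInt.intervalIntegrable {F : ℝ → ℂ} (hF : SqInt F) :
    IntervalIntegrable F volume 0 (2 * Real.pi) := by
  rw [intervalIntegrable_iff_integrableOn_Ioc_of_le Real.two_pi_pos.le]
  exact hF.integrable (by norm_num)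

lemma SqInt.exp_mul {F : ℝ → ℂ} (hF : SqInt F) (s : ℤ) :
    IntervalIntegrable (fun x : ℝ => Complex.exp (-(Complex.I * s * x)) * F x) volume 0
      (2 * Real.pi) :=
  hF.intervalIntegrable.continuousOn_mul (by fun_prop)

lemma SqInt.sqNorm {F : ℝ → ℂ} (hF : SqInt F) :
    IntervalIntegrable (fun x => ‖F x‖ ^ 2) volume 0 (2 * Real.pi) := by
  rw [intervalIntegrable_iff_integrableOn_Ioc_of_le Real.two_pi_pos.le]
  exact hF.integrable_norm_pow (by norm_num)

lemma sqInt_iff {F : ℝ → ℂ} (hF : AEStronglyMeasurable F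
      (volume.restrict (Set.Ioc 0 (2 * Real.pi)))) :
    SqInt F ↔ IntervalIntegrable (fun x => ‖F x‖ ^ 2) volume 0 (2 * Real.pi) := by
  rw [intervalIntegrable_iff_integrableOn_Ioc_of_le Real.two_pi_pos.le]
  exact memLp_two_iff_integrable_sq_norm hF

lemma fc_add {F G : ℝ → ℂ} (hF : SqInt F) (hG : SqInt G) (s : ℤ) :
    fc (fun x => F x + G x) s = fc F s + fc G s := by
  simp only [fc, mul_add]
  rw [intervalIntegral.integral_add (hF.exp_mul s) (hG.exp_mul s), mul_add]

lemma fc_sub {F G : ℝ → ℂ} (hF : SqInt F) (hG : SqInt G) (s : ℤ) :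
    fc (fun x => F x - G x) s = fc F s - fc G s := by
  simp only [fc, mul_sub]
  rw [intervalIntegral.integral_sub (hF.exp_mul s) (hG.exp_mul s), mul_sub]

lemma fc_const_mul (F : ℝ → ℂ) (c : ℂ) (s : ℤ) : fc (fun x => c * F x) s = c * fc F s := by
  simp only [fc, mul_left_comm _ c, intervalIntegral.integral_const_mul]

lemma fc_finset_sum {ι : Type*} (J : Finset ι) {F : ι → ℝ → ℂ} (hF : ∀ j ∈ J, SqInt (F j))
    (s : ℤ) : fc (fun x => ∑ j ∈ J, F j x) s = ∑ j ∈ J, fc (F j) s := by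
  simp only [fc, Finset.mul_sum]
  rw [intervalIntegral.integral_finsetSum fun j hj => (hF j hj).exp_mul s, Finset.mul_sum]

/-- The endpoints are left out on purpose: the singularity of the transfer function sits at 0 ≡ 2π.
-/
lemma fc_congr {F G : ℝ → ℂ} (h : ∀ x ∈ Set.Ioo 0 (2 * Real.pi), F x = G x) (s : ℤ) :
    fc F s = fc G s := by
  simp only [fc]
  congr 1
  rw [intervalIntegral.integral_of_le Real.two_pi_pos.le,
    intervalIntegral.integral_of_le Real.two_pi_pos.le, integral_Ioc_eq_integral_Ioo,
    integral_Ioc_eq_integral_Ioo]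
  exact setIntegral_congr_fun measurableSet_Ioo fun x hx => by simp only [h x hx]

lemma SqInt.congr {F G : ℝ → ℂ} (hF : SqInt F) (h : ∀ x ∈ Set.Ioo 0 (2 * Real.pi), F x = G x) :
    SqInt G := by
  unfold SqInt at *
  rw [← Measure.restrict_congr_set Ioo_ae_eq_Ioc] at *
  exact hF.ae_eq ((ae_restrict_mem measurableSet_Ioo).mono h)

lemma sqInt_of_continuous {F : ℝ → ℂ} (hF : Continuous F) : SqInt F :=
  (sqInt_iff hF.aestronglyMeasurable).2 ((by fun_prop : Continuous fun x => ‖F x‖ ^ 2).intervalIntegrable _ _)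

lemma SqInt.const_mul {F : ℝ → ℂ} (hF : SqInt F) (c : ℂ) : SqInt fun x => c * F x :=
  MemLp.const_mul hF c

lemma SqInt.bdd_mul {F g : ℝ → ℂ} (hF : SqInt F) {K : ℝ}
    (hg : AEStronglyMeasurable g (volume.restrict (Set.Ioc 0 (2 * Real.pi))))
    (hK : ∀ x ∈ Set.Ioo 0 (2 * Real.pi), ‖g x‖ ≤ K) : SqInt fun x => g x * F x := by
  unfold SqInt at *
  rw [← Measure.restrict_congr_set Ioo_ae_eq_Ioc] at *
  have : MemLp g ∞ (volume.restrict (Set.Ioo 0 (2 * Real.pi))) :=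
    memLp_top_of_bound hg K ((ae_restrict_mem measurableSet_Ioo).mono hK)
  exact hF.mul' this

lemma integral_exp_int (m : ℤ) :
    ∫ x in (0 : ℝ)..2 * Real.pi, Complex.exp (Complex.I * m * x) =
      if m = 0 then ((2 * Real.pi : ℝ) : ℂ) else 0 := by
  split_ifs with h
  · simp [h]
  · have hc : Complex.I * (m : ℂ) ≠ 0 := mul_ne_zero Complex.I_ne_zero (by exact_mod_cast h)
    rw [integral_exp_mul_complex hc]
    have : Complex.I * (m : ℂ) * ((2 * Real.pi : ℝ) : ℂ) = m * (2 * Real.pi * Complex.I) := by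
      push_cast; ring
    rw [this, Complex.exp_int_mul_two_pi_mul_I]
    simp

lemma fc_exp (m s : ℤ) :
    fc (fun x : ℝ => Complex.exp (Complex.I * m * x)) s = if s = m then 1 else 0 := by
  have h : ∀ x : ℝ, Complex.exp (-(Complex.I * s * x)) * Complex.exp (Complex.I * m * x) =
      Complex.exp (Complex.I * ((m - s : ℤ) : ℂ) * x) := fun x => by
    rw [← Complex.exp_add]; push_cast; ring_nf
  simp only [fc, h, integral_exp_int, sub_eq_zero]
  have := Real.pi_ne_zero
  split_ifs with h1 h2 h2
  · push_cast; field_simp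
  · exact absurd h1.symm h2
  · exact absurd h2.symm h1
  · simp

lemma fc_trigPoly (T : Finset ℤ) (c : ℤ → ℂ) (s : ℤ) :
    fc (fun x : ℝ => ∑ t ∈ T, c t * Complex.exp (Complex.I * t * x)) s =
      if s ∈ T then c s else 0 := by
  rw [fc_finset_sum T (fun t _ => sqInt_of_continuous (by fun_prop))]
  simp only [fc_const_mul, fc_exp]
  simp

/-- Parseval's identity for trigonometric polynomials. -/
lemma integral_sq_trigPoly (T : Finset ℤ) (c : ℤ → ℂ) :
    (2 * Real.pi)⁻¹ * ∫ x in (0 : ℝ)..2 * Real.pi,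
      ‖∑ t ∈ T, c t * Complex.exp (Complex.I * t * x)‖ ^ 2 = ∑ t ∈ T, ‖c t‖ ^ 2 := by
  have h1 := hasSum_sq_fc (F := fun x : ℝ => ∑ t ∈ T, c t * Complex.exp (Complex.I * t * x))
    (sqInt_of_continuous (by fun_prop))
  simp only [fc_trigPoly] at h1
  have h2 : HasSum (fun s => ‖if s ∈ T then c s else 0‖ ^ 2)
      (∑ t ∈ T, ‖if t ∈ T then c t else 0‖ ^ 2) :=
    hasSum_sum_of_ne_finset_zero fun s hs => by simp [hs]
  rw [h1.unique h2]
  exact Finset.sum_congr rfl fun t ht => by simp [ht]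

/-- The integers `1, …, n`. -/
noncomputable def obs (n : ℕ) : Finset ℤ := Finset.Icc 1 (n : ℤ)

lemma sum_obs {M : Type*} [AddCommMonoid M] (n : ℕ) (f : ℤ → M) :
    ∑ t ∈ obs n, f t = ∑ t ∈ Finset.Icc 1 n, f (t : ℤ) := by
  symm
  refine Finset.sum_bij (fun t _ => (t : ℤ)) ?_ ?_ ?_ ?_
  · intro t ht
    simp only [obs, Finset.mem_Icc] at *
    omega
  · intro a _ b _ h
    exact_mod_cast h
  · intro t ht
    simp only [obs, Finset.mem_Icc] at ht
    exact ⟨t.toNat, by simp only [Finset.mem_Icc]; omega, by omega⟩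
  · intros; rfl

lemma dirichletKer_sub (n : ℕ) (x u : ℝ) :
    dirichletKer n (x - u) = ∑ t ∈ obs n,
      Complex.exp (-(Complex.I * t * u)) * Complex.exp (Complex.I * t * x) := by
  rw [sum_obs, dirichletKer]
  refine Finset.sum_congr rfl fun t _ => ?_
  rw [← Complex.exp_add]
  push_cast
  ring_nf

@[fun_prop]
lemma continuous_dirichletKer (n : ℕ) : Continuous (dirichletKer n) := by
  unfold dirichletKer; fun_prop

lemma fc_dirichletKer (n : ℕ) (u : ℝ) (s : ℤ) :
    fc (fun x => dirichletKer n (x - u)) s =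
      if s ∈ obs n then Complex.exp (-(Complex.I * s * u)) else 0 := by
  simp only [dirichletKer_sub]
  exact fc_trigPoly (obs n) (fun t => Complex.exp (-(Complex.I * t * u))) s

lemma norm_exp_neg_I_mul (t : ℤ) (u : ℝ) : ‖Complex.exp (-(Complex.I * t * u))‖ = 1 := by
  have : -(Complex.I * t * u) = ((-(t * u) : ℝ) : ℂ) * Complex.I := by push_cast; ring
  rw [this, Complex.norm_exp_ofReal_mul_I]

lemma integral_sq_dirichletKer (n : ℕ) (u : ℝ) :
    ∫ x in (0 : ℝ)..2 * Real.pi, ‖dirichletKer n (x - u)‖ ^ 2 = 2 * Real.pi * n := by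
  have h := integral_sq_trigPoly (obs n) (fun t => Complex.exp (-(Complex.I * t * u)))
  simp only [← dirichletKer_sub, norm_exp_neg_I_mul] at h
  have hc : ∑ t ∈ obs n, (1 : ℝ) ^ 2 = n := by simp [obs]
  rw [hc] at h
  have := Real.pi_pos
  field_simp at h
  linarith

lemma dirichletKer_mul (n : ℕ) (y : ℝ) :
    dirichletKer n y * (Complex.exp (Complex.I * y) - 1) =
        Complex.exp (Complex.I * y) * (Complex.exp (Complex.I * (n * y : ℝ)) - 1) := by
  unfold dirichletKer
  induction n with
  | zero => simp
  | succ n ih =>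
    rw [Finset.sum_Icc_succ_top (by omega), add_mul, ih]
    have e1 : Complex.exp (Complex.I * ((n + 1 : ℕ) : ℂ) * y) =
        Complex.exp (Complex.I * (n * y : ℝ)) * Complex.exp (Complex.I * y) := by
      rw [← Complex.exp_add]; push_cast; ring_nf
    have e2 : Complex.exp (Complex.I * ((n + 1 : ℕ) * y : ℝ)) =
        Complex.exp (Complex.I * (n * y : ℝ)) * Complex.exp (Complex.I * y) := by
      rw [← Complex.exp_add]; push_cast; ring_nf
    rw [e1, e2]
    ring

/-- The left side is Jordan's bound for 2|sin(y/2)|. -/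
lemma abs_le_norm_exp_sub_one {y : ℝ} (hy : |y| ≤ Real.pi) :
    2 / Real.pi * |y| ≤ ‖Complex.exp (Complex.I * y) - 1‖ := by
  rw [Complex.norm_exp_I_mul_ofReal_sub_one, norm_mul, Real.norm_eq_abs, Real.norm_eq_abs]
  have := Real.mul_abs_le_abs_sin (x := y / 2) (by rw [abs_div]; norm_num; linarith)
  rw [abs_div, abs_two] at this
  rw [abs_two]
  linarith

/-- `|y| |D_n(y)| ≤ π` for `|y| ≤ π`. -/
lemma abs_mul_norm_dirichletKer_le (n : ℕ) {y : ℝ} (hy : |y| ≤ Real.pi) :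
    |y| * ‖dirichletKer n y‖ ≤ Real.pi := by
  rcases eq_or_ne y 0 with rfl | hy0
  · simp [Real.pi_pos.le]
  have hnum : ‖Complex.exp (Complex.I * y) * (Complex.exp (Complex.I * (n * y : ℝ)) - 1)‖ ≤ 2 := by
    rw [norm_mul, Complex.norm_exp_I_mul_ofReal, one_mul, Complex.norm_exp_I_mul_ofReal_sub_one,
      norm_mul, Real.norm_eq_abs, Real.norm_eq_abs]
    have := Real.abs_sin_le_one (n * y / 2)
    norm_num
    linarith
  have hden := abs_le_norm_exp_sub_one hy
  rw [← dirichletKer_mul, norm_mul] at hnum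
  have h3 : ‖dirichletKer n y‖ * (2 / Real.pi * |y|) ≤ 2 :=
    (mul_le_mul_of_nonneg_left hden (norm_nonneg _)).trans hnum
  have hpi := Real.pi_pos
  have h4 : ‖dirichletKer n y‖ * (2 / Real.pi * |y|) = 2 / Real.pi * (|y| * ‖dirichletKer n y‖) := by
    ring
  rw [h4, div_mul_eq_mul_div, div_le_iff₀ hpi] at h3
  linarith

end FourierCoefficients

/-! ### Hilbert-Schmidt norms of sums of rank-one matrices -/

section Tensor

variable {ι : Type*} (J : Finset ι) (S : Finset ℤ)

/-- Row s of the matrix is, up to conjugation, the combination of the w_j with coefficients conj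
(v_j s). The Riesz bound applies row by row, and no orthogonality of the v_j is needed. -/
lemma sum_sq_tensor_le (v w : ι → ℤ → ℂ) {L : ℝ}
    (hw : ∀ x : ι → ℂ, ∑ t ∈ S, ‖∑ j ∈ J, x j * w j t‖ ^ 2 ≤ L * ∑ j ∈ J, ‖x j‖ ^ 2) :
    ∑ s ∈ S, ∑ t ∈ S, ‖∑ j ∈ J, v j s * starRingEnd ℂ (w j t)‖ ^ 2 ≤
      L * ∑ j ∈ J, ∑ s ∈ S, ‖v j s‖ ^ 2 := by
  rw [Finset.sum_comm (s := J), Finset.mul_sum]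
  refine Finset.sum_le_sum fun s _ => ?_
  have h := hw fun j => starRingEnd ℂ (v j s)
  simp only [RCLike.norm_conj] at h
  refine le_trans (le_of_eq (Finset.sum_congr rfl fun t _ => ?_)) h
  rw [← RCLike.norm_conj]
  simp [map_sum]

lemma sum_sq_tensor_le' (v w : ι → ℤ → ℂ) {L : ℝ}
    (hw : ∀ x : ι → ℂ, ∑ t ∈ S, ‖∑ j ∈ J, x j * w j t‖ ^ 2 ≤ L * ∑ j ∈ J, ‖x j‖ ^ 2) :
    ∑ s ∈ S, ∑ t ∈ S, ‖∑ j ∈ J, w j s * starRingEnd ℂ (v j t)‖ ^ 2 ≤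
      L * ∑ j ∈ J, ∑ s ∈ S, ‖v j s‖ ^ 2 := by
  refine le_trans (le_of_eq ?_) (sum_sq_tensor_le J S v w hw)
  rw [Finset.sum_comm]
  refine Finset.sum_congr rfl fun s _ => Finset.sum_congr rfl fun t _ => ?_
  rw [← RCLike.norm_conj]
  simp [map_sum, mul_comm]

/-- For families without a Riesz bound: Cauchy-Schwarz in j with weights |β_j| factorizes the bound
in s and t. -/
lemma sum_sq_tensor_self_le (β : ι → ℝ) (p : ι → ℤ → ℂ) :
    ∑ s ∈ S, ∑ t ∈ S, ‖∑ j ∈ J, (β j : ℂ) * p j s * starRingEnd ℂ (p j t)‖ ^ 2 ≤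
      (∑ j ∈ J, |β j| * ∑ s ∈ S, ‖p j s‖ ^ 2) ^ 2 := by
  have key : ∀ s t, ‖∑ j ∈ J, (β j : ℂ) * p j s * starRingEnd ℂ (p j t)‖ ^ 2 ≤
      (∑ j ∈ J, |β j| * ‖p j s‖ ^ 2) * ∑ j ∈ J, |β j| * ‖p j t‖ ^ 2 := by
    intro s t
    have h1 : ‖∑ j ∈ J, (β j : ℂ) * p j s * starRingEnd ℂ (p j t)‖ ≤
        ∑ j ∈ J, |β j| * (‖p j s‖ * ‖p j t‖) := by
      refine (norm_sum_le _ _).trans (le_of_eq (Finset.sum_congr rfl fun j _ => ?_))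
      simp [mul_assoc]
    refine (pow_le_pow_left₀ (norm_nonneg _) h1 2).trans ?_
    refine Finset.sum_sq_le_sum_mul_sum_of_sq_le_mul J (fun j _ => by positivity)
      (fun j _ => by positivity) fun j _ => le_of_eq (by ring)
  calc _ ≤ ∑ s ∈ S, ∑ t ∈ S,
        (∑ j ∈ J, |β j| * ‖p j s‖ ^ 2) * ∑ j ∈ J, |β j| * ‖p j t‖ ^ 2 :=
        Finset.sum_le_sum fun s _ => Finset.sum_le_sum fun t _ => key s t
    _ = _ := by
        rw [← Finset.sum_mul_sum, ← sq, Finset.sum_comm]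
        simp only [Finset.mul_sum]

end Tensor

/-! ### Orthogonality at the Fourier frequencies -/

section DFT

lemma freq_pos {n j : ℕ} (hj : j ∈ idx n) : 0 < freq n j := by
  simp only [idx, Finset.mem_Icc] at hj
  have h1 : 0 < (j : ℝ) := by exact_mod_cast (by omega : 0 < j)
  have h2 : 0 < (n : ℝ) := by exact_mod_cast (by omega : 0 < n)
  unfold freq
  have := Real.pi_pos
  positivity

lemma freq_lt_pi {n j : ℕ} (hj : j ∈ idx n) : freq n j < Real.pi := by
  simp only [idx, Finset.mem_Icc] at hj
  have h1 : 2 * (j : ℝ) < n := by exact_mod_cast (by omega : 2 * j < n)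
  have h2 : 0 < (n : ℝ) := by exact_mod_cast (by omega : 0 < n)
  unfold freq
  rw [div_lt_iff₀ h2]
  nlinarith [Real.pi_pos]

/-- For k ≠ j the difference y of frequencies satisfies n y ∈ 2πℤ, so the numerator of the geometric
sum vanishes, while 0 < |y| ≤ π keeps e^{iy} ≠ 1. -/
lemma dirichletKer_freq_sub {n j k : ℕ} (hj : j ∈ idx n) (hk : k ∈ idx n) :
    dirichletKer n (freq n k - freq n j) = if k = j then (n : ℂ) else 0 := by
  split_ifs with h
  · simp [h, dirichletKer]
  · set y := freq n k - freq n j with hy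
    have hn : (n : ℝ) ≠ 0 := by
      simp only [idx, Finset.mem_Icc] at hj
      exact_mod_cast (by omega : n ≠ 0)
    have hyabs : |y| ≤ Real.pi := by
      rw [abs_le]
      constructor <;> linarith [freq_pos hj, freq_pos hk, freq_lt_pi hj, freq_lt_pi hk]
    have hy0 : y ≠ 0 := by
      intro h0
      have h1 : (k : ℝ) - j = 0 := by
        have h2 : y = 2 * Real.pi / n * ((k : ℝ) - j) := by rw [hy, freq, freq]; ring
        rw [h2] at h0
        have h3 : 2 * Real.pi / (n : ℝ) ≠ 0 := div_ne_zero (by simp [Real.pi_ne_zero]) hn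
        exact (mul_eq_zero.mp h0).resolve_left h3
      exact h (by exact_mod_cast sub_eq_zero.mp h1)
    have hne : Complex.exp (Complex.I * y) - 1 ≠ 0 := by
      rw [← norm_pos_iff]
      refine lt_of_lt_of_le ?_ (abs_le_norm_exp_sub_one hyabs)
      have := Real.pi_pos
      have := abs_pos.mpr hy0
      positivity
    have h1 : Complex.exp (Complex.I * (n * y : ℝ)) = 1 := by
      have : Complex.I * ((n * y : ℝ) : ℂ) =
          ((k - j : ℤ) : ℂ) * (2 * Real.pi * Complex.I) := by
        have h2 : n * y = 2 * Real.pi * ((k : ℝ) - j) := by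
          rw [hy, freq, freq]; field_simp
        rw [h2]; push_cast; ring
      rw [this, Complex.exp_int_mul_two_pi_mul_I]
    have h2 := dirichletKer_mul n y
    rw [h1, sub_self, mul_zero] at h2
    exact (mul_eq_zero.mp h2).resolve_right hne

/-- Parseval's identity for the discrete Fourier transform. -/
lemma sum_sq_dft (n : ℕ) (x : ℕ → ℂ) :
    ∑ t ∈ obs n, ‖∑ j ∈ idx n, x j * Complex.exp (-(Complex.I * t * (freq n j : ℂ)))‖ ^ 2 =
      n * ∑ j ∈ idx n, ‖x j‖ ^ 2 := by
  have hexp : ∀ t : ℤ, ∀ j k : ℕ, Complex.exp (-(Complex.I * t * (freq n j : ℂ))) *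
      starRingEnd ℂ (Complex.exp (-(Complex.I * t * (freq n k : ℂ)))) =
      Complex.exp (Complex.I * t * ((freq n k - freq n j : ℝ) : ℂ)) := by
    intro t j k
    rw [← Complex.exp_conj, ← Complex.exp_add]
    simp only [map_neg, map_mul, Complex.conj_I, Complex.conj_ofReal, map_intCast]
    push_cast
    ring_nf
  have hD : ∀ j ∈ idx n, ∀ k ∈ idx n,
      ∑ t ∈ obs n, Complex.exp (Complex.I * t * ((freq n k - freq n j : ℝ) : ℂ)) =
        if k = j then (n : ℂ) else 0 := by
    intro j hj k hk
    rw [← dirichletKer_freq_sub hj hk, sum_obs, dirichletKer]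
    push_cast
    rfl
  have hC : ((∑ t ∈ obs n,
      ‖∑ j ∈ idx n, x j * Complex.exp (-(Complex.I * t * (freq n j : ℂ)))‖ ^ 2 : ℝ) : ℂ) =
      ((n * ∑ j ∈ idx n, ‖x j‖ ^ 2 : ℝ) : ℂ) := by
    push_cast
    simp only [← Complex.mul_conj', map_sum, map_mul, Finset.sum_mul_sum]
    rw [Finset.sum_comm, Finset.mul_sum]
    refine Finset.sum_congr rfl fun j hj => ?_
    rw [Finset.sum_comm]
    have : ∀ k ∈ idx n, ∑ t ∈ obs n, x j * Complex.exp (-(Complex.I * t * (freq n j : ℂ))) *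
        (starRingEnd ℂ (x k) *
          starRingEnd ℂ (Complex.exp (-(Complex.I * t * (freq n k : ℂ))))) =
        if k = j then n * (x j * starRingEnd ℂ (x j)) else 0 := by
      intro k hk
      have h1 : ∀ t ∈ obs n, x j * Complex.exp (-(Complex.I * t * (freq n j : ℂ))) *
        (starRingEnd ℂ (x k) *
          starRingEnd ℂ (Complex.exp (-(Complex.I * t * (freq n k : ℂ))))) =
          (x j * starRingEnd ℂ (x k)) *
            Complex.exp (Complex.I * t * ((freq n k - freq n j : ℝ) : ℂ)) := by
        intro t _
        rw [← hexp]; ring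
      rw [Finset.sum_congr rfl h1, ← Finset.mul_sum, hD j hj k hk]
      split_ifs with h
      · rw [h]; ring
      · simp
    rw [Finset.sum_congr rfl this]
    simp [hj]
  exact_mod_cast hC

lemma sqInt_dirichletKer (n : ℕ) (u : ℝ) : SqInt fun x => dirichletKer n (x - u) :=
  sqInt_of_continuous (by fun_prop)

/-- The families `fc (g D_n(· - u_j))`, `j ∈ idx n`, satisfy a Riesz upper bound. -/
lemma sum_sq_fc_family_le (n : ℕ) {g : ℝ → ℂ} {K : ℝ}
    (hg : AEStronglyMeasurable g (volume.restrict (Set.Ioc 0 (2 * Real.pi))))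
    (hK : ∀ x ∈ Set.Ioo 0 (2 * Real.pi), ‖g x‖ ≤ K) (S : Finset ℤ) (x : ℕ → ℂ) :
    ∑ t ∈ S, ‖∑ j ∈ idx n, x j * fc (fun y => g y * dirichletKer n (y - freq n j)) t‖ ^ 2 ≤
      K ^ 2 * n * ∑ j ∈ idx n, ‖x j‖ ^ 2 := by
  let F : ℝ → ℂ := fun y => ∑ j ∈ idx n, x j * dirichletKer n (y - freq n j)
  have hFc : Continuous F := by fun_prop
  have hF : SqInt F := sqInt_of_continuous hFc
  have hgF : SqInt fun y => g y * F y := hF.bdd_mul hg hK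
  have h1 : ∀ t, ∑ j ∈ idx n, x j * fc (fun y => g y * dirichletKer n (y - freq n j)) t =
      fc (fun y => g y * F y) t := by
    intro t
    have : (fun y => g y * F y) =
        fun y => ∑ j ∈ idx n, x j * (g y * dirichletKer n (y - freq n j)) := by
      funext y
      simp only [F, Finset.mul_sum]
      exact Finset.sum_congr rfl fun j _ => by ring
    rw [this, fc_finset_sum _ fun j _ =>
      (((sqInt_dirichletKer n (freq n j)).bdd_mul hg hK).const_mul (x j))]
    simp only [fc_const_mul]
  have hpi := Real.pi_pos
  -- The combination is the coefficient sequence of g F, with F a trigonometric polynomial. Bessel,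
  -- |g| ≤ K, Parseval for F and discrete Parseval then give the constant K²n.
  calc _ = ∑ t ∈ S, ‖fc (fun y => g y * F y) t‖ ^ 2 := by simp only [h1]
    _ ≤ (2 * Real.pi)⁻¹ * ∫ y in (0 : ℝ)..2 * Real.pi, ‖g y * F y‖ ^ 2 := sum_sq_fc_le hgF S
    _ ≤ (2 * Real.pi)⁻¹ * ∫ y in (0 : ℝ)..2 * Real.pi, K ^ 2 * ‖F y‖ ^ 2 := by
        refine mul_le_mul_of_nonneg_left ?_ (by positivity)
        refine intervalIntegral.integral_mono_on_of_le_Ioo Real.two_pi_pos.le hgF.sqNorm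
          (hF.sqNorm.const_mul _) fun y hy => ?_
        rw [norm_mul, mul_pow]
        exact mul_le_mul_of_nonneg_right (pow_le_pow_left₀ (norm_nonneg _) (hK y hy) 2)
          (sq_nonneg _)
    _ = K ^ 2 * ((2 * Real.pi)⁻¹ * ∫ y in (0 : ℝ)..2 * Real.pi, ‖F y‖ ^ 2) := by
        rw [intervalIntegral.integral_const_mul]; ring
    _ = K ^ 2 * ∑ t ∈ obs n,
          ‖∑ j ∈ idx n, x j * Complex.exp (-(Complex.I * t * (freq n j : ℂ)))‖ ^ 2 := by
        rw [← integral_sq_trigPoly]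
        congr 4
        funext y
        simp only [F, dirichletKer_sub, Finset.mul_sum, Finset.sum_mul]
        rw [Finset.sum_comm]
        simp only [mul_assoc]
    _ = _ := by rw [sum_sq_dft]; ring

end DFT

/-! ### Hilbert-Schmidt norm of the error matrix -/

section KernelMatrix

/-- Fourier coefficients of `A D_n(· - u_j)`: the weights of the innovations in the discrete
Fourier transform of `X` at the `j`-th Fourier frequency. -/
noncomputable def filteredCoeff (A : ℝ → ℂ) (n j : ℕ) (s : ℤ) : ℂ :=
  fc (fun x => A x * dirichletKer n (x - freq n j)) s

/-- Fourier coefficients of `D_n(· - u_j)`. -/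
noncomputable def dftCoeff (n j : ℕ) (s : ℤ) : ℂ :=
  fc (fun x => dirichletKer n (x - freq n j)) s

/-- Up to the factor `(2πn)⁻¹`, the matrix of `Q_{n,X} - Q_{n,ζ}` as a quadratic form in `ζ`. -/
noncomputable def kernelEntry (A : ℝ → ℂ) (b : ℕ → ℝ) (n : ℕ) (s t : ℤ) : ℂ :=
  ∑ j ∈ idx n, (b j : ℂ) * (filteredCoeff A n j s * starRingEnd ℂ (filteredCoeff A n j t) -
    (‖A (freq n j)‖ ^ 2 : ℝ) * (dftCoeff n j s * starRingEnd ℂ (dftCoeff n j t)))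

lemma norm_add_five_sq_le (a b c d e : ℂ) :
    ‖a + b + c + d + e‖ ^ 2 ≤
      5 * (‖a‖ ^ 2 + ‖b‖ ^ 2 + ‖c‖ ^ 2 + ‖d‖ ^ 2 + ‖e‖ ^ 2) := by
  have h : ‖a + b + c + d + e‖ ≤ ‖a‖ + ‖b‖ + ‖c‖ + ‖d‖ + ‖e‖ := by
    refine (norm_add_le _ _).trans (add_le_add_left ?_ _)
    refine (norm_add_le _ _).trans (add_le_add_left ?_ _)
    exact norm_add₃_le
  refine (pow_le_pow_left₀ (norm_nonneg _) h 2).trans ?_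
  nlinarith [sq_nonneg (‖a‖ - ‖b‖), sq_nonneg (‖a‖ - ‖c‖), sq_nonneg (‖a‖ - ‖d‖),
    sq_nonneg (‖a‖ - ‖e‖), sq_nonneg (‖b‖ - ‖c‖), sq_nonneg (‖b‖ - ‖d‖), sq_nonneg (‖b‖ - ‖e‖),
    sq_nonneg (‖c‖ - ‖d‖), sq_nonneg (‖c‖ - ‖e‖), sq_nonneg (‖d‖ - ‖e‖)]

lemma freq_mem_Ioo {n j : ℕ} (hj : j ∈ idx n) : freq n j ∈ Set.Ioo 0 (2 * Real.pi) :=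
  ⟨freq_pos hj, by linarith [freq_lt_pi hj, Real.pi_pos]⟩

/-- `pb` and `qb` bound the energies of the relative error of H and of the absolute error of g near
u_j. They enter linearly, weighted by β_j² with β_j = b_j |H(u_j)|², wherever an orthogonal leg is
available; the quadratic last term is the price of p ⊗ conj p. -/
lemma sum_sq_kernelEntry_le {A H g : ℝ → ℂ} {K : ℝ} {n : ℕ} {b pb qb : ℕ → ℝ} (hA : SqInt A)
    (hg : AEStronglyMeasurable g (volume.restrict (Set.Ioc 0 (2 * Real.pi))))
    (hK : ∀ x ∈ Set.Ioo 0 (2 * Real.pi), ‖g x‖ ≤ K)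
    (hHg : ∀ x ∈ Set.Ioo 0 (2 * Real.pi), A x = H x * g x)
    (hH : ∀ j ∈ idx n, H (freq n j) ≠ 0)
    (hp : ∀ j ∈ idx n, ∫ x in (0 : ℝ)..2 * Real.pi,
      ‖(H x / H (freq n j) - 1) * (g x * dirichletKer n (x - freq n j))‖ ^ 2 ≤ pb j)
    (hq : ∀ j ∈ idx n, ∫ x in (0 : ℝ)..2 * Real.pi,
      ‖(g x - g (freq n j)) * dirichletKer n (x - freq n j)‖ ^ 2 ≤ qb j) (S : Finset ℤ) :
    ∑ s ∈ S, ∑ t ∈ S, ‖kernelEntry A b n s t‖ ^ 2 ≤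
      10 * K ^ 2 * n * ∑ j ∈ idx n, (b j * ‖H (freq n j)‖ ^ 2) ^ 2 * (pb j + qb j) +
        5 * (∑ j ∈ idx n, |b j * ‖H (freq n j)‖ ^ 2| * pb j) ^ 2 := by
  have hpi := Real.pi_pos
  let u := freq n
  let β : ℕ → ℝ := fun j => b j * ‖H (u j)‖ ^ 2
  let D : ℕ → ℝ → ℂ := fun j x => dirichletKer n (x - u j)
  have hD : ∀ j, SqInt (D j) := fun j => sqInt_dirichletKer n (u j)
  have hgD : ∀ j, SqInt fun x => g x * D j x := fun j => (hD j).bdd_mul hg hK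
  have hqI : ∀ j, SqInt fun x => (g x - g (u j)) * D j x := fun j => by
    have : SqInt fun x => g x * D j x - g (u j) * D j x :=
      MemLp.sub (hgD j) ((hD j).const_mul _)
    exact this.congr fun x _ => by ring
  have hAD : ∀ j, SqInt fun x => A x * D j x := fun j => by
    have hc : Continuous (D j) := by fun_prop
    obtain ⟨M, hM⟩ := isCompact_Icc.exists_bound_of_continuousOn
      (s := Set.Icc 0 (2 * Real.pi)) hc.continuousOn
    refine (hA.bdd_mul hc.aestronglyMeasurable
      (fun x hx => hM x (Set.Ioo_subset_Icc_self hx))).congr fun x _ => by ring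
  have hpI : ∀ j ∈ idx n, SqInt fun x => (H x / H (u j) - 1) * (g x * D j x) := fun j hj => by
    have : SqInt fun x => (H (u j))⁻¹ * (A x * D j x) - g x * D j x :=
      MemLp.sub ((hAD j).const_mul _) (hgD j)
    refine this.congr fun x hx => ?_
    rw [hHg x hx]; ring
  let p : ℕ → ℤ → ℂ := fun j => fc fun x => (H x / H (u j) - 1) * (g x * D j x)
  let e : ℕ → ℤ → ℂ := fun j => fc fun x => g x * D j x
  let q : ℕ → ℤ → ℂ := fun j => fc fun x => (g x - g (u j)) * D j x
  let f : ℕ → ℤ → ℂ := fun j s => g (u j) * dftCoeff n j s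
  have hC : ∀ j ∈ idx n, ∀ s, filteredCoeff A n j s = H (u j) * (p j s + e j s) := by
    intro j hj s
    have h0 : H (u j) ≠ 0 := hH j hj
    simp only [p, e]
    rw [← fc_add (hpI j hj) (hgD j), ← fc_const_mul]
    refine fc_congr (fun x hx => ?_) s
    simp only [D, u] at h0 ⊢
    rw [hHg x hx]
    field_simp
    ring
  have he : ∀ j s, e j s = q j s + f j s := by
    intro j s
    simp only [e, q, f, dftCoeff]
    rw [← fc_const_mul, ← fc_add (hqI j) ((hD j).const_mul _)]
    refine fc_congr (fun x _ => ?_) s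
    simp only [D, u]
    ring
  have hAu : ∀ j ∈ idx n, A (u j) = H (u j) * g (u j) := fun j hj => hHg _ (freq_mem_Ioo hj)
  -- Expand (p + e) ⊗ conj (p + e) and use e ⊗ conj e - f ⊗ conj f = q ⊗ conj e + f ⊗ conj q, where
  -- e = q + f. The weight β_j stays with the leg p or q, so that the other leg is a pure Riesz
  -- family.
  have hsplit : ∀ s t, kernelEntry A b n s t =
      ∑ j ∈ idx n, (β j : ℂ) * p j s * starRingEnd ℂ (p j t) +
      ∑ j ∈ idx n, (β j : ℂ) * p j s * starRingEnd ℂ (e j t) +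
      ∑ j ∈ idx n, e j s * starRingEnd ℂ ((β j : ℂ) * p j t) +
      ∑ j ∈ idx n, (β j : ℂ) * q j s * starRingEnd ℂ (e j t) +
      ∑ j ∈ idx n, f j s * starRingEnd ℂ ((β j : ℂ) * q j t) := by
    intro s t
    simp only [kernelEntry, ← Finset.sum_add_distrib]
    refine Finset.sum_congr rfl fun j hj => ?_
    rw [hC j hj, hC j hj, show A (freq n j) = H (u j) * g (u j) from hAu j hj]
    have hn1 : ((‖H (u j) * g (u j)‖ ^ 2 : ℝ) : ℂ) =
        ((‖H (u j)‖ ^ 2 : ℝ) : ℂ) * (g (u j) * starRingEnd ℂ (g (u j))) := by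
      rw [norm_mul, mul_pow, Complex.mul_conj']
      push_cast; ring
    have hn2 : ((‖H (u j)‖ ^ 2 : ℝ) : ℂ) = H (u j) * starRingEnd ℂ (H (u j)) := by
      rw [Complex.mul_conj']; push_cast; ring
    have hβ : (β j : ℂ) = b j * (H (u j) * starRingEnd ℂ (H (u j))) := by
      rw [← hn2]; simp only [β]; push_cast; ring
    have hcb : starRingEnd ℂ (β j : ℂ) = β j := Complex.conj_ofReal _
    rw [hn1, hn2]
    simp only [map_mul, map_add, hcb, he, f]
    simp only [hβ]
    ring
  have hwe : ∀ x : ℕ → ℂ, ∑ t ∈ S, ‖∑ j ∈ idx n, x j * e j t‖ ^ 2 ≤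
      K ^ 2 * n * ∑ j ∈ idx n, ‖x j‖ ^ 2 := fun x => sum_sq_fc_family_le n hg hK S x
  have hwf : ∀ x : ℕ → ℂ, ∑ t ∈ S, ‖∑ j ∈ idx n, x j * f j t‖ ^ 2 ≤
      K ^ 2 * n * ∑ j ∈ idx n, ‖x j‖ ^ 2 := by
    -- The Riesz bound for f is that of the bare kernels (g = 1), applied to the coefficients x_j
    -- g(u_j).
    intro x
    have h := sum_sq_fc_family_le n (g := fun _ => 1) (K := 1) aestronglyMeasurable_const
      (fun _ _ => by simp) S (fun j => x j * g (u j))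
    simp only [one_mul, one_pow] at h
    refine le_trans (le_of_eq ?_) (h.trans ?_)
    · simp only [f, dftCoeff, mul_assoc, u]
    · rw [mul_comm (K ^ 2) (n : ℝ), mul_assoc]
      refine mul_le_mul_of_nonneg_left ?_ (Nat.cast_nonneg n)
      rw [Finset.mul_sum]
      refine Finset.sum_le_sum fun j hj => ?_
      rw [norm_mul, mul_pow, mul_comm]
      exact mul_le_mul_of_nonneg_right
        (pow_le_pow_left₀ (norm_nonneg _) (hK _ (freq_mem_Ioo hj)) 2) (sq_nonneg _)
  have hinv : (2 * Real.pi)⁻¹ ≤ 1 := by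
    rw [inv_le_one₀ (by positivity)]
    linarith [Real.pi_gt_three]
  have bess : ∀ {F : ℝ → ℂ} {B : ℝ}, SqInt F → ∫ x in (0 : ℝ)..2 * Real.pi, ‖F x‖ ^ 2 ≤ B →
      ∑ s ∈ S, ‖fc F s‖ ^ 2 ≤ B := by
    intro F B hF hB
    have h0 : 0 ≤ ∫ x in (0 : ℝ)..2 * Real.pi, ‖F x‖ ^ 2 :=
      intervalIntegral.integral_nonneg Real.two_pi_pos.le fun _ _ => sq_nonneg _
    calc _ ≤ (2 * Real.pi)⁻¹ * ∫ x in (0 : ℝ)..2 * Real.pi, ‖F x‖ ^ 2 := sum_sq_fc_le hF S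
      _ ≤ 1 * ∫ x in (0 : ℝ)..2 * Real.pi, ‖F x‖ ^ 2 := mul_le_mul_of_nonneg_right hinv h0
      _ ≤ B := by linarith
  have hpS : ∀ j ∈ idx n, ∑ s ∈ S, ‖p j s‖ ^ 2 ≤ pb j := fun j hj => bess (hpI j hj) (hp j hj)
  have hqS : ∀ j ∈ idx n, ∑ s ∈ S, ‖q j s‖ ^ 2 ≤ qb j := fun j hj => bess (hqI j) (hq j hj)
  have hscale : ∀ (v : ℕ → ℤ → ℂ) (vb : ℕ → ℝ), (∀ j ∈ idx n, ∑ s ∈ S, ‖v j s‖ ^ 2 ≤ vb j) →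
      K ^ 2 * n * ∑ j ∈ idx n, ∑ s ∈ S, ‖(β j : ℂ) * v j s‖ ^ 2 ≤
        K ^ 2 * n * ∑ j ∈ idx n, β j ^ 2 * vb j := by
    intro v vb hv
    refine mul_le_mul_of_nonneg_left (Finset.sum_le_sum fun j hj => ?_) (by positivity)
    simp only [norm_mul, mul_pow, Complex.norm_real, Real.norm_eq_abs, sq_abs, ← Finset.mul_sum]
    exact mul_le_mul_of_nonneg_left (hv j hj) (sq_nonneg _)
  have t1 := sum_sq_tensor_self_le (idx n) S β p
  have t2 := (sum_sq_tensor_le (idx n) S (fun j s => (β j : ℂ) * p j s) e hwe).trans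
    (hscale p pb hpS)
  have t3 := (sum_sq_tensor_le' (idx n) S (fun j s => (β j : ℂ) * p j s) e hwe).trans
    (hscale p pb hpS)
  have t4 := (sum_sq_tensor_le (idx n) S (fun j s => (β j : ℂ) * q j s) e hwe).trans
    (hscale q qb hqS)
  have t5 := (sum_sq_tensor_le' (idx n) S (fun j s => (β j : ℂ) * q j s) f hwf).trans
    (hscale q qb hqS)
  have t1' : (∑ j ∈ idx n, |β j| * ∑ s ∈ S, ‖p j s‖ ^ 2) ^ 2 ≤
      (∑ j ∈ idx n, |β j| * pb j) ^ 2 := by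
    refine pow_le_pow_left₀ (Finset.sum_nonneg fun j _ => by positivity)
      (Finset.sum_le_sum fun j hj => mul_le_mul_of_nonneg_left (hpS j hj) (abs_nonneg _)) 2
  calc ∑ s ∈ S, ∑ t ∈ S, ‖kernelEntry A b n s t‖ ^ 2 ≤ ∑ s ∈ S, ∑ t ∈ S, 5 *
        (‖∑ j ∈ idx n, (β j : ℂ) * p j s * starRingEnd ℂ (p j t)‖ ^ 2 +
        ‖∑ j ∈ idx n, (β j : ℂ) * p j s * starRingEnd ℂ (e j t)‖ ^ 2 +
        ‖∑ j ∈ idx n, e j s * starRingEnd ℂ ((β j : ℂ) * p j t)‖ ^ 2 +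
        ‖∑ j ∈ idx n, (β j : ℂ) * q j s * starRingEnd ℂ (e j t)‖ ^ 2 +
        ‖∑ j ∈ idx n, f j s * starRingEnd ℂ ((β j : ℂ) * q j t)‖ ^ 2) :=
        Finset.sum_le_sum fun s _ => Finset.sum_le_sum fun t _ => by
          rw [hsplit]; exact norm_add_five_sq_le _ _ _ _ _
    -- The 10 is the 5 of the five-term inequality times the two terms containing each of `pb` and
    -- `qb`.
    _ ≤ 10 * K ^ 2 * n * ∑ j ∈ idx n, β j ^ 2 * (pb j + qb j) +
        5 * (∑ j ∈ idx n, |β j| * pb j) ^ 2 := by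
      simp only [← Finset.mul_sum, Finset.sum_add_distrib, mul_add] at *
      linarith

end KernelMatrix

/-! ### Fourier coefficients of the transfer function -/

section Transfer

lemma integral_sq_norm_eq {α : Type*} [MeasurableSpace α] {μ : Measure α} {E : Type*}
    [NormedAddCommGroup E] {f : α → E} (hf : MemLp f 2 μ) :
    ∫ x, ‖f x‖ ^ 2 ∂μ = (eLpNorm f 2 μ).toReal ^ 2 := by
  rw [hf.eLpNorm_eq_integral_rpow_norm (by norm_num) (by norm_num)]
  have h0 : 0 ≤ ∫ x, ‖f x‖ ^ 2 ∂μ := integral_nonneg fun _ => by positivity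
  have h1 : ∀ x, ‖f x‖ ^ (2 : ℝ≥0∞).toReal = ‖f x‖ ^ 2 := fun x => by norm_num
  simp only [h1]
  rw [ENNReal.toReal_ofReal (by positivity), ← Real.rpow_natCast, ← Real.rpow_mul h0]
  norm_num

lemma memLp_piInt_iff {F : ℝ → ℂ} :
    MemLp F 2 (volume.restrict PiInt) ↔
      MemLp F 2 (volume.restrict (Set.Ioc (-Real.pi) Real.pi)) := by
  rw [PiInt, Measure.restrict_congr_set Ioc_ae_eq_Icc]

lemma sqInt_of_periodic {F : ℝ → ℂ} (hper : Function.Periodic F (2 * Real.pi))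
    (hF : MemLp F 2 (volume.restrict PiInt)) : SqInt F := by
  rw [memLp_piInt_iff] at hF
  have hpi := Real.pi_pos
  have hend : -Real.pi + 2 * Real.pi = Real.pi := by ring
  have h1 : IntervalIntegrable F volume (-Real.pi) (-Real.pi + 2 * Real.pi) := by
    rw [hend, intervalIntegrable_iff_integrableOn_Ioc_of_le (by linarith)]
    exact hF.integrable (by norm_num)
  have h2 : IntervalIntegrable (fun x => ‖F x‖ ^ 2) volume (-Real.pi)
      (-Real.pi + 2 * Real.pi) := by
    rw [hend, intervalIntegrable_iff_integrableOn_Ioc_of_le (by linarith)]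
    exact hF.integrable_norm_pow (by norm_num)
  have hsq : Function.Periodic (fun x => ‖F x‖ ^ 2) (2 * Real.pi) := fun x => by simp only [hper x]
  have h3 := hper.intervalIntegrable Real.two_pi_pos.ne' h1 0 (2 * Real.pi)
  have h4 := hsq.intervalIntegrable Real.two_pi_pos.ne' h2 0 (2 * Real.pi)
  refine (sqInt_iff ?_).2 h4
  rw [intervalIntegrable_iff_integrableOn_Ioc_of_le Real.two_pi_pos.le] at h3
  exact h3.aestronglyMeasurable

lemma integral_sq_of_periodic {F : ℝ → ℂ} (hper : Function.Periodic F (2 * Real.pi)) :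
    ∫ x in (0 : ℝ)..2 * Real.pi, ‖F x‖ ^ 2 = ∫ x in PiInt, ‖F x‖ ^ 2 := by
  have hsq : Function.Periodic (fun x => ‖F x‖ ^ 2) (2 * Real.pi) := fun x => by simp only [hper x]
  have h := hsq.intervalIntegral_add_eq 0 (-Real.pi)
  rw [zero_add, show -Real.pi + 2 * Real.pi = Real.pi by ring] at h
  rw [h, intervalIntegral.integral_of_le (by linarith [Real.pi_pos]), PiInt,
    integral_Icc_eq_integral_Ioc]

/-- The coefficients of the filter, extended by zero: `k ↦ a (-k)` for `k ≤ 0`. -/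
def filterCoeff (a : ℕ → ℝ) (k : ℤ) : ℝ := if k ≤ 0 then a (-k).toNat else 0

/-- A Fourier coefficient is L²-continuous by Bessel, and that of the partial sums is eventually
constant in N. -/
lemma fc_transfer {a : ℕ → ℝ} {A : ℝ → ℂ} (hA : IsTransferFunction a A) (k : ℤ) :
    fc A k = filterCoeff a k := by
  let T : ℕ → ℝ → ℂ := fun N u => ∑ k ∈ Finset.range N,
    Complex.exp (-(Complex.I * (k : ℂ) * (u : ℂ))) * (a k : ℂ)
  have hTc : ∀ N, Continuous (T N) := fun N => by fun_prop
  have hTper : ∀ N, Function.Periodic (T N) (2 * Real.pi) := by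
    intro N x
    refine Finset.sum_congr rfl fun j _ => ?_
    congr 1
    have : -(Complex.I * (j : ℂ) * ((x + 2 * Real.pi : ℝ) : ℂ)) =
        -(Complex.I * j * x) + ((-(j : ℤ) : ℤ) : ℂ) * (2 * Real.pi * Complex.I) := by
      push_cast; ring
    rw [this, Complex.exp_add, Complex.exp_int_mul_two_pi_mul_I, mul_one]
  have hTm : ∀ N, MemLp (T N) 2 (volume.restrict PiInt) := by
    intro N
    rw [memLp_two_iff_integrable_sq_norm (hTc N).aestronglyMeasurable]
    exact ((hTc N).norm.pow 2).continuousOn.integrableOn_Icc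
  have hT : ∀ N : ℕ, (-k).toNat < N → fc (T N) k = filterCoeff a k := by
    intro N hN
    have : ∀ j : ℕ, fc (fun u : ℝ => Complex.exp (-(Complex.I * (j : ℂ) * (u : ℂ))) * (a j : ℂ)) k =
        a j * if k = -(j : ℤ) then 1 else 0 := by
      intro j
      rw [← fc_exp, ← fc_const_mul]
      refine fc_congr (fun x _ => ?_) k
      rw [mul_comm]
      push_cast
      ring_nf
    simp only [T]
    rw [fc_finset_sum _ fun j _ => sqInt_of_continuous (by fun_prop)]
    simp only [this, filterCoeff]
    split_ifs with h
    · rw [Finset.sum_eq_single (-k).toNat]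
      · rw [if_pos (by omega), mul_one]
      · intro j _ hj
        rw [if_neg (by omega), mul_zero]
      · intro hj
        exact absurd (Finset.mem_range.mpr hN) hj
    · rw [Finset.sum_eq_zero]
      · simp
      · intro j _
        rw [if_neg (by omega), mul_zero]
  have hle : ∀ N : ℕ, (-k).toNat < N → ‖fc A k - filterCoeff a k‖ ^ 2 ≤
      (2 * Real.pi)⁻¹ * (eLpNorm (fun u => A u - T N u) 2 (volume.restrict PiInt)).toReal ^ 2 := by
    intro N hN
    have hper : Function.Periodic (fun u => A u - T N u) (2 * Real.pi) := fun x => by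
      simp only [hA.periodic x, hTper N x]
    have hm : MemLp (fun u => A u - T N u) 2 (volume.restrict PiInt) := hA.memLp.sub (hTm N)
    have h := sum_sq_fc_le (sqInt_of_periodic hper hm) {k}
    rw [Finset.sum_singleton, fc_sub (sqInt_of_periodic hA.periodic hA.memLp)
      (sqInt_of_continuous (hTc N)), hT N hN, integral_sq_of_periodic hper,
      integral_sq_norm_eq hm] at h
    exact h
  have hlim : Tendsto (fun N : ℕ => (2 * Real.pi)⁻¹ *
      (eLpNorm (fun u => A u - T N u) 2 (volume.restrict PiInt)).toReal ^ 2) atTop (𝓝 0) := by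
    have h1 := (ENNReal.tendsto_toReal ENNReal.zero_ne_top).comp hA.tendsto
    have h2 := (h1.pow 2).const_mul (2 * Real.pi)⁻¹
    simpa using h2
  have h0 : ‖fc A k - filterCoeff a k‖ ^ 2 ≤ 0 :=
    ge_of_tendsto hlim ((eventually_gt_atTop (-k).toNat).mono hle)
  have h1 : ‖fc A k - filterCoeff a k‖ = 0 := by
    have := le_antisymm h0 (sq_nonneg _)
    simpa using this
  exact sub_eq_zero.mp (norm_eq_zero.mp h1)

/-- Multiplication by e^{itx} shifts Fourier coefficients by t. This identifies the analytic object
A D_n(· - u_j) with the weights that the innovations carry in the transform of X. -/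
lemma filteredCoeff_eq {a : ℕ → ℝ} {A : ℝ → ℂ} (hA : IsTransferFunction a A) (n j : ℕ) (s : ℤ) :
    filteredCoeff A n j s = ∑ t ∈ obs n,
      Complex.exp (-(Complex.I * t * (freq n j : ℂ))) * (filterCoeff a (s - t) : ℂ) := by
  have hAI := sqInt_of_periodic hA.periodic hA.memLp
  have h : ∀ t : ℤ, SqInt fun x : ℝ => Complex.exp (-(Complex.I * t * (freq n j : ℂ))) *
      (Complex.exp (Complex.I * t * x) * A x) := fun t => by
    refine SqInt.const_mul (hAI.bdd_mul (K := 1) ?_ fun x _ => ?_) _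
    · exact (by fun_prop : Continuous fun x : ℝ => Complex.exp (Complex.I * t * x)).aestronglyMeasurable
    · have := norm_exp_neg_I_mul (-t) x
      push_cast at this
      simpa using this.le
  have h1 : (fun x => A x * dirichletKer n (x - freq n j)) = fun x : ℝ => ∑ t ∈ obs n,
      Complex.exp (-(Complex.I * t * (freq n j : ℂ))) * (Complex.exp (Complex.I * t * x) * A x) := by
    funext x
    rw [dirichletKer_sub, Finset.mul_sum]
    exact Finset.sum_congr rfl fun t _ => by ring
  rw [filteredCoeff, h1, fc_finset_sum _ fun t _ => h t]
  refine Finset.sum_congr rfl fun t _ => ?_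
  rw [fc_const_mul, ← fc_transfer hA]
  congr 1
  simp only [fc, ← mul_assoc, ← Complex.exp_add]
  congr 1
  refine intervalIntegral.integral_congr fun x _ => ?_
  congr 2
  push_cast
  ring

end Transfer

/-! ### Passage to the limit in quadratic forms -/

section LimitOfQuadForms

variable {Ω : Type*} [MeasurableSpace Ω] {P : Measure Ω}

/-- Pointwise, | |f|² - |g|² | ≤ |f - g| (|f - g| + 2|g|); conclude by Cauchy-Schwarz. -/
lemma tendsto_eLpNorm_sq_norm {f : ℕ → Ω → ℂ} {g : Ω → ℂ} (hf : ∀ N, MemLp (f N) 2 P)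
    (hg : MemLp g 2 P) (h : Tendsto (fun N => eLpNorm (f N - g) 2 P) atTop (𝓝 0)) :
    Tendsto (fun N => eLpNorm (fun ω => ‖f N ω‖ ^ 2 - ‖g ω‖ ^ 2) 1 P) atTop (𝓝 0) := by
  have hb : ∀ N, eLpNorm (fun ω => ‖f N ω‖ ^ 2 - ‖g ω‖ ^ 2) 1 P ≤
      eLpNorm (f N - g) 2 P * (eLpNorm (f N - g) 2 P + eLpNorm (fun ω => 2 * ‖g ω‖) 2 P) := by
    intro N
    have hd : MemLp (fun ω => ‖(f N - g) ω‖) 2 P := ((hf N).sub hg).norm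
    have hg2 : MemLp (fun ω => 2 * ‖g ω‖) 2 P := hg.norm.const_mul 2
    calc _ ≤ eLpNorm ((fun ω => ‖(f N - g) ω‖) •
          ((fun ω => ‖(f N - g) ω‖) + fun ω => 2 * ‖g ω‖)) 1 P := by
          refine eLpNorm_mono fun ω => ?_
          simp only [Pi.smul_apply', Pi.add_apply, Pi.sub_apply, smul_eq_mul, Real.norm_eq_abs]
          have h1 := abs_norm_sub_norm_le (f N ω) (g ω)
          have h0 := norm_nonneg (f N ω - g ω)
          have hg0 := norm_nonneg (g ω)
          have hf0 := norm_nonneg (f N ω)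
          rw [abs_of_nonneg (by positivity : 0 ≤ ‖f N ω - g ω‖ * (‖f N ω - g ω‖ + 2 * ‖g ω‖)),
            show ‖f N ω‖ ^ 2 - ‖g ω‖ ^ 2 = (‖f N ω‖ - ‖g ω‖) * (‖f N ω‖ + ‖g ω‖) by ring, abs_mul,
            abs_of_nonneg (by positivity : 0 ≤ ‖f N ω‖ + ‖g ω‖)]
          refine mul_le_mul h1 ?_ (by positivity) h0
          linarith [le_abs_self (‖f N ω‖ - ‖g ω‖)]
      _ ≤ eLpNorm (fun ω => ‖(f N - g) ω‖) 2 P *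
          eLpNorm ((fun ω => ‖(f N - g) ω‖) + fun ω => 2 * ‖g ω‖) 2 P :=
          eLpNorm_smul_le_mul_eLpNorm (hd.add hg2).1 hd.1
      _ ≤ _ := by
          rw [eLpNorm_norm]
          gcongr
          refine (eLpNorm_add_le hd.1 hg2.1 (by norm_num)).trans ?_
          rw [eLpNorm_norm]
  have hlim : Tendsto (fun N => eLpNorm (f N - g) 2 P *
      (eLpNorm (f N - g) 2 P + eLpNorm (fun ω => 2 * ‖g ω‖) 2 P)) atTop (𝓝 0) := by
    have hfin : eLpNorm (fun ω => 2 * ‖g ω‖) 2 P ≠ ∞ := (hg.norm.const_mul 2).2.ne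
    have := ENNReal.Tendsto.mul h (Or.inr (by simpa using hfin)) (h.add_const _)
      (Or.inr ENNReal.zero_ne_top)
    simpa using this
  exact tendsto_of_tendsto_of_tendsto_of_le_of_le tendsto_const_nhds hlim (fun _ => zero_le) hb

/-- If `f N → g` in `L¹` and the variances of `f N` are bounded by `V`, then so is that of `g`. -/
lemma centered_sq_le_of_tendsto [IsProbabilityMeasure P] {f : ℕ → Ω → ℝ} {g : Ω → ℝ} {V : ℝ}
    (hf : ∀ N, MemLp (f N) 2 P) (hg : Integrable g P)
    (h : Tendsto (fun N => eLpNorm (f N - g) 1 P) atTop (𝓝 0))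
    (hV : ∀ N, ∫ ω, (f N ω - ∫ ω', f N ω' ∂P) ^ 2 ∂P ≤ V) :
    MemLp (fun ω => g ω - ∫ ω', g ω' ∂P) 2 P ∧ ∫ ω, (g ω - ∫ ω', g ω' ∂P) ^ 2 ∂P ≤ V := by
  have hV0 : 0 ≤ V := (integral_nonneg fun _ => sq_nonneg _).trans (hV 0)
  let T : ℕ → Ω → ℝ := fun N ω => f N ω - ∫ ω', f N ω' ∂P
  let R : Ω → ℝ := fun ω => g ω - ∫ ω', g ω' ∂P
  have hTm : ∀ N, MemLp (T N) 2 P := fun N => (hf N).sub (memLp_const _)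
  have hfm : TendstoInMeasure P f atTop g :=
    tendstoInMeasure_of_tendsto_eLpNorm one_ne_zero (fun N => (hf N).1) hg.1 h
  have hint : Tendsto (fun N => ∫ ω, f N ω ∂P) atTop (𝓝 (∫ ω, g ω ∂P)) :=
    tendsto_integral_of_L1' g hg.1 (Eventually.of_forall fun N => (hf N).integrable (by norm_num)) h
  have hTb : ∀ N, eLpNorm (T N) 2 P ≤ ENNReal.ofReal (Real.sqrt V) := by
    intro N
    have h1 := integral_sq_norm_eq (hTm N)
    rw [← ENNReal.ofReal_toReal (hTm N).2.ne]
    refine ENNReal.ofReal_le_ofReal (Real.le_sqrt_of_sq_le ?_)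
    rw [← h1]
    simpa [T] using hV N
  have hRm : AEStronglyMeasurable R P := hg.1.sub aestronglyMeasurable_const
  -- Along an almost surely convergent subsequence, Fatou's lemma carries the L² bound over to the
  -- limit; the means converge by L¹ convergence.
  obtain ⟨ns, hns, hae⟩ := hfm.exists_seq_tendsto_ae
  have hRb : eLpNorm R 2 P ≤ ENNReal.ofReal (Real.sqrt V) := by
    refine Lp.eLpNorm_le_of_ae_tendsto (u := atTop) (f := fun i => T (ns i))
      (Eventually.of_forall fun i => hTb (ns i)) (fun i => (hTm (ns i)).1) ?_
    filter_upwards [hae] with ω hω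
    exact hω.sub (hint.comp hns.tendsto_atTop)
  have hR : MemLp R 2 P := ⟨hRm, hRb.trans_lt ENNReal.ofReal_lt_top⟩
  refine ⟨hR, ?_⟩
  have h1 := integral_sq_norm_eq hR
  have h2 : (eLpNorm R 2 P).toReal ≤ Real.sqrt V :=
    ENNReal.toReal_le_of_le_ofReal (Real.sqrt_nonneg _) hRb
  have h3 : (eLpNorm R 2 P).toReal ^ 2 ≤ V := by
    rw [← Real.sq_sqrt hV0]
    exact pow_le_pow_left₀ ENNReal.toReal_nonneg h2 2
  rw [← h1] at h3
  simpa [R] using h3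

end LimitOfQuadForms

/-! ### The error as a limit of quadratic forms in finitely many innovations -/

section ErrorMoment

variable {Ω : Type*} [MeasurableSpace Ω] {P : Measure Ω} {ζ X : ℤ → Ω → ℝ} {a : ℕ → ℝ} {A : ℝ → ℂ}

/-- The innovation indices `1 - N, …, n`. -/
noncomputable def innov (n N : ℕ) : Finset ℤ := Finset.Icc (1 - (N : ℤ)) n

/-- The linear process with the innovations before time `1 - N` removed. -/
noncomputable def truncProcess (a : ℕ → ℝ) (ζ : ℤ → Ω → ℝ) (n N : ℕ) (t : ℤ) (ω : Ω) : ℝ :=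
  ∑ s ∈ innov n N, filterCoeff a (s - t) * ζ s ω

/-- The discrete Fourier transform `∑_{t=1}^n e^{itu_j} Y_t`. -/
noncomputable def dft (Y : ℤ → Ω → ℝ) (n j : ℕ) (ω : Ω) : ℂ :=
  ∑ t ∈ obs n, Complex.exp (Complex.I * t * (freq n j : ℂ)) * (Y t ω : ℂ)

omit [MeasurableSpace Ω] in
lemma periodogram_eq (Y : ℤ → Ω → ℝ) (n j : ℕ) (ω : Ω) :
    periodogram Y n (freq n j) ω = (2 * Real.pi * n)⁻¹ * ‖dft Y n j ω‖ ^ 2 := by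
  rw [periodogram, dft, sum_obs]
  simp only [Int.cast_natCast]

omit [MeasurableSpace Ω] in
-- The window of innovations is common to all times, so that the truncated error is a single finite
-- quadratic form. Seen from time t it keeps exactly the lags k < t + N, that is, a partial sum of
-- the series of X_t.
lemma truncProcess_eq (n N : ℕ) {t : ℤ} (ht : t ∈ obs n) (ω : Ω) :
    truncProcess a ζ n N t ω =
      ∑ k ∈ Finset.range (t + N).toNat, a k * ζ (t - (k : ℤ)) ω := by
  simp only [obs, Finset.mem_Icc] at ht
  symm
  rw [truncProcess]
  have h1 : ∑ s ∈ innov n N, filterCoeff a (s - t) * ζ s ω =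
      ∑ s ∈ (innov n N).filter (· ≤ t), filterCoeff a (s - t) * ζ s ω := by
    refine (Finset.sum_filter_of_ne fun s _ hs => ?_).symm
    by_contra h
    apply hs
    simp [filterCoeff, show ¬ s ≤ t from h]
  rw [h1]
  refine Finset.sum_bij (fun k _ => t - (k : ℤ)) ?_ ?_ ?_ ?_
  · intro k hk
    simp only [Finset.mem_range] at hk
    simp only [innov, Finset.mem_filter, Finset.mem_Icc]
    omega
  · intro k _ l _ h
    omega
  · intro s hs
    simp only [innov, Finset.mem_filter, Finset.mem_Icc] at hs
    exact ⟨(t - s).toNat, by simp only [Finset.mem_range]; omega, by omega⟩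
  · intro k _
    simp [filterCoeff]

omit [MeasurableSpace Ω] in
lemma dft_truncProcess (hA : IsTransferFunction a A) (n N j : ℕ) (ω : Ω) :
    dft (truncProcess a ζ n N) n j ω =
      ∑ s ∈ innov n N, (ζ s ω : ℂ) * starRingEnd ℂ (filteredCoeff A n j s) := by
  simp only [dft, truncProcess, filteredCoeff_eq hA, map_sum, Finset.mul_sum, Complex.ofReal_sum]
  rw [Finset.sum_comm]
  refine Finset.sum_congr rfl fun s _ => Finset.sum_congr rfl fun t _ => ?_
  rw [map_mul, ← Complex.exp_conj]
  simp only [map_neg, map_mul, Complex.conj_I, Complex.conj_ofReal, map_intCast]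
  push_cast
  ring_nf

omit [MeasurableSpace Ω] in
lemma dft_innovation (ζ : ℤ → Ω → ℝ) (n N j : ℕ) (ω : Ω) :
    dft ζ n j ω = ∑ s ∈ innov n N, (ζ s ω : ℂ) * starRingEnd ℂ (dftCoeff n j s) := by
  have hsub : obs n ⊆ innov n N := by
    intro t ht
    simp only [obs, innov, Finset.mem_Icc] at *
    omega
  rw [dft]
  refine Finset.sum_subset_zero_on_sdiff hsub (fun s hs => ?_) (fun s hs => ?_)
  · rw [dftCoeff, fc_dirichletKer, if_neg (Finset.mem_sdiff.mp hs).2]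
    simp
  · rw [dftCoeff, fc_dirichletKer, if_pos hs, ← Complex.exp_conj]
    simp only [map_neg, map_mul, Complex.conj_I, Complex.conj_ofReal, map_intCast]
    ring_nf

/-- The z_s are real and the left side is real, so only the real parts of the Hermitian matrix
contribute. -/
lemma sq_norm_sum_conj (S : Finset ℤ) (z : ℤ → ℝ) (c : ℤ → ℂ) :
    ‖∑ s ∈ S, (z s : ℂ) * starRingEnd ℂ (c s)‖ ^ 2 =
      ∑ s ∈ S, ∑ t ∈ S, (c s * starRingEnd ℂ (c t)).re * (z s * z t) := by
  have h : ((‖∑ s ∈ S, (z s : ℂ) * starRingEnd ℂ (c s)‖ ^ 2 : ℝ) : ℂ) =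
      ∑ s ∈ S, ∑ t ∈ S, (c s * starRingEnd ℂ (c t)) * ((z s * z t : ℝ) : ℂ) := by
    push_cast
    rw [← RCLike.norm_conj, ← Complex.mul_conj']
    simp only [map_sum, map_mul, Complex.conj_conj, Complex.conj_ofReal, Finset.sum_mul_sum]
    exact Finset.sum_congr rfl fun s _ => Finset.sum_congr rfl fun t _ => by ring
  have h2 := congrArg Complex.re h
  simpa only [Complex.ofReal_re, Complex.re_sum, Complex.re_mul_ofReal] using h2

/-- The error quadratic form `∑_j b_j (I_Y(u_j) - |A(u_j)|² I_ζ(u_j))`. -/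
noncomputable def errForm (A : ℝ → ℂ) (b : ℕ → ℝ) (n : ℕ) (ζ Y : ℤ → Ω → ℝ) (ω : Ω) : ℝ :=
  ∑ j ∈ idx n, b j * ((2 * Real.pi * n)⁻¹ *
    (‖dft Y n j ω‖ ^ 2 - ‖A (freq n j)‖ ^ 2 * ‖dft ζ n j ω‖ ^ 2))

omit [MeasurableSpace Ω] in
lemma QX_sub_QZ (b : ℕ → ℝ) (n : ℕ) (ω : Ω) :
    QX X b n ω - QZ ζ A b n ω = errForm A b n ζ X ω := by
  rw [QX, QZ, errForm, ← Finset.sum_sub_distrib]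
  refine Finset.sum_congr rfl fun j _ => ?_
  rw [periodogram_eq, periodogram_eq, specDensity]
  have := Real.pi_ne_zero
  field_simp

omit [MeasurableSpace Ω] in
lemma errForm_truncProcess (hA : IsTransferFunction a A) (b : ℕ → ℝ) (n N : ℕ) (ω : Ω) :
    errForm A b n ζ (truncProcess a ζ n N) ω = ∑ s ∈ innov n N, ∑ t ∈ innov n N,
      ((2 * Real.pi * n)⁻¹ * (kernelEntry A b n s t).re) * (ζ s ω * ζ t ω) := by
  simp only [errForm, dft_truncProcess hA, dft_innovation ζ n N]
  simp only [sq_norm_sum_conj (innov n N) (fun s => ζ s ω)]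
  simp only [kernelEntry, Complex.re_sum, Complex.re_ofReal_mul, Complex.sub_re, Finset.mul_sum,
    Finset.sum_mul, ← Finset.sum_sub_distrib]
  rw [Finset.sum_comm]
  refine Finset.sum_congr rfl fun s _ => ?_
  rw [Finset.sum_comm]
  refine Finset.sum_congr rfl fun t _ => Finset.sum_congr rfl fun j _ => ?_
  ring

variable [IsProbabilityMeasure P]

lemma integral_centeredProd (hζ : IsStandardIID P ζ) (hζ4 : MemLp (ζ 0) 4 P) (s t : ℤ) :
    ∫ ω, centeredProd ζ s t ω ∂P = 0 := by
  rcases eq_or_ne s t with rfl | h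
  · exact integral_centeredProd_self hζ hζ4 s
  · have := (hζ.indep.indepFun h).integral_fun_mul_eq_mul_integral
      (hζ.measurable s).aestronglyMeasurable (hζ.measurable t).aestronglyMeasurable
    simp only [centeredProd, if_neg h, sub_zero]
    rw [this, integral_innovation hζ, zero_mul]

lemma errForm_truncProcess_centered (hζ : IsStandardIID P ζ) (hζ4 : MemLp (ζ 0) 4 P)
    (hA : IsTransferFunction a A) (b : ℕ → ℝ) (n N : ℕ) :
    MemLp (errForm A b n ζ (truncProcess a ζ n N)) 2 P ∧
    ∫ ω, (errForm A b n ζ (truncProcess a ζ n N) ω -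
        ∫ ω', errForm A b n ζ (truncProcess a ζ n N) ω' ∂P) ^ 2 ∂P ≤
      (4 + 2 * ∫ ω, (ζ 0 ω ^ 2 - 1) ^ 2 ∂P) * ((2 * Real.pi * n)⁻¹ ^ 2 *
        ∑ s ∈ innov n N, ∑ t ∈ innov n N, ‖kernelEntry A b n s t‖ ^ 2) := by
  let S := innov n N
  let m : ℤ → ℤ → ℝ := fun s t => (2 * Real.pi * n)⁻¹ * (kernelEntry A b n s t).re
  -- The trace is the mean of the form and disappears with the centering.
  let c : ℝ := ∑ s ∈ S, ∑ t ∈ S, m s t * if s = t then 1 else 0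
  let T : Ω → ℝ := fun ω => ∑ s ∈ S, ∑ t ∈ S, m s t * centeredProd ζ s t ω
  have hT : MemLp T 2 P := memLp_quadForm hζ hζ4 m S
  have hdec : ∀ ω, errForm A b n ζ (truncProcess a ζ n N) ω = T ω + c := by
    intro ω
    rw [errForm_truncProcess hA]
    simp only [T, c, ← Finset.sum_add_distrib, centeredProd, m, S]
    exact Finset.sum_congr rfl fun s _ => Finset.sum_congr rfl fun t _ => by ring
  have hT0 : ∫ ω, T ω ∂P = 0 := by
    have hi : ∀ s t, Integrable (fun ω => m s t * centeredProd ζ s t ω) P := fun s t =>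
      ((memLp_centeredProd hζ hζ4 s t).const_mul _).integrable (by norm_num)
    simp only [T]
    rw [integral_finsetSum _ fun s _ => integrable_finsetSum _ fun t _ => hi s t]
    refine Finset.sum_eq_zero fun s _ => ?_
    rw [integral_finsetSum _ fun t _ => hi s t]
    exact Finset.sum_eq_zero fun t _ => by
      rw [integral_const_mul, integral_centeredProd hζ hζ4, mul_zero]
  have hfun : errForm A b n ζ (truncProcess a ζ n N) = fun ω => T ω + c := funext hdec
  rw [hfun]
  refine ⟨hT.add (memLp_const c), ?_⟩
  rw [integral_add (hT.integrable (by norm_num)) (integrable_const c), hT0]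
  simp only [integral_const, probReal_univ, one_smul, zero_add, add_sub_cancel_right]
  refine (integral_quadForm_sq_le hζ hζ4 m S).trans ?_
  have hV0 : 0 ≤ ∫ ω, (ζ 0 ω ^ 2 - 1) ^ 2 ∂P := integral_nonneg fun _ => sq_nonneg _
  refine mul_le_mul_of_nonneg_left ?_ (by positivity)
  rw [Finset.mul_sum]
  refine Finset.sum_le_sum fun s _ => ?_
  rw [Finset.mul_sum]
  refine Finset.sum_le_sum fun t _ => ?_
  rw [mul_pow]
  refine mul_le_mul_of_nonneg_left ?_ (sq_nonneg _)
  rw [← sq_abs]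
  exact pow_le_pow_left₀ (abs_nonneg _) (Complex.abs_re_le_norm _) 2

omit [IsProbabilityMeasure P] in
lemma memLp_dft {Y : ℤ → Ω → ℝ} {n : ℕ} (hY : ∀ t ∈ obs n, MemLp (Y t) 2 P) (j : ℕ) :
    MemLp (dft Y n j) 2 P :=
  memLp_finsetSum _ fun t ht => (hY t ht).ofReal.const_mul _

lemma memLp_truncProcess (hζ : IsStandardIID P ζ) (hζ4 : MemLp (ζ 0) 4 P) (n N : ℕ) (t : ℤ) :
    MemLp (truncProcess a ζ n N t) 2 P :=
  memLp_finsetSum _ fun s _ => (memLp_two_innovation hζ hζ4 s).const_mul _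

lemma tendsto_dft_truncProcess (hζ : IsStandardIID P ζ) (hζ4 : MemLp (ζ 0) 4 P)
    (hX : IsLinearProcess P a ζ X) (n j : ℕ) :
    Tendsto (fun N => eLpNorm (dft (truncProcess a ζ n N) n j - dft X n j) 2 P) atTop (𝓝 0) := by
  have ht : ∀ t ∈ obs n, Tendsto (fun N => eLpNorm
      (fun ω => truncProcess a ζ n N t ω - X t ω) 2 P) atTop (𝓝 0) := by
    intro t ht
    have hM : Tendsto (fun N : ℕ => (t + N).toNat) atTop atTop := by
      refine tendsto_atTop.mpr fun k => ?_
      filter_upwards [eventually_ge_atTop (k + t.natAbs)] with N hN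
      omega
    refine ((hX.tendsto t).comp hM).congr fun N => ?_
    rw [Function.comp_apply, ← eLpNorm_neg]
    congr 1
    funext ω
    rw [truncProcess_eq n N ht]
    simp
  have hb : ∀ N, eLpNorm (dft (truncProcess a ζ n N) n j - dft X n j) 2 P ≤
      ∑ t ∈ obs n, eLpNorm (fun ω => truncProcess a ζ n N t ω - X t ω) 2 P := by
    intro N
    have h1 : dft (truncProcess a ζ n N) n j - dft X n j = ∑ t ∈ obs n, fun ω =>
        Complex.exp (Complex.I * t * (freq n j : ℂ)) *
          ((truncProcess a ζ n N t ω - X t ω : ℝ) : ℂ) := by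
      funext ω
      simp only [Pi.sub_apply, dft, Finset.sum_apply, ← Finset.sum_sub_distrib]
      exact Finset.sum_congr rfl fun t _ => by push_cast; ring
    have hm : ∀ t, MemLp (fun ω => truncProcess a ζ n N t ω - X t ω) 2 P := fun t =>
      (memLp_truncProcess hζ hζ4 n N t).sub (hX.memLp t)
    rw [h1]
    refine (eLpNorm_sum_le (fun t _ => ((hm t).ofReal.const_mul _).1) (by norm_num)).trans ?_
    refine Finset.sum_le_sum fun t _ => eLpNorm_mono fun ω => ?_
    have := norm_exp_neg_I_mul (-t) (freq n j)
    push_cast at this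
    simp only [neg_mul, mul_neg, neg_neg] at this
    rw [norm_mul, this, one_mul, RCLike.norm_ofReal, Real.norm_eq_abs]
  refine tendsto_of_tendsto_of_tendsto_of_le_of_le tendsto_const_nhds ?_ (fun _ => zero_le) hb
  simpa using tendsto_finsetSum (obs n) ht

/-- Second moment of the centered error in terms of the matrix of the quadratic form. -/
lemma rErr_sq_le (hζ : IsStandardIID P ζ) (hζ4 : MemLp (ζ 0) 4 P)
    (hX : IsLinearProcess P a ζ X) (hA : IsTransferFunction a A) (b : ℕ → ℝ) (n : ℕ) {V : ℝ}
    (hV : ∀ S : Finset ℤ, ∑ s ∈ S, ∑ t ∈ S, ‖kernelEntry A b n s t‖ ^ 2 ≤ V) :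
    MemLp (rErr P ζ X A b n) 2 P ∧ rMS P ζ X A b n ≤
      (4 + 2 * ∫ ω, (ζ 0 ω ^ 2 - 1) ^ 2 ∂P) * ((2 * Real.pi * n)⁻¹ ^ 2 * V) := by
  have hdX : ∀ j, MemLp (dft X n j) 2 P := fun j => memLp_dft (fun t _ => hX.memLp t) j
  have hdζ : ∀ j, MemLp (dft ζ n j) 2 P := fun j =>
    memLp_dft (fun t _ => memLp_two_innovation hζ hζ4 t) j
  have hdN : ∀ N j, MemLp (dft (truncProcess a ζ n N) n j) 2 P := fun N j =>
    memLp_dft (fun t _ => memLp_truncProcess hζ hζ4 n N t) j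
  have hint : Integrable (errForm A b n ζ X) P :=
    integrable_finsetSum _ fun j _ => ((((hdX j).integrable_norm_pow (by norm_num)).sub
      (((hdζ j).integrable_norm_pow (by norm_num)).const_mul _)).const_mul _).const_mul _
  have hconv : Tendsto (fun N => eLpNorm (errForm A b n ζ (truncProcess a ζ n N) -
      errForm A b n ζ X) 1 P) atTop (𝓝 0) := by
    have hj : ∀ j ∈ idx n, Tendsto (fun N => eLpNorm ((b j * (2 * Real.pi * n)⁻¹) •
        fun ω => ‖dft (truncProcess a ζ n N) n j ω‖ ^ 2 - ‖dft X n j ω‖ ^ 2) 1 P)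
        atTop (𝓝 0) := by
      intro j _
      have h := tendsto_eLpNorm_sq_norm (fun N => hdN N j) (hdX j)
        (tendsto_dft_truncProcess hζ hζ4 hX n j)
      simp only [eLpNorm_const_smul]
      have h2 := ENNReal.Tendsto.const_mul (a := ‖b j * (2 * Real.pi * n)⁻¹‖ₑ) h
        (Or.inr enorm_ne_top)
      rwa [mul_zero] at h2
    have hb : ∀ N, eLpNorm (errForm A b n ζ (truncProcess a ζ n N) - errForm A b n ζ X) 1 P ≤
        ∑ j ∈ idx n, eLpNorm ((b j * (2 * Real.pi * n)⁻¹) •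
          fun ω => ‖dft (truncProcess a ζ n N) n j ω‖ ^ 2 - ‖dft X n j ω‖ ^ 2) 1 P := by
      intro N
      have h1 : errForm A b n ζ (truncProcess a ζ n N) - errForm A b n ζ X =
          ∑ j ∈ idx n, (b j * (2 * Real.pi * n)⁻¹) •
            fun ω => ‖dft (truncProcess a ζ n N) n j ω‖ ^ 2 - ‖dft X n j ω‖ ^ 2 := by
        funext ω
        simp only [Pi.sub_apply, errForm, Finset.sum_apply, ← Finset.sum_sub_distrib,
          Pi.smul_apply, smul_eq_mul]
        exact Finset.sum_congr rfl fun j _ => by ring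
      rw [h1]
      refine eLpNorm_sum_le (fun j _ => ?_) le_rfl
      exact (((hdN N j).integrable_norm_pow (by norm_num)).sub
        ((hdX j).integrable_norm_pow (by norm_num))).1.const_smul _
    refine tendsto_of_tendsto_of_tendsto_of_le_of_le tendsto_const_nhds ?_ (fun _ => zero_le) hb
    simpa using tendsto_finsetSum (idx n) hj
  have hV0 : 0 ≤ ∫ ω, (ζ 0 ω ^ 2 - 1) ^ 2 ∂P := integral_nonneg fun _ => sq_nonneg _
  -- The bound `hV` holds for every finite index set, hence uniformly in the truncation N.
  have h := centered_sq_le_of_tendsto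
    (fun N => (errForm_truncProcess_centered hζ hζ4 hA b n N).1) hint hconv
    (fun N => (errForm_truncProcess_centered hζ hζ4 hA b n N).2.trans
      (mul_le_mul_of_nonneg_left (mul_le_mul_of_nonneg_left (hV _) (sq_nonneg _))
        (by positivity)))
  have hr : rErr P ζ X A b n = fun ω => errForm A b n ζ X ω - ∫ ω', errForm A b n ζ X ω' ∂P := by
    funext ω
    simp only [rErr, QX_sub_QZ]
  rw [rMS, hr]
  exact h

end ErrorMoment

/-! ### Finiteness of the second moment without smoothness -/

section FiniteSecondMoment

lemma SqInt.mul_dirichletKer {A : ℝ → ℂ} (hA : SqInt A) (n : ℕ) (u : ℝ) :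
    SqInt fun x => A x * dirichletKer n (x - u) := by
  have hc : Continuous fun x => dirichletKer n (x - u) := by fun_prop
  obtain ⟨M, hM⟩ := isCompact_Icc.exists_bound_of_continuousOn
    (s := Set.Icc 0 (2 * Real.pi)) hc.continuousOn
  exact (hA.bdd_mul hc.aestronglyMeasurable
    (fun x hx => hM x (Set.Ioo_subset_Icc_self hx))).congr fun x _ => by ring

/-- The matrix of the error quadratic form is Hilbert-Schmidt. -/
lemma exists_sum_sq_kernelEntry_le {A : ℝ → ℂ} (hA : SqInt A) (b : ℕ → ℝ) (n : ℕ) :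
    ∃ V : ℝ, ∀ S : Finset ℤ, ∑ s ∈ S, ∑ t ∈ S, ‖kernelEntry A b n s t‖ ^ 2 ≤ V := by
  let c : (ℝ → ℂ) → ℝ := fun F => (2 * Real.pi)⁻¹ * ∫ x in (0 : ℝ)..2 * Real.pi, ‖F x‖ ^ 2
  let c1 : ℕ → ℝ := fun j => c fun x => A x * dirichletKer n (x - freq n j)
  let c2 : ℕ → ℝ := fun j => c fun x => dirichletKer n (x - freq n j)
  -- With the minus sign in the weight, both pieces are sums of p ⊗ conj p, for which square
  -- summability of the coefficients alone suffices.
  let β : ℕ → ℝ := fun j => -(b j * ‖A (freq n j)‖ ^ 2)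
  refine ⟨2 * (∑ j ∈ idx n, |b j| * c1 j) ^ 2 + 2 * (∑ j ∈ idx n, |β j| * c2 j) ^ 2, fun S => ?_⟩
  have t1 := sum_sq_tensor_self_le (idx n) S b (filteredCoeff A n)
  have t2 := sum_sq_tensor_self_le (idx n) S β (dftCoeff n)
  have h1 : ∀ j, ∑ s ∈ S, ‖filteredCoeff A n j s‖ ^ 2 ≤ c1 j := fun j =>
    sum_sq_fc_le (hA.mul_dirichletKer n _) S
  have h2 : ∀ j, ∑ s ∈ S, ‖dftCoeff n j s‖ ^ 2 ≤ c2 j := fun j =>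
    sum_sq_fc_le (sqInt_dirichletKer n _) S
  have t1' := t1.trans (pow_le_pow_left₀ (Finset.sum_nonneg fun j _ => by positivity)
    (Finset.sum_le_sum fun j _ => mul_le_mul_of_nonneg_left (h1 j) (abs_nonneg (b j))) 2)
  have t2' := t2.trans (pow_le_pow_left₀ (Finset.sum_nonneg fun j _ => by positivity)
    (Finset.sum_le_sum fun j _ => mul_le_mul_of_nonneg_left (h2 j) (abs_nonneg (β j))) 2)
  have hsplit : ∀ s t, kernelEntry A b n s t =
      ∑ j ∈ idx n, (b j : ℂ) * filteredCoeff A n j s * starRingEnd ℂ (filteredCoeff A n j t) +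
      ∑ j ∈ idx n, (β j : ℂ) * dftCoeff n j s * starRingEnd ℂ (dftCoeff n j t) := by
    intro s t
    rw [kernelEntry, ← Finset.sum_add_distrib]
    refine Finset.sum_congr rfl fun j _ => ?_
    simp only [β]
    push_cast
    ring
  have hpt : ∀ x y : ℂ, ‖x + y‖ ^ 2 ≤ 2 * ‖x‖ ^ 2 + 2 * ‖y‖ ^ 2 := fun x y => by
    have := pow_le_pow_left₀ (norm_nonneg _) (norm_add_le x y) 2
    nlinarith [sq_nonneg (‖x‖ - ‖y‖)]
  calc _ ≤ ∑ s ∈ S, ∑ t ∈ S, (2 * ‖∑ j ∈ idx n, (b j : ℂ) * filteredCoeff A n j s *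
            starRingEnd ℂ (filteredCoeff A n j t)‖ ^ 2 +
          2 * ‖∑ j ∈ idx n, (β j : ℂ) * dftCoeff n j s *
            starRingEnd ℂ (dftCoeff n j t)‖ ^ 2) :=
        Finset.sum_le_sum fun s _ => Finset.sum_le_sum fun t _ => by rw [hsplit]; exact hpt _ _
    _ ≤ _ := by
        simp only [Finset.sum_add_distrib, ← Finset.mul_sum]
        linarith

end FiniteSecondMoment

/-! ### Energy of the local approximation errors -/

section KernelIntegrals

/-- Only the majorant has to be integrable, since a nonnegative function that is not integrable has
integral 0. -/
lemma integral_le_of_le_Ioo {f F : ℝ → ℝ} {a b : ℝ} (hab : a ≤ b)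
    (hF : IntervalIntegrable F volume a b) (h0 : ∀ x ∈ Set.Ioo a b, 0 ≤ f x)
    (h : ∀ x ∈ Set.Ioo a b, f x ≤ F x) : ∫ x in a..b, f x ≤ ∫ x in a..b, F x := by
  rw [intervalIntegrable_iff_integrableOn_Ioo_of_le hab] at hF
  rw [intervalIntegral.integral_of_le hab, intervalIntegral.integral_of_le hab,
    integral_Ioc_eq_integral_Ioo, integral_Ioc_eq_integral_Ioo]
  exact integral_mono_of_nonneg ((ae_restrict_mem measurableSet_Ioo).mono h0) hF
    ((ae_restrict_mem measurableSet_Ioo).mono h)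

lemma dirichletKer_periodic (n : ℕ) : Function.Periodic (dirichletKer n) (2 * Real.pi) := by
  intro y
  refine Finset.sum_congr rfl fun t _ => ?_
  have : Complex.I * (t : ℂ) * ((y + 2 * Real.pi : ℝ) : ℂ) =
      Complex.I * t * y + ((t : ℤ) : ℂ) * (2 * Real.pi * Complex.I) := by
    push_cast; ring
  rw [this, Complex.exp_add, Complex.exp_int_mul_two_pi_mul_I, mul_one]

lemma sq_mul_sq_norm_dirichletKer_le (n : ℕ) {y : ℝ} (hy : |y| ≤ Real.pi) :
    y ^ 2 * ‖dirichletKer n y‖ ^ 2 ≤ Real.pi ^ 2 := by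
  rw [← sq_abs y, ← mul_pow]
  exact pow_le_pow_left₀ (by positivity) (abs_mul_norm_dirichletKer_le n hy) 2

lemma integral_inv_sq_le {u : ℝ} (hu : 0 < u) :
    ∫ x in (0 : ℝ)..2 * Real.pi, ((2 * Real.pi + u - x) ^ 2)⁻¹ ≤ 1 / u := by
  have hpi := Real.pi_pos
  have hne : ∀ x ∈ Set.uIcc 0 (2 * Real.pi), 2 * Real.pi + u - x ≠ 0 := fun x hx => by
    rw [Set.uIcc_of_le Real.two_pi_pos.le, Set.mem_Icc] at hx
    linarith [hx.2]
  have h := intervalIntegral.integral_eq_sub_of_hasDerivAt (a := 0) (b := 2 * Real.pi)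
    (f := fun x => (2 * Real.pi + u - x)⁻¹) (f' := fun x => ((2 * Real.pi + u - x) ^ 2)⁻¹)
    (fun x hx => by
      have h1 := ((hasDerivAt_id x).const_sub (2 * Real.pi + u)).fun_inv (hne x hx)
      simpa [neg_div] using h1)
    (ContinuousOn.intervalIntegrable
      (ContinuousOn.inv₀ (by fun_prop) fun x hx => pow_ne_zero 2 (hne x hx)))
  rw [h]
  have : 0 < (2 * Real.pi + u - 0)⁻¹ := inv_pos.mpr (by linarith)
  rw [show 2 * Real.pi + u - 2 * Real.pi = u by ring, one_div]
  linarith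

/-- Mean square error of approximating a smooth factor `g` by its value at `u`. -/
lemma integral_sq_sub_mul_dirichletKer_le {g : ℝ → ℂ} {n : ℕ} {u η c R : ℝ} (hu : 0 < u)
    (hu' : u < Real.pi) (hc : 0 ≤ c) (hR : 0 ≤ R)
    (h1 : ∀ x ∈ Set.Ioo 0 (2 * Real.pi), x ≤ u + Real.pi →
      ‖g x - g u‖ ^ 2 ≤ η + c * (x - u) ^ 2)
    (h2 : ∀ x ∈ Set.Ioo 0 (2 * Real.pi), u + Real.pi < x →
      ‖g x - g u‖ ^ 2 ≤ η + c * (x - u - 2 * Real.pi) ^ 2 + R) :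
    ∫ x in (0 : ℝ)..2 * Real.pi, ‖(g x - g u) * dirichletKer n (x - u)‖ ^ 2 ≤
      2 * Real.pi * η * n + 2 * Real.pi ^ 3 * c + R * Real.pi ^ 2 / u := by
  have hpi := Real.pi_pos
  have i1 : IntervalIntegrable (fun x => η * ‖dirichletKer n (x - u)‖ ^ 2) volume 0
      (2 * Real.pi) := (by fun_prop : Continuous _).intervalIntegrable _ _
  have i2 : IntervalIntegrable (fun _ : ℝ => c * Real.pi ^ 2) volume 0 (2 * Real.pi) :=
    intervalIntegrable_const
  have i3 : IntervalIntegrable (fun x => R * Real.pi ^ 2 * ((2 * Real.pi + u - x) ^ 2)⁻¹) volume 0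
      (2 * Real.pi) := by
    refine ContinuousOn.intervalIntegrable (ContinuousOn.mul continuousOn_const
      (ContinuousOn.inv₀ (by fun_prop) fun x hx => ?_))
    rw [Set.uIcc_of_le Real.two_pi_pos.le, Set.mem_Icc] at hx
    have : 0 < 2 * Real.pi + u - x := by linarith [hx.2]
    positivity
  have hle := integral_le_of_le_Ioo
    (f := fun x => ‖(g x - g u) * dirichletKer n (x - u)‖ ^ 2)
    (F := fun x => η * ‖dirichletKer n (x - u)‖ ^ 2 + c * Real.pi ^ 2 +
      R * Real.pi ^ 2 * ((2 * Real.pi + u - x) ^ 2)⁻¹) Real.two_pi_pos.le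
    ((i1.add i2).add i3) (fun x _ => sq_nonneg _) (fun x hx => by
      rw [norm_mul, mul_pow]
      have hpos : 0 < 2 * Real.pi + u - x := by linarith [hx.2]
      have h3 : 0 ≤ R * Real.pi ^ 2 * ((2 * Real.pi + u - x) ^ 2)⁻¹ := by positivity
      have hD0 := sq_nonneg ‖dirichletKer n (x - u)‖
      rcases le_or_gt x (u + Real.pi) with hx1 | hx1
      · have hD := sq_mul_sq_norm_dirichletKer_le n (y := x - u)
          (abs_le.mpr ⟨by linarith [hx.1], by linarith⟩)
        have hg := mul_le_mul_of_nonneg_right (h1 x hx hx1) hD0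
        have := mul_le_mul_of_nonneg_left hD hc
        linarith
      -- Past u + π the nearest peak of the kernel is u + 2π, at distance at least u from (0, 2π).
      -- The error R from a jump of g at 2π is thus only weighted by π²/(2π + u - x)², whose
      -- integral is at most π²/u.
      · have hper : dirichletKer n (x - u) = dirichletKer n (x - u - 2 * Real.pi) :=
          ((dirichletKer_periodic n).sub_eq _).symm
        have hab : |x - u - 2 * Real.pi| ≤ Real.pi :=
          abs_le.mpr ⟨by linarith, by linarith [hx.2]⟩
        have hD := sq_mul_sq_norm_dirichletKer_le n hab
        rw [← hper] at hD
        have hg := mul_le_mul_of_nonneg_right (h2 x hx hx1) hD0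
        have h4 := mul_le_mul_of_nonneg_left hD hc
        have h5 : ‖dirichletKer n (x - u)‖ ^ 2 ≤
            Real.pi ^ 2 * ((2 * Real.pi + u - x) ^ 2)⁻¹ := by
          rw [← div_eq_mul_inv, le_div_iff₀ (by positivity)]
          linarith
        have h6 := mul_le_mul_of_nonneg_left h5 hR
        linarith)
  have e1 : ∫ x in (0 : ℝ)..2 * Real.pi, (η * ‖dirichletKer n (x - u)‖ ^ 2 + c * Real.pi ^ 2 +
      R * Real.pi ^ 2 * ((2 * Real.pi + u - x) ^ 2)⁻¹) =
      η * (2 * Real.pi * n) + 2 * Real.pi * (c * Real.pi ^ 2) + R * Real.pi ^ 2 *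
        ∫ x in (0 : ℝ)..2 * Real.pi, ((2 * Real.pi + u - x) ^ 2)⁻¹ := by
    rw [intervalIntegral.integral_add (i1.add i2) i3, intervalIntegral.integral_add i1 i2,
      intervalIntegral.integral_const_mul, intervalIntegral.integral_const,
      intervalIntegral.integral_const_mul, integral_sq_dirichletKer, sub_zero, smul_eq_mul]
  rw [e1] at hle
  have h7 := mul_le_mul_of_nonneg_left (integral_inv_sq_le hu)
    (by positivity : 0 ≤ R * Real.pi ^ 2)
  refine hle.trans ?_
  rw [mul_one_div] at h7
  linarith

/-- The profile `(1 + t^{-2d}) (1 + t)^{-2}`. -/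
noncomputable def profile (d t : ℝ) : ℝ := (1 + t ^ (-2 * d)) * ((1 + t) ^ 2)⁻¹

lemma profile_nonneg (d : ℝ) {t : ℝ} (ht : 0 ≤ t) : 0 ≤ profile d t := by
  unfold profile
  have := Real.rpow_nonneg ht (-2 * d)
  positivity

/-- Both halves of |d| < 1/2 are used: d < 1/2 for integrability at 0, d > -1/2 for the decay
t^{-2d-2} at infinity. -/
lemma integrableOn_profile {d : ℝ} (hd : |d| < 1 / 2) : IntegrableOn (profile d) (Set.Ioi 0) := by
  have hd' := abs_lt.mp hd
  have hm : Measurable (profile d) := by unfold profile; fun_prop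
  have hu : Set.Ioi (0 : ℝ) = Set.Ioc 0 1 ∪ Set.Ioi 1 :=
    (Set.Ioc_union_Ioi_eq_Ioi zero_le_one).symm
  rw [hu]
  refine IntegrableOn.union ?_ ?_
  · have h1 : IntegrableOn (fun t : ℝ => 1 + t ^ (-2 * d)) (Set.Ioc 0 1) := by
      rw [← intervalIntegrable_iff_integrableOn_Ioc_of_le zero_le_one]
      exact intervalIntegrable_const.add
        (intervalIntegral.intervalIntegrable_rpow' (by linarith [hd'.2]))
    refine h1.mono' hm.aestronglyMeasurable ?_
    refine (ae_restrict_mem measurableSet_Ioc).mono fun t ht => ?_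
    have ht0 : 0 ≤ t := ht.1.le
    rw [Real.norm_of_nonneg (profile_nonneg d ht0), profile]
    have := Real.rpow_nonneg ht0 (-2 * d)
    refine mul_le_of_le_one_right (by positivity) ?_
    exact inv_le_one_of_one_le₀ (by nlinarith)
  · have h1 : IntegrableOn (fun t : ℝ => t ^ (-2 : ℝ) + t ^ (-2 * d - 2)) (Set.Ioi 1) :=
      (integrableOn_Ioi_rpow_of_lt (by norm_num) one_pos).add
        (integrableOn_Ioi_rpow_of_lt (by linarith [hd'.1]) one_pos)
    refine h1.mono' hm.aestronglyMeasurable ?_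
    refine (ae_restrict_mem measurableSet_Ioi).mono fun t ht => ?_
    have ht0 : 0 < t := lt_trans one_pos ht
    rw [Real.norm_of_nonneg (profile_nonneg d ht0.le), profile, Real.rpow_sub ht0,
      Real.rpow_neg ht0.le, Real.rpow_two, div_eq_mul_inv, ← one_add_mul]
    have := Real.rpow_nonneg ht0.le (-2 * d)
    refine mul_le_mul_of_nonneg_left ?_ (by positivity)
    exact inv_anti₀ (by positivity) (by nlinarith)

lemma integral_profile_div_le {d : ℝ} (hd : |d| < 1 / 2) {u : ℝ} (hu : 0 < u) :
    IntervalIntegrable (fun x => profile d (x / u)) volume 0 (2 * Real.pi) ∧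
    ∫ x in (0 : ℝ)..2 * Real.pi, profile d (x / u) ≤ u * ∫ t in Set.Ioi 0, profile d t := by
  have hpi := Real.two_pi_pos
  have hq : 0 ≤ 2 * Real.pi / u := by positivity
  have hI := integrableOn_profile hd
  have h1 : IntervalIntegrable (profile d) volume 0 (2 * Real.pi / u) := by
    rw [intervalIntegrable_iff_integrableOn_Ioc_of_le hq]
    exact hI.mono_set Set.Ioc_subset_Ioi_self
  constructor
  · have h2 := h1.comp_mul_right (c := u⁻¹)
    simpa [div_eq_mul_inv, hu.ne'] using h2
  · rw [intervalIntegral.integral_comp_div _ hu.ne', zero_div, smul_eq_mul,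
      intervalIntegral.integral_of_le hq]
    refine mul_le_mul_of_nonneg_left ?_ hu.le
    exact setIntegral_mono_set hI
      ((ae_restrict_mem measurableSet_Ioi).mono fun t ht => profile_nonneg d (le_of_lt ht))
      Set.Ioc_subset_Ioi_self.eventuallyLE

/-- A function on `(0, 2π)` that behaves like a power of the distance to `2πℤ`. -/
structure PowerLike (d c₁ c₂ c₃ : ℝ) (H : ℝ → ℂ) : Prop where
  pos : 0 < c₁
  pos' : 0 ≤ c₃
  lower : ∀ x ∈ Set.Ioo 0 (2 * Real.pi), c₁ * min x (2 * Real.pi - x) ^ (-d) ≤ ‖H x‖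
  upper : ∀ x ∈ Set.Ioo 0 (2 * Real.pi), ‖H x‖ ≤ c₂ * min x (2 * Real.pi - x) ^ (-d)
  lip : ∀ u ∈ Set.Ioo 0 Real.pi, ∀ x ∈ Set.Ioo 0 (2 * Real.pi), |x - u| ≤ u / 2 →
    ‖H x - H u‖ ≤ c₃ * |x - u| * u ^ (-1 - d)

/-- On |x - u| ≤ u/2 the Lipschitz bound of H cancels the pole of the kernel. Elsewhere, with m the
distance of x to {0, 2π}, the kernel is O(1/(u + m)) and H(x)/H(u) is O((m/u)^{-d}). Both cases
become u⁻² times a function of x/u or (2π - x)/u; adding the two profiles treats the ends 0 and 2π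
alike. -/
lemma PowerLike.pointwise {d c₁ c₂ c₃ : ℝ} {H : ℝ → ℂ} (hH : PowerLike d c₁ c₂ c₃ H) {u x : ℝ}
    (hu : u ∈ Set.Ioo 0 Real.pi) (hx : x ∈ Set.Ioo 0 (2 * Real.pi)) (n : ℕ) :
    ‖H x / H u - 1‖ ^ 2 * ‖dirichletKer n (x - u)‖ ^ 2 ≤
      (25 * Real.pi ^ 2 * ((c₃ / c₁) ^ 2 + 2 + 2 * (c₂ / c₁) ^ 2)) / u ^ 2 *
        (profile d (x / u) + profile d ((2 * Real.pi - x) / u)) := by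
  have hpi := Real.pi_pos
  have hu0 := hu.1
  have hx0 := hx.1
  have hc1 := hH.pos
  have hx2 : 0 < 2 * Real.pi - x := by linarith [hx.2]
  have hp1 := profile_nonneg d (div_nonneg hx0.le hu0.le)
  have hp2 := profile_nonneg d (div_nonneg hx2.le hu0.le)
  have hHu : c₁ * u ^ (-d) ≤ ‖H u‖ := by
    have := hH.lower u ⟨hu.1, by linarith [hu.2]⟩
    rwa [min_eq_left (by linarith [hu.2])] at this
  have hud := Real.rpow_pos_of_pos hu0 (-d)
  have hHu0 : 0 < ‖H u‖ := lt_of_lt_of_le (by positivity) hHu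
  have hne : H u ≠ 0 := norm_pos_iff.mp hHu0
  have hdiv : H x / H u - 1 = (H x - H u) / H u := by field_simp
  rcases le_or_gt |x - u| (u / 2) with hxu | hxu
  · have hlip := hH.lip u hu x hx hxu
    have hD := abs_mul_norm_dirichletKer_le n (y := x - u) (by linarith [hu.2])
    have h1 : ‖H x / H u - 1‖ * ‖dirichletKer n (x - u)‖ ≤ c₃ / c₁ * Real.pi / u := by
      rw [hdiv, norm_div]
      calc ‖H x - H u‖ / ‖H u‖ * ‖dirichletKer n (x - u)‖
          ≤ (c₃ * |x - u| * u ^ (-1 - d)) / (c₁ * u ^ (-d)) * ‖dirichletKer n (x - u)‖ := by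
            gcongr
            exact (norm_nonneg _).trans hlip
        _ = c₃ / c₁ / u * (|x - u| * ‖dirichletKer n (x - u)‖) := by
            rw [show -1 - d = -d - 1 by ring, Real.rpow_sub_one hu0.ne']
            field_simp
        _ ≤ c₃ / c₁ / u * Real.pi := by
            refine mul_le_mul_of_nonneg_left hD ?_
            have := hH.pos'
            positivity
        _ = _ := by ring
    have h2 : (‖H x / H u - 1‖ * ‖dirichletKer n (x - u)‖) ^ 2 ≤ (c₃ / c₁ * Real.pi / u) ^ 2 :=
      pow_le_pow_left₀ (by positivity) h1 2
    rw [mul_pow] at h2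
    have h3 : 1 ≤ 25 * profile d (x / u) := by
      have hxu' : x / u ≤ 3 / 2 := by
        rw [div_le_iff₀ hu0]
        linarith [(abs_le.mp hxu).2]
      have hxu0 : 0 ≤ x / u := by positivity
      rw [profile, ← mul_assoc, ← div_eq_mul_inv, le_div_iff₀ (by positivity)]
      have := Real.rpow_nonneg hxu0 (-2 * d)
      nlinarith
    calc _ ≤ (c₃ / c₁ * Real.pi / u) ^ 2 * 1 := by linarith
      _ ≤ (c₃ / c₁ * Real.pi / u) ^ 2 * (25 * profile d (x / u)) := by gcongr
      _ = (25 * Real.pi ^ 2 * (c₃ / c₁) ^ 2) / u ^ 2 * profile d (x / u) := by ring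
      _ ≤ _ := by
        gcongr
        · nlinarith [sq_nonneg (c₂ / c₁)]
        · linarith
  · set m := min x (2 * Real.pi - x) with hm
    have hm0 : 0 < m := lt_min hx0 hx2
    have hmx : m ≤ x := min_le_left _ _
    have hmx2 : m ≤ 2 * Real.pi - x := min_le_right _ _
    -- The 5 is sharp at x = 3u/2, the edge of the near region: there x - u = (u + x)/5.
    have hD : (u + m) / 5 * ‖dirichletKer n (x - u)‖ ≤ Real.pi := by
      rcases le_or_gt (x - u) Real.pi with hx1 | hx1
      · refine le_trans (mul_le_mul_of_nonneg_right ?_ (norm_nonneg _))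
          (abs_mul_norm_dirichletKer_le n (y := x - u)
            (abs_le.mpr ⟨by linarith [hu.2], hx1⟩))
        rcases le_or_gt x u with h | h
        · rw [abs_of_nonpos (by linarith)] at hxu ⊢
          linarith
        · rw [abs_of_pos (by linarith)] at hxu ⊢
          linarith
      · have hab : |x - u - 2 * Real.pi| ≤ Real.pi := abs_le.mpr ⟨by linarith, by linarith⟩
        rw [← (dirichletKer_periodic n).sub_eq]
        refine le_trans (mul_le_mul_of_nonneg_right ?_ (norm_nonneg _))
          (abs_mul_norm_dirichletKer_le n hab)
        rw [abs_of_neg (by linarith)]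
        linarith
    have hD2 : ‖dirichletKer n (x - u)‖ ^ 2 ≤ 25 * Real.pi ^ 2 / u ^ 2 * ((1 + m / u) ^ 2)⁻¹ := by
      have h1 := pow_le_pow_left₀ (by positivity) hD 2
      have h2 : 25 * Real.pi ^ 2 / u ^ 2 * ((1 + m / u) ^ 2)⁻¹ =
          25 * Real.pi ^ 2 / (u + m) ^ 2 := by
        field_simp
      rw [h2, le_div_iff₀ (by positivity)]
      linear_combination 25 * h1
    have hHx : ‖H x / H u - 1‖ ^ 2 ≤
        (2 + 2 * (c₂ / c₁) ^ 2) * (1 + (m / u) ^ (-2 * d)) := by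
      have h1 : ‖H x / H u‖ ≤ c₂ / c₁ * (m / u) ^ (-d) := by
        rw [norm_div, Real.div_rpow hm0.le hu0.le, div_mul_div_comm]
        have hup := hH.upper x hx
        exact div_le_div₀ ((norm_nonneg _).trans hup) hup (by positivity) hHu
      have h2 : ((m / u) ^ (-d)) ^ 2 = (m / u) ^ (-2 * d) := by
        rw [← Real.rpow_natCast, ← Real.rpow_mul (by positivity)]
        congr 1
        push_cast; ring
      have h3 : ‖H x / H u - 1‖ ≤ c₂ / c₁ * (m / u) ^ (-d) + 1 := by
        refine (norm_sub_le _ _).trans ?_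
        rw [norm_one]
        linarith
      have h4 := pow_le_pow_left₀ (norm_nonneg _) h3 2
      have h5 := Real.rpow_nonneg (by positivity : 0 ≤ m / u) (-2 * d)
      have h6 : (c₂ / c₁ * (m / u) ^ (-d)) ^ 2 = (c₂ / c₁) ^ 2 * (m / u) ^ (-2 * d) := by
        rw [mul_pow, h2]
      have h7 := sq_nonneg (c₂ / c₁ * (m / u) ^ (-d) - 1)
      have h8 := mul_nonneg (sq_nonneg (c₂ / c₁)) (sq_nonneg (1 : ℝ))
      linear_combination h4 + h7 + 2 * h6 + 2 * h8 + 2 * h5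
    have hmp : profile d (m / u) ≤ profile d (x / u) + profile d ((2 * Real.pi - x) / u) := by
      rcases min_choice x (2 * Real.pi - x) with h | h
      · rw [hm, h]; linarith
      · rw [hm, h]; linarith
    have h5 := Real.rpow_nonneg (by positivity : 0 ≤ m / u) (-2 * d)
    calc _ ≤ ((2 + 2 * (c₂ / c₁) ^ 2) * (1 + (m / u) ^ (-2 * d))) *
          (25 * Real.pi ^ 2 / u ^ 2 * ((1 + m / u) ^ 2)⁻¹) :=
          mul_le_mul hHx hD2 (sq_nonneg _) (by positivity)
      _ = (25 * Real.pi ^ 2 * (2 + 2 * (c₂ / c₁) ^ 2)) / u ^ 2 * profile d (m / u) := by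
          rw [profile]; ring
      _ ≤ _ := by
        have := profile_nonneg d (by positivity : 0 ≤ m / u)
        gcongr
        nlinarith [sq_nonneg (c₃ / c₁)]

/-- Mean square error of approximating a power-like factor by its value at `u`. -/
lemma PowerLike.exists_integral_le {d c₁ c₂ c₃ : ℝ} {H : ℝ → ℂ} (hd : |d| < 1 / 2)
    (hH : PowerLike d c₁ c₂ c₃ H) :
    ∃ M : ℝ, 0 ≤ M ∧ ∀ (n : ℕ) (u : ℝ) (g : ℝ → ℂ) (K : ℝ), u ∈ Set.Ioo 0 Real.pi →
      (∀ x ∈ Set.Ioo 0 (2 * Real.pi), ‖g x‖ ≤ K) →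
      ∫ x in (0 : ℝ)..2 * Real.pi, ‖(H x / H u - 1) * (g x * dirichletKer n (x - u))‖ ^ 2 ≤
        M * K ^ 2 / u := by
  set I := ∫ t in Set.Ioi 0, profile d t
  have hI : 0 ≤ I := setIntegral_nonneg measurableSet_Ioi fun t ht => profile_nonneg d (le_of_lt ht)
  set C := 25 * Real.pi ^ 2 * ((c₃ / c₁) ^ 2 + 2 + 2 * (c₂ / c₁) ^ 2) with hC
  have hC0 : 0 ≤ C := by positivity
  -- Each end contributes (C/u²)·uI after the substitution t = x/u, which leaves the order 1/u.
  refine ⟨2 * C * I, by positivity, fun n u g K hu hK => ?_⟩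
  have hu0 := hu.1
  obtain ⟨j1, j2⟩ := integral_profile_div_le hd hu0
  have j3 : IntervalIntegrable (fun x => profile d ((2 * Real.pi - x) / u)) volume 0
      (2 * Real.pi) := by
    have := (j1.comp_sub_left (2 * Real.pi)).symm
    simpa using this
  have j4 : ∫ x in (0 : ℝ)..2 * Real.pi, profile d ((2 * Real.pi - x) / u) =
      ∫ x in (0 : ℝ)..2 * Real.pi, profile d (x / u) := by
    rw [intervalIntegral.integral_comp_sub_left (fun x => profile d (x / u))]
    simp
  refine (integral_le_of_le_Ioo (F := fun x => K ^ 2 * (C / u ^ 2 *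
    (profile d (x / u) + profile d ((2 * Real.pi - x) / u)))) Real.two_pi_pos.le
    (((j1.add j3).const_mul _).const_mul _) (fun x _ => sq_nonneg _) fun x hx => ?_).trans ?_
  · have h1 := hH.pointwise hu hx n
    have h2 := pow_le_pow_left₀ (norm_nonneg _) (hK x hx) 2
    rw [norm_mul, norm_mul, mul_pow, mul_pow]
    calc _ = ‖g x‖ ^ 2 * (‖H x / H u - 1‖ ^ 2 * ‖dirichletKer n (x - u)‖ ^ 2) := by ring
      _ ≤ _ := mul_le_mul h2 h1 (by positivity) (sq_nonneg _)
  · rw [intervalIntegral.integral_const_mul, intervalIntegral.integral_const_mul,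
      intervalIntegral.integral_add j1 j3, j4]
    calc _ ≤ K ^ 2 * (C / u ^ 2 * (u * I + u * I)) := by gcongr
      _ = _ := by field_simp; ring

end KernelIntegrals

/-! ### Sums with harmonic weights -/

section WeightedSums

lemma one_le_of_mem_idx {n j : ℕ} (hj : j ∈ idx n) : 1 ≤ j := (Finset.mem_Icc.mp hj).1

lemma four_le_of_mem_idx {n j : ℕ} (hj : j ∈ idx n) : 4 ≤ n := by
  have := Finset.mem_Icc.mp hj
  omega

lemma one_le_log {n : ℕ} (hn : 4 ≤ n) : 1 ≤ Real.log n := by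
  rw [Real.le_log_iff_exp_le (by exact_mod_cast (by omega : 0 < n))]
  have : (4 : ℝ) ≤ n := by exact_mod_cast hn
  linarith [Real.exp_one_lt_three]

lemma sum_inv_idx_le {n : ℕ} (hn : 4 ≤ n) : ∑ j ∈ idx n, (j : ℝ)⁻¹ ≤ 2 * Real.log n := by
  have hsub : idx n ⊆ Finset.Icc 1 n := Finset.Icc_subset_Icc_right (by omega)
  have h1 : ∑ j ∈ idx n, (j : ℝ)⁻¹ ≤ ∑ j ∈ Finset.Icc 1 n, (j : ℝ)⁻¹ :=
    Finset.sum_le_sum_of_subset_of_nonneg hsub fun j _ _ => by positivity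
  have h2 : ((harmonic n : ℚ) : ℝ) = ∑ j ∈ Finset.Icc 1 n, (j : ℝ)⁻¹ := by
    rw [harmonic_eq_sum_Icc]; push_cast; rfl
  have h3 := harmonic_le_one_add_log n
  rw [h2] at h3
  linarith [one_le_log hn]

/-- Bounding y by M and using harmonic sums gives the logarithmic alternative. The other one
interpolates: both terms are controlled by T = Σ y_j² j^{-3/4}, and T ≤ M Σ y_j j^{-3/4} ≤ M (Σ
y_j²)^{1/2} (Σ j^{-3/2})^{1/2}. -/
lemma exists_sum_weights_le : ∃ C : ℝ, 0 < C ∧ ∀ (n : ℕ) (y : ℕ → ℝ) (M : ℝ), 0 ≤ M →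
    (∀ j ∈ idx n, 0 ≤ y j ∧ y j ≤ M) →
    ∑ j ∈ idx n, y j ^ 2 / j + (∑ j ∈ idx n, y j / j) ^ 2 ≤
      C * min (M ^ 2 * Real.log n ^ 3) (M * Real.sqrt (∑ j ∈ idx n, y j ^ 2)) := by
  have hs1 : Summable fun j : ℕ => (j : ℝ) ^ (-(5 / 4) : ℝ) :=
    Real.summable_nat_rpow.mpr (by norm_num)
  have hs2 : Summable fun j : ℕ => (j : ℝ) ^ (-(3 / 2) : ℝ) :=
    Real.summable_nat_rpow.mpr (by norm_num)
  set S1 := ∑' j : ℕ, (j : ℝ) ^ (-(5 / 4) : ℝ)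
  set S2 := ∑' j : ℕ, (j : ℝ) ^ (-(3 / 2) : ℝ)
  have hS1 : 0 ≤ S1 := tsum_nonneg fun j => by positivity
  have hS2 : 0 ≤ Real.sqrt S2 := Real.sqrt_nonneg _
  refine ⟨6 + (1 + S1) * Real.sqrt S2, by positivity, fun n y M hM hy => ?_⟩
  set Q := ∑ j ∈ idx n, y j ^ 2
  have hQ : 0 ≤ Q := Finset.sum_nonneg fun _ _ => sq_nonneg _
  have hpos : ∀ j ∈ idx n, (0 : ℝ) < j := fun j hj => by
    exact_mod_cast one_le_of_mem_idx hj
  have hlog : 0 ≤ Real.log n := Real.log_natCast_nonneg n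
  have hA : ∑ j ∈ idx n, y j ^ 2 / j + (∑ j ∈ idx n, y j / j) ^ 2 ≤
      6 * (M ^ 2 * Real.log n ^ 3) := by
    rcases (idx n).eq_empty_or_nonempty with he | ⟨i, hi⟩
    · rw [he]; simp; positivity
    have hn := four_le_of_mem_idx hi
    have h1 : ∑ j ∈ idx n, y j ^ 2 / j ≤ M ^ 2 * ∑ j ∈ idx n, (j : ℝ)⁻¹ := by
      rw [Finset.mul_sum]
      refine Finset.sum_le_sum fun j hj => ?_
      rw [div_eq_mul_inv]
      exact mul_le_mul_of_nonneg_right (pow_le_pow_left₀ (hy j hj).1 (hy j hj).2 2)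
        (inv_nonneg.mpr (hpos j hj).le)
    have h2 : ∑ j ∈ idx n, y j / j ≤ M * ∑ j ∈ idx n, (j : ℝ)⁻¹ := by
      rw [Finset.mul_sum]
      refine Finset.sum_le_sum fun j hj => ?_
      rw [div_eq_mul_inv]
      exact mul_le_mul_of_nonneg_right (hy j hj).2 (inv_nonneg.mpr (hpos j hj).le)
    have h20 : 0 ≤ ∑ j ∈ idx n, y j / j :=
      Finset.sum_nonneg fun j hj => div_nonneg (hy j hj).1 (hpos j hj).le
    have h3 := sum_inv_idx_le hn
    have hL := one_le_log hn
    set L := Real.log n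
    have h1' : ∑ j ∈ idx n, y j ^ 2 / j ≤ M ^ 2 * (2 * L) :=
      h1.trans (mul_le_mul_of_nonneg_left h3 (sq_nonneg _))
    have h2' : (∑ j ∈ idx n, y j / j) ^ 2 ≤ (M * (2 * L)) ^ 2 :=
      pow_le_pow_left₀ h20 (h2.trans (mul_le_mul_of_nonneg_left h3 hM)) 2
    have hL2 : L ^ 2 ≤ L ^ 3 := pow_le_pow_right₀ hL (by norm_num)
    have hL1 : L ≤ L ^ 3 := by simpa using pow_le_pow_right₀ hL (by norm_num : 1 ≤ 3)
    have hM2 := sq_nonneg M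
    linarith [mul_le_mul_of_nonneg_left hL2 hM2, mul_le_mul_of_nonneg_left hL1 hM2]
  have hB : ∑ j ∈ idx n, y j ^ 2 / j + (∑ j ∈ idx n, y j / j) ^ 2 ≤
      (1 + S1) * Real.sqrt S2 * (M * Real.sqrt Q) := by
    set T := ∑ j ∈ idx n, y j ^ 2 * (j : ℝ) ^ (-(3 / 4) : ℝ)
    have hT0 : 0 ≤ T := Finset.sum_nonneg fun j _ => by positivity
    have h1 : ∑ j ∈ idx n, y j ^ 2 / j ≤ T := by
      refine Finset.sum_le_sum fun j hj => ?_
      rw [div_eq_mul_inv, ← Real.rpow_neg_one]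
      refine mul_le_mul_of_nonneg_left ?_ (sq_nonneg _)
      exact Real.rpow_le_rpow_of_exponent_le (by exact_mod_cast one_le_of_mem_idx hj)
        (by norm_num)
    -- Cauchy-Schwarz with y_j²/j² = (y_j² j^{-3/4}) j^{-5/4}. The exponent 3/4 makes both j^{-5/4}
    -- and, in the next estimate, j^{-3/2} summable.
    have h2 : (∑ j ∈ idx n, y j / j) ^ 2 ≤ T * S1 := by
      calc _ ≤ T * ∑ j ∈ idx n, (j : ℝ) ^ (-(5 / 4) : ℝ) := by
            refine Finset.sum_sq_le_sum_mul_sum_of_sq_le_mul _ (fun j _ => by positivity)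
              (fun j _ => by positivity) fun j hj => le_of_eq ?_
            rw [mul_assoc, ← Real.rpow_add (hpos j hj), div_pow, div_eq_mul_inv]
            norm_num [Real.rpow_neg (hpos j hj).le]
        _ ≤ T * S1 :=
            mul_le_mul_of_nonneg_left (hs1.sum_le_tsum _ fun j _ => by positivity) hT0
    have h3 : (∑ j ∈ idx n, y j * (j : ℝ) ^ (-(3 / 4) : ℝ)) ^ 2 ≤ Q * S2 := by
      calc _ ≤ Q * ∑ j ∈ idx n, (j : ℝ) ^ (-(3 / 2) : ℝ) := by
            refine Finset.sum_sq_le_sum_mul_sum_of_sq_le_mul _ (fun j _ => sq_nonneg _)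
              (fun j _ => by positivity) fun j hj => le_of_eq ?_
            rw [mul_pow, sq ((j : ℝ) ^ (-(3 / 4) : ℝ)), ← Real.rpow_add (hpos j hj)]
            norm_num
        _ ≤ Q * S2 :=
            mul_le_mul_of_nonneg_left (hs2.sum_le_tsum _ fun j _ => by positivity) hQ
    have h4 : ∑ j ∈ idx n, y j * (j : ℝ) ^ (-(3 / 4) : ℝ) ≤ Real.sqrt Q * Real.sqrt S2 := by
      rw [← Real.sqrt_mul hQ]
      exact Real.le_sqrt_of_sq_le h3
    have h5 : T ≤ M * ∑ j ∈ idx n, y j * (j : ℝ) ^ (-(3 / 4) : ℝ) := by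
      rw [Finset.mul_sum]
      refine Finset.sum_le_sum fun j hj => ?_
      rw [sq, mul_assoc]
      refine mul_le_mul_of_nonneg_right (hy j hj).2 ?_
      have := (hy j hj).1
      positivity
    have h6 : T ≤ M * (Real.sqrt Q * Real.sqrt S2) := h5.trans (mul_le_mul_of_nonneg_left h4 hM)
    calc _ ≤ (1 + S1) * T := by linarith
      _ ≤ (1 + S1) * (M * (Real.sqrt Q * Real.sqrt S2)) := by gcongr
      _ = _ := by ring
  have hx : 0 ≤ M ^ 2 * Real.log n ^ 3 := by positivity
  have hz : 0 ≤ M * Real.sqrt Q := by positivity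
  rcases min_choice (M ^ 2 * Real.log n ^ 3) (M * Real.sqrt Q) with h | h <;> rw [h]
  · have : 0 ≤ (1 + S1) * Real.sqrt S2 * (M ^ 2 * Real.log n ^ 3) := by positivity
    linarith
  · linarith

end WeightedSums

/-! ### Moduli of continuity adapted to the Dirichlet kernel -/

section Modulus

/-- `‖G x - G y‖² ≤ δ_n (1 + n (x - y)²)` on `Π`. -/
def ModulusBound (δ : ℕ → ℝ) (G : ℝ → ℂ) : Prop :=
  ∀ n : ℕ, 1 ≤ n → ∀ x ∈ PiInt, ∀ y ∈ PiInt, ‖G x - G y‖ ^ 2 ≤ δ n * (1 + n * (x - y) ^ 2)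

lemma zero_mem_piInt : (0 : ℝ) ∈ PiInt := ⟨by linarith [Real.pi_pos], Real.pi_pos.le⟩

lemma ModulusBound.nonneg {δ : ℕ → ℝ} {G : ℝ → ℂ} (h : ModulusBound δ G) {n : ℕ} (hn : 1 ≤ n) :
    0 ≤ δ n := by
  simpa using h n hn 0 zero_mem_piInt 0 zero_mem_piInt

lemma exists_bound_piInt {G : ℝ → ℂ} (hG : ContinuousOn G PiInt) :
    ∃ K : ℝ, 0 < K ∧ ∀ x ∈ PiInt, ‖G x‖ ≤ K := by
  obtain ⟨K, hK⟩ := isCompact_Icc.exists_bound_of_continuousOn hG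
  exact ⟨max K 1, by positivity, fun x hx => (hK x hx).trans (le_max_left _ _)⟩

/-- The weight 1 + n(x - y)² fits the kernel: D_n has energy 2πn while (x - u)² |D_n(x - u)|² is
bounded for |x - u| ≤ π, so both parts cost O(n δ_n). The best δ_n is the supremum of the quotients.
It tends to 0 because uniform continuity gives, for each ε, a bound ε/4 + c(x - y)², and c ≤ (ε/4) n
for large n. -/
lemma exists_modulusBound {G : ℝ → ℂ} (hG : ContinuousOn G PiInt) :
    ∃ δ : ℕ → ℝ, Tendsto δ atTop (𝓝 0) ∧ ModulusBound δ G := by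
  obtain ⟨K, hK0, hK⟩ := exists_bound_piInt hG
  let r : ℕ → PiInt × PiInt → ℝ := fun n p =>
    ‖G p.1 - G p.2‖ ^ 2 / (1 + n * ((p.1 : ℝ) - p.2) ^ 2)
  have hnum : ∀ p : PiInt × PiInt, ‖G p.1 - G p.2‖ ^ 2 ≤ (2 * K) ^ 2 := fun p => by
    refine pow_le_pow_left₀ (norm_nonneg _) ?_ 2
    linarith [norm_sub_le (G p.1) (G p.2), hK _ p.1.2, hK _ p.2.2]
  have hden : ∀ (n : ℕ) (p : PiInt × PiInt), 1 ≤ 1 + n * ((p.1 : ℝ) - p.2) ^ 2 := fun n p => by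
    have : 0 ≤ n * ((p.1 : ℝ) - p.2) ^ 2 := by positivity
    linarith
  have hr0 : ∀ n p, 0 ≤ r n p := fun n p =>
    div_nonneg (sq_nonneg _) (zero_le_one.trans (hden n p))
  have hbdd : ∀ n, BddAbove (Set.range (r n)) := fun n => ⟨(2 * K) ^ 2, by
    rintro _ ⟨p, rfl⟩
    exact (div_le_self (sq_nonneg _) (hden n p)).trans (hnum p)⟩
  refine ⟨fun n => ⨆ p, r n p, ?_, ?_⟩
  · rw [Metric.tendsto_atTop]
    intro ε hε
    have huc := Metric.uniformContinuousOn_iff.mp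
      (isCompact_Icc.uniformContinuousOn_of_continuous hG) (Real.sqrt (ε / 4)) (by positivity)
    obtain ⟨ρ, hρ, hG'⟩ := huc
    set c := (2 * K) ^ 2 / ρ ^ 2 with hc
    have hc0 : 0 ≤ c := by positivity
    have hmod : ∀ p : PiInt × PiInt, ‖G p.1 - G p.2‖ ^ 2 ≤ ε / 4 + c * ((p.1 : ℝ) - p.2) ^ 2 := by
      intro p
      rcases lt_or_ge (dist (p.1 : ℝ) p.2) ρ with h | h
      · have h1 := (hG' _ p.1.2 _ p.2.2 h).le
        rw [dist_eq_norm] at h1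
        have h2 := pow_le_pow_left₀ (norm_nonneg _) h1 2
        rw [Real.sq_sqrt (by positivity)] at h2
        have : 0 ≤ c * ((p.1 : ℝ) - p.2) ^ 2 := by positivity
        linarith
      · have h1 : ρ ^ 2 ≤ ((p.1 : ℝ) - p.2) ^ 2 := by
          rw [Real.dist_eq] at h
          rw [← sq_abs ((p.1 : ℝ) - p.2)]
          exact pow_le_pow_left₀ hρ.le h 2
        have h2 := mul_le_mul_of_nonneg_left h1 hc0
        rw [hc, div_mul_cancel₀ _ (by positivity)] at h2
        linarith [hnum p]
    obtain ⟨N, hN⟩ := exists_nat_gt (c / (ε / 4))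
    refine ⟨N + 1, fun n hn => ?_⟩
    have hn0 : (0 : ℝ) < n := by exact_mod_cast (by omega : 0 < n)
    have hcn : c ≤ ε / 4 * n := by
      have : (N : ℝ) ≤ n := by exact_mod_cast (by omega : N ≤ n)
      rw [div_lt_iff₀ (by positivity)] at hN
      nlinarith
    have hle : ⨆ p, r n p ≤ ε / 2 := by
      refine Real.iSup_le (fun p => ?_) (by positivity)
      rw [div_le_iff₀ (zero_lt_one.trans_le (hden n p))]
      have := mul_le_mul_of_nonneg_right hcn (sq_nonneg ((p.1 : ℝ) - p.2))
      have h0 : 0 ≤ ε / 4 * n * ((p.1 : ℝ) - p.2) ^ 2 := by positivity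
      linarith [hmod p]
    rw [Real.dist_eq, sub_zero, abs_of_nonneg (Real.iSup_nonneg (hr0 n))]
    linarith
  · intro n _ x hx y hy
    have h := le_ciSup (hbdd n) (⟨⟨x, hx⟩, ⟨y, hy⟩⟩ : PiInt × PiInt)
    have hd := hden n (⟨⟨x, hx⟩, ⟨y, hy⟩⟩ : PiInt × PiInt)
    exact (div_le_iff₀ (zero_lt_one.trans_le hd)).mp h

lemma LipClass.continuousOn {β : ℝ≥0} (hβ : 0 < β) {G : ℝ → ℂ} (hG : LipClass β G) :
    ContinuousOn G PiInt := by
  obtain ⟨C, hC⟩ := hG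
  exact (hC.uniformContinuousOn hβ).continuousOn

/-- With t = n(x - y)², |x - y|^{2β} = n^{-β} t^β ≤ n^{-β}(1 + t). This covers β = 1 as well, so the
logarithm in `lipRate` is only slack. -/
lemma LipClass.exists_modulusBound {β : ℝ≥0} (hβ1 : β ≤ 1) {G : ℝ → ℂ}
    (hG : LipClass β G) :
    ∃ C : ℝ, 0 ≤ C ∧ ModulusBound (fun n => C * (n : ℝ) ^ (-(β : ℝ))) G := by
  obtain ⟨C, hC⟩ := hG
  refine ⟨(C : ℝ) ^ 2, by positivity, fun n hn x hx y hy => ?_⟩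
  have hn0 : (0 : ℝ) < n := by exact_mod_cast hn
  have h1 := hC.dist_le hx hy
  rw [dist_eq_norm, Real.dist_eq] at h1
  have h2 := pow_le_pow_left₀ (norm_nonneg _) h1 2
  set t := (n : ℝ) * (x - y) ^ 2
  have ht : 0 ≤ t := by positivity
  have hβ' : (0 : ℝ) ≤ β := β.2
  have htb : t ^ (β : ℝ) ≤ 1 + t := by
    rcases le_or_gt t 1 with h | h
    · linarith [Real.rpow_le_one ht h hβ']
    · have := Real.rpow_le_rpow_of_exponent_le h.le (by exact_mod_cast hβ1 : (β : ℝ) ≤ 1)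
      rw [Real.rpow_one] at this
      linarith
  have h3 : (|x - y| ^ (β : ℝ)) ^ 2 = (n : ℝ) ^ (-(β : ℝ)) * t ^ (β : ℝ) := by
    rw [Real.mul_rpow hn0.le (sq_nonneg _), ← mul_assoc, ← Real.rpow_add hn0, neg_add_cancel,
      Real.rpow_zero, one_mul, ← sq_abs (x - y), ← Real.rpow_natCast, ← Real.rpow_natCast,
      ← Real.rpow_mul (abs_nonneg _), ← Real.rpow_mul (abs_nonneg _), mul_comm]
  rw [mul_pow, h3, ← mul_assoc] at h2
  exact h2.trans (mul_le_mul_of_nonneg_left htb (by positivity))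

lemma rpow_neg_le_lipRate {β : ℝ≥0} {n : ℕ} (hn : 4 ≤ n) :
    (n : ℝ) ^ (-(β : ℝ)) ≤ lipRate β n := by
  rw [lipRate]
  split_ifs with h
  · rw [h, NNReal.coe_one, Real.rpow_neg_one, ← one_div]
    have := one_le_log hn
    gcongr
    nlinarith
  · exact le_rfl

lemma lipRate_nonneg (β : ℝ≥0) (n : ℕ) : 0 ≤ lipRate β n := by
  rw [lipRate]
  split_ifs <;> positivity

lemma tendsto_lipRate {β : ℝ≥0} (hβ : 0 < β) : Tendsto (lipRate β) atTop (𝓝 0) := by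
  unfold lipRate
  by_cases h : β = 1
  · simp only [h, if_true]
    have := (isLittleO_log_rpow_atTop (r := 1 / 2) (by norm_num)).tendsto_div_nhds_zero
    have h2 := (this.pow 2).comp tendsto_natCast_atTop_atTop
    simp only [ne_eq, OfNat.ofNat_ne_zero, not_false_eq_true, zero_pow] at h2
    refine h2.congr fun n => ?_
    simp only [Function.comp_apply, div_pow]
    rw [← Real.rpow_natCast ((n : ℝ) ^ (1 / 2 : ℝ)), ← Real.rpow_mul (Nat.cast_nonneg n)]
    norm_num
  · simp only [h, if_false]
    exact (tendsto_rpow_neg_atTop (by exact_mod_cast hβ)).comp tendsto_natCast_atTop_atTop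

end Modulus

/-! ### From Π to (0, 2π): gluing the factors at π -/

section Wrap

/-- A function on `Π`, moved to `(0, 2π)` with the factor `κ` on `(π, 2π)`. -/
noncomputable def wrap (κ : ℂ) (G : ℝ → ℂ) (x : ℝ) : ℂ :=
  if x ≤ Real.pi then G x else κ * G (x - 2 * Real.pi)

lemma mem_piInt_of_Ioo {x : ℝ} (hx : x ∈ Set.Ioo 0 Real.pi) : x ∈ PiInt :=
  ⟨by linarith [hx.1, Real.pi_pos], hx.2.le⟩

lemma pi_mem_piInt : Real.pi ∈ PiInt := ⟨by linarith [Real.pi_pos], le_rfl⟩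

lemma neg_pi_mem_piInt : -Real.pi ∈ PiInt := ⟨le_rfl, by linarith [Real.pi_pos]⟩

lemma norm_wrap_le {κ : ℂ} {G : ℝ → ℂ} {K : ℝ} (hK : ∀ x ∈ PiInt, ‖G x‖ ≤ K) {x : ℝ}
    (hx : x ∈ Set.Ioo 0 (2 * Real.pi)) : ‖wrap κ G x‖ ≤ (1 + ‖κ‖) * K := by
  have hK0 : 0 ≤ K := (norm_nonneg _).trans (hK 0 zero_mem_piInt)
  have hκ := norm_nonneg κ
  have := mul_nonneg hκ hK0
  rw [wrap]
  split_ifs with h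
  · linarith [hK x ⟨by linarith [hx.1, Real.pi_pos], h⟩]
  · push Not at h
    rw [norm_mul]
    have h1 := hK (x - 2 * Real.pi) ⟨by linarith, by linarith [hx.2, Real.pi_pos]⟩
    linarith [mul_le_mul_of_nonneg_left h1 hκ]

lemma aestronglyMeasurable_wrap {κ : ℂ} {G : ℝ → ℂ} (hG : ContinuousOn G PiInt) :
    AEStronglyMeasurable (wrap κ G) (volume.restrict (Set.Ioc 0 (2 * Real.pi))) := by
  have hpi := Real.pi_pos
  rw [← Set.Ioc_union_Ioc_eq_Ioc hpi.le (by linarith : Real.pi ≤ 2 * Real.pi),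
    aestronglyMeasurable_union_iff]
  constructor
  · refine ContinuousOn.aestronglyMeasurable ?_ measurableSet_Ioc
    refine (hG.mono fun x hx => ?_).congr fun x hx => by rw [wrap, if_pos hx.2]
    exact ⟨by linarith [hx.1], hx.2⟩
  · refine ContinuousOn.aestronglyMeasurable ?_ measurableSet_Ioc
    refine ContinuousOn.congr (f := fun x => κ * G (x - 2 * Real.pi)) ?_
      fun x hx => by rw [wrap, if_neg (not_le.mpr hx.1)]
    refine continuousOn_const.mul (hG.comp (by fun_prop) fun x hx => ?_)
    exact ⟨by linarith [hx.1], by linarith [hx.2]⟩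

/-- The condition on κ makes the wrapped function continuous at π, so that for x > π the increment
splits at π into two increments of G inside Π, each over a distance at most x - u. -/
lemma ModulusBound.wrap_le {δ : ℕ → ℝ} {G : ℝ → ℂ} (h : ModulusBound δ G) {κ : ℂ}
    (hκ : κ * G (-Real.pi) = G Real.pi) {n : ℕ} (hn : 1 ≤ n) {u x : ℝ}
    (hu : u ∈ Set.Ioo 0 Real.pi) (hx : x ∈ Set.Ioo 0 (2 * Real.pi)) :
    ‖wrap κ G x - wrap κ G u‖ ^ 2 ≤
      (2 + 2 * ‖κ‖ ^ 2) * δ n + (2 + 2 * ‖κ‖ ^ 2) * (n * δ n) * (x - u) ^ 2 := by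
  have hδ := h.nonneg hn
  have hκ0 := sq_nonneg ‖κ‖
  have hn0 : (0 : ℝ) ≤ n := Nat.cast_nonneg n
  have hwu : wrap κ G u = G u := by rw [wrap, if_pos hu.2.le]
  have huP := mem_piInt_of_Ioo hu
  rw [hwu, wrap]
  split_ifs with hxp
  · have h1 := h n hn x ⟨by linarith [hx.1, Real.pi_pos], hxp⟩ u huP
    have h2 : 0 ≤ δ n * (1 + n * (x - u) ^ 2) := by positivity
    have h3 := mul_nonneg hκ0 h2
    linarith
  · push Not at hxp
    have hxP : x - 2 * Real.pi ∈ PiInt := ⟨by linarith, by linarith [hx.2, Real.pi_pos]⟩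
    have h1 := h n hn _ hxP _ neg_pi_mem_piInt
    have h2 := h n hn _ pi_mem_piInt u huP
    have hdec : κ * G (x - 2 * Real.pi) - G u =
        κ * (G (x - 2 * Real.pi) - G (-Real.pi)) + (G Real.pi - G u) := by
      rw [mul_sub, hκ]; ring
    have h3 : ‖κ * G (x - 2 * Real.pi) - G u‖ ^ 2 ≤
        2 * (‖κ‖ ^ 2 * ‖G (x - 2 * Real.pi) - G (-Real.pi)‖ ^ 2) + 2 * ‖G Real.pi - G u‖ ^ 2 := by
      rw [hdec, ← mul_pow, ← norm_mul]
      have := pow_le_pow_left₀ (norm_nonneg _) (norm_add_le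
        (κ * (G (x - 2 * Real.pi) - G (-Real.pi))) (G Real.pi - G u)) 2
      linarith [sq_nonneg (‖κ * (G (x - 2 * Real.pi) - G (-Real.pi))‖ - ‖G Real.pi - G u‖)]
    have hd1 : (x - 2 * Real.pi - -Real.pi) ^ 2 ≤ (x - u) ^ 2 :=
      pow_le_pow_left₀ (by linarith) (by linarith [hu.2]) 2
    have hd2 : (Real.pi - u) ^ 2 ≤ (x - u) ^ 2 :=
      pow_le_pow_left₀ (by linarith [hu.2]) (by linarith) 2
    have h1' : ‖G (x - 2 * Real.pi) - G (-Real.pi)‖ ^ 2 ≤ δ n * (1 + n * (x - u) ^ 2) :=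
      h1.trans (by gcongr)
    have h2' : ‖G Real.pi - G u‖ ^ 2 ≤ δ n * (1 + n * (x - u) ^ 2) := h2.trans (by gcongr)
    have h4 := mul_le_mul_of_nonneg_left h1' hκ0
    linarith

lemma PowerSingular.ne_zero {d : ℝ} {h : ℝ → ℂ} (hh : PowerSingular d h) {x : ℝ}
    (hx : x ∈ PiInt) (hx0 : x ≠ 0) : h x ≠ 0 := by
  obtain ⟨h', C, C₁, C₂, -, h1, -, hP⟩ := hh
  have := (hP x hx hx0).2.1
  rw [← norm_pos_iff]
  refine lt_of_lt_of_le ?_ this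
  have := Real.rpow_pos_of_pos (abs_pos.mpr hx0) (-d)
  positivity

/-- The factor κ ≠ 0 affects only the constants and removes the jump of h at π. The Lipschitz
estimate is the mean value inequality on [u/2, π] and [-π, -u/2], where |h'| is O(u^{-1-d}), chained
through π. -/
lemma PowerSingular.powerLike {d : ℝ} {h : ℝ → ℂ} (hd : |d| < 1 / 2) (hh : PowerSingular d h)
    {κ : ℂ} (hκ0 : κ ≠ 0) (hκ : κ * h (-Real.pi) = h Real.pi) :
    ∃ c₁ c₂ c₃, PowerLike d c₁ c₂ c₃ (wrap κ h) := by
  obtain ⟨h', C, C₁, C₂, hC, hC1, hC2, hP⟩ := hh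
  have hpi := Real.pi_pos
  have hd' := abs_lt.mp hd
  have hκp : 0 < ‖κ‖ := norm_pos_iff.mpr hκ0
  have hmv : ∀ u : ℝ, 0 < u → ∀ a b : ℝ, Set.Icc a b ⊆ PiInt → (∀ y ∈ Set.Icc a b, u / 2 ≤ |y|) →
      ∀ x ∈ Set.Icc a b, ∀ y ∈ Set.Icc a b, ‖h x - h y‖ ≤ 4 * C * u ^ (-1 - d) * |x - y| := by
    intro u hu a b hsub hlow x hx y hy
    have hne : ∀ y ∈ Set.Icc a b, y ≠ 0 := fun y hy h0 => by
      have := hlow y hy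
      rw [h0, abs_zero] at this
      linarith
    have := (convex_Icc a b).norm_image_sub_le_of_norm_hasDerivWithin_le (f := h) (f' := h')
      (C := 4 * C * u ^ (-1 - d))
      (fun y hy => ((hP y (hsub hy) (hne y hy)).1).mono hsub) (fun y hy => ?_) hy hx
    · simpa [Real.norm_eq_abs] using this
    · refine (hP y (hsub hy) (hne y hy)).2.2.2.trans ?_
      have h1 : |y| ^ (-1 - d) ≤ (u / 2) ^ (-1 - d) :=
        Real.rpow_le_rpow_of_nonpos (by positivity) (hlow y hy) (by linarith [hd'.1])
      have h2 : (u / 2) ^ (-1 - d) = u ^ (-1 - d) * 2 ^ (1 + d) := by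
        rw [Real.div_rpow hu.le (by norm_num), div_eq_mul_inv, ← Real.rpow_neg (by norm_num)]
        congr 2
        ring
      -- Replacing |y| by its lower bound u/2 costs 2^{1+d}; this is the 4 in 4C.
      have h3 : (2 : ℝ) ^ (1 + d) ≤ 4 := by
        have := Real.rpow_le_rpow_of_exponent_le (by norm_num : (1 : ℝ) ≤ 2)
          (by push_cast; linarith [hd'.2] : 1 + d ≤ (2 : ℕ))
        rw [Real.rpow_natCast] at this
        linarith
      have hu' := Real.rpow_pos_of_pos hu (-1 - d)
      calc C * |y| ^ (-1 - d) ≤ C * (u ^ (-1 - d) * 4) := by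
            rw [h2] at h1
            gcongr
            exact h1.trans (by gcongr)
        _ = _ := by ring
  have hval : ∀ x ∈ Set.Ioo 0 (2 * Real.pi),
      (wrap κ h x = h x ∧ x ∈ PiInt ∧ x ≠ 0 ∧ |x| = min x (2 * Real.pi - x)) ∨
      (wrap κ h x = κ * h (x - 2 * Real.pi) ∧ x - 2 * Real.pi ∈ PiInt ∧ x - 2 * Real.pi ≠ 0 ∧
        |x - 2 * Real.pi| = min x (2 * Real.pi - x)) := by
    intro x hx
    rcases le_or_gt x Real.pi with h | h
    · left
      refine ⟨by rw [wrap, if_pos h], ⟨by linarith [hx.1], h⟩, hx.1.ne', ?_⟩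
      rw [abs_of_pos hx.1, min_eq_left (by linarith)]
    · right
      refine ⟨by rw [wrap, if_neg (not_le.mpr h)], ⟨by linarith, by linarith [hx.2]⟩,
        by linarith [hx.2], ?_⟩
      rw [abs_of_neg (by linarith [hx.2]), min_eq_right (by linarith)]
      ring
  refine ⟨C₁ * min 1 ‖κ‖, C₂ * (1 + ‖κ‖), 4 * C * (1 + ‖κ‖), ?_, by positivity, ?_, ?_, ?_⟩
  · have : 0 < min 1 ‖κ‖ := lt_min one_pos hκp
    positivity
  · intro x hx
    rcases hval x hx with ⟨hw, hxP, hx0, hm⟩ | ⟨hw, hxP, hx0, hm⟩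
    · rw [hw, ← hm]
      refine le_trans ?_ (hP x hxP hx0).2.1
      have := Real.rpow_nonneg (abs_nonneg x) (-d)
      gcongr
      exact mul_le_of_le_one_right hC1.le (min_le_left _ _)
    · rw [hw, ← hm, norm_mul]
      have h1 := mul_le_mul_of_nonneg_left (hP _ hxP hx0).2.1 hκp.le
      refine le_trans ?_ h1
      have := Real.rpow_nonneg (abs_nonneg (x - 2 * Real.pi)) (-d)
      have h2 := mul_le_mul_of_nonneg_left (min_le_right 1 ‖κ‖)
        (mul_nonneg hC1.le this)
      linarith
  · intro x hx
    rcases hval x hx with ⟨hw, hxP, hx0, hm⟩ | ⟨hw, hxP, hx0, hm⟩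
    · rw [hw, ← hm]
      refine (hP x hxP hx0).2.2.1.trans ?_
      have := Real.rpow_nonneg (abs_nonneg x) (-d)
      gcongr
      nlinarith
    · rw [hw, ← hm, norm_mul]
      refine (mul_le_mul_of_nonneg_left (hP _ hxP hx0).2.2.1 hκp.le).trans ?_
      have := mul_nonneg hC2.le (Real.rpow_nonneg (abs_nonneg (x - 2 * Real.pi)) (-d))
      linarith
  · intro u hu x hx hxu
    have hu0 := hu.1
    have hxu' := abs_le.mp hxu
    have hup := Real.rpow_pos_of_pos hu0 (-1 - d)
    have hwu : wrap κ h u = h u := by rw [wrap, if_pos hu.2.le]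
    have hsub : Set.Icc (u / 2) Real.pi ⊆ PiInt := Set.Icc_subset_Icc_left (by linarith)
    have hlow : ∀ y ∈ Set.Icc (u / 2) Real.pi, u / 2 ≤ |y| := fun y hy =>
      hy.1.trans (le_abs_self y)
    have huI : u ∈ Set.Icc (u / 2) Real.pi := ⟨by linarith, hu.2.le⟩
    rw [hwu, wrap]
    split_ifs with hxp
    · have h1 := hmv u hu0 _ _ hsub hlow x ⟨by linarith, hxp⟩ u huI
      have h2 : 0 ≤ C * ‖κ‖ * (u ^ (-1 - d) * |x - u|) := by positivity
      linarith
    · push Not at hxp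
      have h1 := hmv u hu0 _ _ hsub hlow Real.pi ⟨by linarith [hu.2], le_rfl⟩ u huI
      have h2 := hmv u hu0 (-Real.pi) (-(u / 2)) (Set.Icc_subset_Icc_right (by linarith))
        (fun y hy => by rw [abs_of_nonpos (by linarith [hy.2])]; linarith [hy.2])
        (x - 2 * Real.pi) ⟨by linarith, by linarith [hu.2]⟩ (-Real.pi)
        ⟨le_rfl, by linarith [hu.2]⟩
      have e1 : |Real.pi - u| ≤ |x - u| := by
        rw [abs_of_pos (by linarith [hu.2]), abs_of_pos (by linarith [hu.2])]
        linarith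
      have e2 : |x - 2 * Real.pi - -Real.pi| ≤ |x - u| := by
        rw [abs_of_pos (by linarith), abs_of_pos (by linarith [hu.2])]
        linarith [hu.2]
      have hdec : κ * h (x - 2 * Real.pi) - h u =
          κ * (h (x - 2 * Real.pi) - h (-Real.pi)) + (h Real.pi - h u) := by
        rw [mul_sub, hκ]; ring
      rw [hdec]
      calc _ ≤ ‖κ‖ * ‖h (x - 2 * Real.pi) - h (-Real.pi)‖ + ‖h Real.pi - h u‖ := by
            rw [← norm_mul]; exact norm_add_le _ _
        _ ≤ ‖κ‖ * (4 * C * u ^ (-1 - d) * |x - u|) + 4 * C * u ^ (-1 - d) * |x - u| := by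
            gcongr
            · exact h2.trans (by gcongr)
            · exact h1.trans (by gcongr)
        _ = _ := by ring

end Wrap

/-! ### Bounds on E r_n² and comparison with v_n² -/

section Assembly

variable {Ω : Type*} [MeasurableSpace Ω] {P : Measure Ω} [IsProbabilityMeasure P]
  {ζ X : ℤ → Ω → ℝ} {a : ℕ → ℝ} {A : ℝ → ℂ}

lemma specDensity_nonneg (A : ℝ → ℂ) (u : ℝ) : 0 ≤ specDensity A u := by
  have := Real.pi_pos
  unfold specDensity
  positivity

omit [IsProbabilityMeasure P] in
lemma rMS_nonneg (b : ℕ → ℝ) (n : ℕ) : 0 ≤ rMS P ζ X A b n :=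
  integral_nonneg fun _ => sq_nonneg _

lemma rMS_le_of_kernel (hζ : IsStandardIID P ζ) (hζ4 : MemLp (ζ 0) 4 P)
    (hX : IsLinearProcess P a ζ X) (hA : IsTransferFunction a A) :
    ∃ C : ℝ, 0 < C ∧ ∀ (n : ℕ) (b : ℕ → ℝ) (V : ℝ), 1 ≤ n →
      (∀ S : Finset ℤ, ∑ s ∈ S, ∑ t ∈ S, ‖kernelEntry A b n s t‖ ^ 2 ≤ n ^ 2 * V) →
      rMS P ζ X A b n ≤ C * V := by
  have hV0 : 0 ≤ ∫ ω, (ζ 0 ω ^ 2 - 1) ^ 2 ∂P := integral_nonneg fun _ => sq_nonneg _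
  have hpi := Real.pi_pos
  refine ⟨(4 + 2 * ∫ ω, (ζ 0 ω ^ 2 - 1) ^ 2 ∂P) * (2 * Real.pi)⁻¹ ^ 2, by positivity,
    fun n b V hn h => ?_⟩
  have hn0 : (0 : ℝ) < n := by exact_mod_cast hn
  refine (rErr_sq_le hζ hζ4 hX hA b n h).2.trans (le_of_eq ?_)
  field_simp

/-- Bounded transfer functions. -/
lemma rMS_le_of_modulusBound (hζ : IsStandardIID P ζ) (hζ4 : MemLp (ζ 0) 4 P)
    (hX : IsLinearProcess P a ζ X) (hA : IsTransferFunction a A) (hc : ContinuousOn A PiInt)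
    {δ : ℕ → ℝ} (hδ : ModulusBound δ A) :
    ∃ C : ℝ, 0 < C ∧ ∀ (n : ℕ) (b : ℕ → ℝ), 1 ≤ n → rMS P ζ X A b n ≤ C * δ n * BSq b n := by
  obtain ⟨C, hC, hr⟩ := rMS_le_of_kernel hζ hζ4 hX hA
  obtain ⟨K, hK0, hK⟩ := exists_bound_piInt hc
  have hpi := Real.pi_pos
  have hAper : ∀ x, A (x - 2 * Real.pi) = A x := fun x => hA.periodic.sub_eq x
  have hwrap : ∀ x, wrap 1 A x = A x := fun x => by
    rw [wrap, one_mul, hAper, ite_self]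
  set L := 2 * Real.pi * 4 + 2 * Real.pi ^ 3 * 4
  refine ⟨C * (10 * ((1 + ‖(1 : ℂ)‖) * K) ^ 2 * L), by positivity, fun n b hn => ?_⟩
  have hn0 : (0 : ℝ) < n := by exact_mod_cast hn
  have hδ0 := hδ.nonneg hn
  have hkey : ∀ j ∈ idx n, ∫ x in (0 : ℝ)..2 * Real.pi,
      ‖(A x - A (freq n j)) * dirichletKer n (x - freq n j)‖ ^ 2 ≤ L * (n * δ n) := by
    intro j hj
    have hu : freq n j ∈ Set.Ioo 0 Real.pi := ⟨freq_pos hj, freq_lt_pi hj⟩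
    refine (integral_sq_sub_mul_dirichletKer_le (n := n) (η := 4 * δ n) (c := 4 * (n * δ n))
      (R := 0) hu.1 hu.2 (by positivity) le_rfl (fun x hx _ => ?_) (fun x hx hxu => ?_)).trans
      (le_of_eq ?_)
    · have := hδ.wrap_le (κ := 1) (by
        have := hA.periodic (-Real.pi)
        rw [show -Real.pi + 2 * Real.pi = Real.pi by ring] at this
        rw [one_mul, this]) hn hu hx
      rw [hwrap, hwrap] at this
      norm_num at this
      exact this
    -- Periodicity of A transfers the modulus across 2π: there is no jump, hence R = 0 and no term
    -- of order n/j.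
    · have := hδ n hn (x - 2 * Real.pi) ⟨by linarith [hu.1], by linarith [hx.2]⟩ _
        (mem_piInt_of_Ioo hu)
      rw [hAper] at this
      have e : (x - 2 * Real.pi - freq n j) = x - freq n j - 2 * Real.pi := by ring
      rw [e] at this
      have h0 : 0 ≤ δ n * (1 + n * (x - freq n j - 2 * Real.pi) ^ 2) := by positivity
      linarith
    · simp only [L]; ring
  have hker := sum_sq_kernelEntry_le (A := A) (H := fun _ => 1) (g := A)
    (K := (1 + ‖(1 : ℂ)‖) * K) (n := n) (b := b) (pb := fun _ => 0)
    (qb := fun _ => L * (n * δ n)) (sqInt_of_periodic hA.periodic hA.memLp)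
    (sqInt_of_periodic hA.periodic hA.memLp).1
    (fun x hx => by rw [← hwrap]; exact norm_wrap_le hK hx) (fun x _ => by simp)
    (fun _ _ => one_ne_zero) (fun j _ => by simp) hkey
  refine (hr n b (10 * ((1 + ‖(1 : ℂ)‖) * K) ^ 2 * L * δ n * BSq b n) hn fun S =>
    (hker S).trans (le_of_eq ?_)).trans (le_of_eq (by ring))
  simp only [norm_one, one_pow, mul_one, mul_zero, zero_add, Finset.sum_const_zero, BSq,
    ← Finset.sum_mul]
  ring

lemma bf_nonneg (A : ℝ → ℂ) (b : ℕ → ℝ) (n : ℕ) : 0 ≤ bf A b n :=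
  Real.iSup_nonneg fun _ => mul_nonneg (abs_nonneg _) (specDensity_nonneg _ _)

lemma BfSq_nonneg (A : ℝ → ℂ) (b : ℕ → ℝ) (n : ℕ) : 0 ≤ BfSq A b n :=
  Finset.sum_nonneg fun _ _ => sq_nonneg _

lemma minTerm_nonneg (A : ℝ → ℂ) (b : ℕ → ℝ) (n : ℕ) : 0 ≤ minTerm A b n := by
  have := bf_nonneg A b n
  have := Real.log_natCast_nonneg n
  exact le_min (by positivity) (mul_nonneg (bf_nonneg A b n) (Real.sqrt_nonneg _))

/-- Insert the energies n q/j for p_j and n(Lδ + r/j) for q_j into the matrix bound and take out n²,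
which the factor (2πn)⁻² compensates. -/
lemma weighted_error_le {n : ℕ} {β y : ℕ → ℝ} {D K q L r δ : ℝ}
    (hβ : ∀ j ∈ idx n, |β j| ≤ D * y j) (hq : 0 ≤ q) (hL : 0 ≤ L) (hr : 0 ≤ r) (hδ : 0 ≤ δ) :
    10 * K ^ 2 * n * ∑ j ∈ idx n, β j ^ 2 * (n * (q * (1 / j)) + n * (L * δ + r * (1 / j))) +
      5 * (∑ j ∈ idx n, |β j| * (n * (q * (1 / j)))) ^ 2 ≤
    n ^ 2 * (D ^ 2 * ((10 * K ^ 2 * (q + L + r) + 5 * q ^ 2) *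
      (∑ j ∈ idx n, y j ^ 2 / j + (∑ j ∈ idx n, y j / j) ^ 2 + δ * ∑ j ∈ idx n, y j ^ 2))) := by
  set T1 := ∑ j ∈ idx n, y j ^ 2 / j with hT1
  set T2 := ∑ j ∈ idx n, y j / j with hT2
  set B := ∑ j ∈ idx n, y j ^ 2 with hB
  have hT1' : 0 ≤ T1 := Finset.sum_nonneg fun j _ => by positivity
  have hB' : 0 ≤ B := Finset.sum_nonneg fun j _ => sq_nonneg _
  have hfirst : ∑ j ∈ idx n, β j ^ 2 * (n * (q * (1 / j)) + n * (L * δ + r * (1 / j))) ≤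
      n * D ^ 2 * ((q + r) * T1 + L * (δ * B)) := by
    have e : n * D ^ 2 * ((q + r) * T1 + L * (δ * B)) = ∑ j ∈ idx n, (D * y j) ^ 2 *
        (n * (q * (1 / j)) + n * (L * δ + r * (1 / j))) := by
      rw [hT1, hB]
      simp only [Finset.mul_sum, ← Finset.sum_add_distrib]
      exact Finset.sum_congr rfl fun j _ => by ring
    rw [e]
    refine Finset.sum_le_sum fun j hj => mul_le_mul_of_nonneg_right ?_ (by positivity)
    rw [← sq_abs]
    exact pow_le_pow_left₀ (abs_nonneg _) (hβ j hj) 2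
  have hsecond : (∑ j ∈ idx n, |β j| * (n * (q * (1 / j)))) ^ 2 ≤ (n * D * q * T2) ^ 2 := by
    refine pow_le_pow_left₀ (Finset.sum_nonneg fun j _ => by positivity) ?_ 2
    rw [hT2, Finset.mul_sum]
    refine Finset.sum_le_sum fun j hj => ?_
    calc _ ≤ D * y j * (n * (q * (1 / j))) :=
          mul_le_mul_of_nonneg_right (hβ j hj) (by positivity)
      _ = _ := by ring
  have hw : 0 ≤ δ * B := mul_nonneg hδ hB'
  have h1 := mul_le_mul_of_nonneg_left hfirst (by positivity : 0 ≤ 10 * K ^ 2 * (n : ℝ))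
  have z1 : 0 ≤ (10 * K ^ 2 * L + 5 * q ^ 2) * T1 := by positivity
  have z2 : 0 ≤ 10 * K ^ 2 * (q + L + r) * T2 ^ 2 := by positivity
  have z3 : 0 ≤ (10 * K ^ 2 * (q + r) + 5 * q ^ 2) * (δ * B) := by positivity
  have hx : 10 * K ^ 2 * ((q + r) * T1 + L * (δ * B)) + 5 * q ^ 2 * T2 ^ 2 ≤
      (10 * K ^ 2 * (q + L + r) + 5 * q ^ 2) * (T1 + T2 ^ 2 + δ * B) := by
    linarith
  have h2 := mul_le_mul_of_nonneg_left hx (by positivity : 0 ≤ (n : ℝ) ^ 2 * D ^ 2)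
  linarith

/-- Transfer functions with a power singularity at the origin. -/
lemma rMS_le_of_powerSingular (hζ : IsStandardIID P ζ) (hζ4 : MemLp (ζ 0) 4 P)
    (hX : IsLinearProcess P a ζ X) (hA : IsTransferFunction a A) {d : ℝ} {h G : ℝ → ℂ}
    (hd : |d| < 1 / 2) (hh : PowerSingular d h) (hAhG : ∀ u ∈ PiInt, u ≠ 0 → A u = h u * G u)
    (hG0 : ∃ c : ℝ, 0 < c ∧ ∀ u ∈ PiInt, c ≤ ‖G u‖) (hG : ContinuousOn G PiInt)
    {δ : ℕ → ℝ} (hδ : ModulusBound δ G) :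
    ∃ C : ℝ, 0 < C ∧ ∀ (n : ℕ) (b : ℕ → ℝ), 1 ≤ n →
      rMS P ζ X A b n ≤ C * (minTerm A b n + δ n * BfSq A b n) := by
  obtain ⟨C, hC, hr⟩ := rMS_le_of_kernel hζ hζ4 hX hA
  obtain ⟨K₀, hK₀, hKG⟩ := exists_bound_piInt hG
  obtain ⟨c, hc, hcG⟩ := hG0
  obtain ⟨W, hW, hsum⟩ := exists_sum_weights_le
  have hpi := Real.pi_pos
  have hπ0 : h Real.pi ≠ 0 := hh.ne_zero pi_mem_piInt hpi.ne'
  have hmπ0 : h (-Real.pi) ≠ 0 := hh.ne_zero neg_pi_mem_piInt (by linarith)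
  -- Only the product h G inherits the values of the periodic A, so h and G may each jump between π
  -- and -π. Rescaling h by κ and G by κ⁻¹ on (π, 2π) removes both jumps and preserves the product.
  set κ := h Real.pi / h (-Real.pi) with hκdef
  have hκ0 : κ ≠ 0 := div_ne_zero hπ0 hmπ0
  have hκh : κ * h (-Real.pi) = h Real.pi := div_mul_cancel₀ _ hmπ0
  have hκG : κ⁻¹ * G (-Real.pi) = G Real.pi := by
    have h1 := hA.periodic (-Real.pi)
    rw [show -Real.pi + 2 * Real.pi = Real.pi by ring, hAhG _ pi_mem_piInt hpi.ne',
      hAhG _ neg_pi_mem_piInt (by linarith)] at h1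
    rw [hκdef, inv_div, div_mul_eq_mul_div, ← h1]
    field_simp
  obtain ⟨c₁, c₂, c₃, hH⟩ := hh.powerLike hd hκ0 hκh
  obtain ⟨M, hM, hpI⟩ := hH.exists_integral_le hd
  set H := wrap κ h
  set g := wrap κ⁻¹ G
  set K := (1 + ‖κ⁻¹‖) * K₀ with hKdef
  have hK0 : 0 < K := by positivity
  have hgK : ∀ x ∈ Set.Ioo 0 (2 * Real.pi), ‖g x‖ ≤ K := fun x hx => norm_wrap_le hKG hx
  have hHg : ∀ x ∈ Set.Ioo 0 (2 * Real.pi), A x = H x * g x := by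
    intro x hx
    simp only [H, g, wrap]
    split_ifs with hxp
    · exact hAhG x ⟨by linarith [hx.1], hxp⟩ hx.1.ne'
    · push Not at hxp
      rw [← hA.periodic.sub_eq x, hAhG (x - 2 * Real.pi) ⟨by linarith, by linarith [hx.2]⟩
        (by linarith [hx.2])]
      field_simp
  set m := 2 + 2 * ‖κ⁻¹‖ ^ 2 with hm
  set L := 2 * Real.pi * m + 2 * Real.pi ^ 3 * m with hL
  set R := (2 * K) ^ 2 with hR
  have hm0 : 0 < m := by positivity
  have hL0 : 0 < L := by positivity
  -- From f_X = |h|²|G|²/(2π) and |G| ≥ c: |h|² ≤ (2π/c²) f_X.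
  set D := (2 * Real.pi / c ^ 2) with hD
  have hD0 : 0 < D := by positivity
  set F := 10 * K ^ 2 * (M * K ^ 2 + L + R * Real.pi ^ 2) + 5 * (M * K ^ 2) ^ 2 with hF
  have hF0 : 0 < F := by positivity
  refine ⟨C * (F * D ^ 2 * (W + 1)), by positivity, fun n b hn => ?_⟩
  have hn0 : (0 : ℝ) < n := by exact_mod_cast hn
  have hδ0 := hδ.nonneg hn
  have hjpos : ∀ j ∈ idx n, (0 : ℝ) < j := fun j hj => by exact_mod_cast one_le_of_mem_idx hj
  have hfreq : ∀ j ∈ idx n, 1 / freq n j ≤ n / j := by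
    intro j hj
    have := hjpos j hj
    rw [freq, one_div_div, div_le_div_iff_of_pos_left hn0 (by positivity) this]
    nlinarith [Real.pi_gt_three]
  have hu : ∀ j ∈ idx n, freq n j ∈ Set.Ioo 0 Real.pi := fun j hj => ⟨freq_pos hj, freq_lt_pi hj⟩
  have hqb : ∀ j ∈ idx n, ∫ x in (0 : ℝ)..2 * Real.pi,
      ‖(g x - g (freq n j)) * dirichletKer n (x - freq n j)‖ ^ 2 ≤
        n * (L * δ n + R * Real.pi ^ 2 * (1 / j)) := by
    intro j hj
    refine (integral_sq_sub_mul_dirichletKer_le (n := n) (η := m * δ n) (c := m * (n * δ n))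
      (R := R) (hu j hj).1 (hu j hj).2 (by positivity) (by positivity)
      (fun x hx _ => hδ.wrap_le hκG hn (hu j hj) hx) (fun x hx _ => ?_)).trans ?_
    -- Nothing relates G(0⁺) and G(0⁻) across 2π in the wrapped picture, so only the crude bound R =
    -- (2K)² is used there.
    · have h1 : ‖g x - g (freq n j)‖ ≤ 2 * K := by
        linarith [norm_sub_le (g x) (g (freq n j)), hgK x hx, hgK _ (freq_mem_Ioo hj)]
      have h2 := pow_le_pow_left₀ (norm_nonneg _) h1 2
      have h3 : 0 ≤ m * δ n + m * (n * δ n) * (x - freq n j - 2 * Real.pi) ^ 2 := by positivity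
      linarith
    · have h1 := mul_le_mul_of_nonneg_left (hfreq j hj)
        (by positivity : 0 ≤ R * Real.pi ^ 2)
      calc _ = n * (L * δ n) + R * Real.pi ^ 2 * (1 / freq n j) := by rw [hL]; ring
        _ ≤ n * (L * δ n) + R * Real.pi ^ 2 * (n / j) := by linarith
        _ = _ := by ring
  have hpb : ∀ j ∈ idx n, ∫ x in (0 : ℝ)..2 * Real.pi,
      ‖(H x / H (freq n j) - 1) * (g x * dirichletKer n (x - freq n j))‖ ^ 2 ≤
        n * (M * K ^ 2 * (1 / j)) := by
    intro j hj
    refine (hpI n _ g K (hu j hj) hgK).trans ?_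
    have h1 := mul_le_mul_of_nonneg_left (hfreq j hj) (by positivity : 0 ≤ M * K ^ 2)
    calc _ = M * K ^ 2 * (1 / freq n j) := by ring
      _ ≤ M * K ^ 2 * (n / j) := h1
      _ = _ := by ring
  have hHu : ∀ j ∈ idx n, H (freq n j) = h (freq n j) := fun j hj => by
    simp only [H, wrap, if_pos (hu j hj).2.le]
  have hker := sum_sq_kernelEntry_le (b := b) (sqInt_of_periodic hA.periodic hA.memLp)
    (aestronglyMeasurable_wrap hG) hgK hHg
    (fun j hj => by
      rw [hHu j hj]; exact hh.ne_zero (mem_piInt_of_Ioo (hu j hj)) (hu j hj).1.ne') hpb hqb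
  set y : ℕ → ℝ := fun j => |b j| * specDensity A (freq n j) with hy
  have hy0 : ∀ j, 0 ≤ y j := fun j => mul_nonneg (abs_nonneg _) (specDensity_nonneg _ _)
  have hβ : ∀ j ∈ idx n, |b j * ‖H (freq n j)‖ ^ 2| ≤ D * y j := by
    intro j hj
    have huP := mem_piInt_of_Ioo (hu j hj)
    have h1 := pow_le_pow_left₀ hc.le (hcG _ huP) 2
    rw [abs_mul, abs_of_nonneg (sq_nonneg ‖H (freq n j)‖), hHu j hj, hy]
    simp only [specDensity]
    rw [hAhG _ huP (hu j hj).1.ne', norm_mul, mul_pow, hD]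
    calc |b j| * ‖h (freq n j)‖ ^ 2 = |b j| * ‖h (freq n j)‖ ^ 2 * c ^ 2 / c ^ 2 := by
          field_simp
      _ ≤ |b j| * ‖h (freq n j)‖ ^ 2 * ‖G (freq n j)‖ ^ 2 / c ^ 2 := by gcongr
      _ = _ := by field_simp
  have hysq : ∑ j ∈ idx n, y j ^ 2 = BfSq A b n := by
    rw [BfSq]
    refine Finset.sum_congr rfl fun j _ => ?_
    rw [hy, mul_pow, mul_pow, sq_abs]
  have hbf : ∀ j ∈ idx n, y j ≤ bf A b n := fun j hj =>
    le_ciSup (f := fun j : idx n => |b j| * specDensity A (freq n j))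
      (Set.finite_range _).bddAbove ⟨j, hj⟩
  have hbf0 : 0 ≤ bf A b n := Real.iSup_nonneg fun j => hy0 j
  have hmin := hsum n y (bf A b n) hbf0 fun j hj => ⟨hy0 j, hbf j hj⟩
  have hmin' : ∑ j ∈ idx n, y j ^ 2 / j + (∑ j ∈ idx n, y j / j) ^ 2 ≤ W * minTerm A b n := by
    rw [hysq] at hmin
    exact hmin
  refine (hr n b (D ^ 2 * (F * (∑ j ∈ idx n, y j ^ 2 / j + (∑ j ∈ idx n, y j / j) ^ 2 +
    δ n * ∑ j ∈ idx n, y j ^ 2))) hn fun S => (hker S).trans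
    (weighted_error_le hβ (by positivity) hL0.le (by positivity) hδ0)).trans ?_
  have hw : 0 ≤ δ n * BfSq A b n := mul_nonneg hδ0 (BfSq_nonneg A b n)
  have hmt := minTerm_nonneg A b n
  have hfin : ∑ j ∈ idx n, y j ^ 2 / j + (∑ j ∈ idx n, y j / j) ^ 2 + δ n * BfSq A b n ≤
      (W + 1) * (minTerm A b n + δ n * BfSq A b n) := by
    have := mul_nonneg hW.le hw
    linarith
  rw [hysq]
  calc _ ≤ C * (D ^ 2 * (F * ((W + 1) * (minTerm A b n + δ n * BfSq A b n)))) := by gcongr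
    _ = _ := by ring

omit [IsProbabilityMeasure P] in
-- Needed because the stated rates may vanish for small n, for instance log 1 = 0.
lemma rMS_eq_zero {b : ℕ → ℝ} {n : ℕ} (hn : n < 4) : rMS P ζ X A b n = 0 := by
  have hidx : idx n = ∅ := by
    rw [Finset.eq_empty_iff_forall_notMem]
    intro j hj
    have := four_le_of_mem_idx hj
    omega
  simp [rMS, rErr, QX, QZ, hidx]

/-- `v_n²` is comparable to `B_{f,n}²`. -/
lemma exists_le_vSq (hζ : IsStandardIID P ζ) (hζ4 : MemLp (ζ 0) 4 P)
    (hv : 0 < variance (fun ω => ζ 0 ω ^ 2) P) (A : ℝ → ℂ) :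
    ∃ c : ℝ, 0 < c ∧ ∀ (n : ℕ) (b : ℕ → ℝ), c * BfSq A b n ≤ vSq P ζ A b n := by
  set w := variance (fun ω => ζ 0 ω ^ 2) P with hw
  -- For a standardized variable, Eζ⁴ - 3 = (Eζ⁴ - 1) - 2.
  have hcum : cum4 P (ζ 0) = w - 2 := by
    have h2 : MemLp (fun ω => ζ 0 ω ^ 2) 2 P := by
      have := (memLp_four_innovation hζ hζ4 0).mul' (memLp_four_innovation hζ hζ4 0) (r := 2)
      simpa only [sq] using this
    rw [hw, variance_eq_sub h2, cum4, hζ.variance_one, centralMoment, hζ.mean_zero,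
      integral_innovation_sq hζ]
    have : ∀ ω, ζ 0 ω ^ 4 = (ζ 0 ω ^ 2) ^ 2 := fun ω => by ring
    simp only [Pi.pow_apply, Pi.sub_apply, sub_zero, this]
    ring
  refine ⟨min 1 (w / 2), lt_min one_pos (by positivity), fun n b => ?_⟩
  have hB : 0 ≤ BfSq A b n := Finset.sum_nonneg fun _ _ => sq_nonneg _
  set σ := ∑ j ∈ idx n, b j * specDensity A (freq n j) with hσ
  -- Cauchy-Schwarz over at most n/2 indices. The factor 1/2 is essential: as the cumulant is w - 2
  -- ≥ -2, it leaves (w/2) B_{f,n}² when w < 2.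
  have hcs : 1 / (n : ℝ) * σ ^ 2 ≤ BfSq A b n / 2 := by
    rcases (idx n).eq_empty_or_nonempty with he | ⟨i, hi⟩
    · have : σ = 0 := by rw [hσ, he, Finset.sum_empty]
      rw [this]
      simpa using by positivity
    have hn := four_le_of_mem_idx hi
    have hn0 : (0 : ℝ) < n := by exact_mod_cast (by omega : 0 < n)
    have h1 : σ ^ 2 ≤ (idx n).card * BfSq A b n := sq_sum_le_card_mul_sum_sq
    have h2 : ((idx n).card : ℝ) ≤ n / 2 := by
      have : 2 * (idx n).card ≤ n := by
        simp only [idx, Nat.card_Icc]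
        omega
      have h3 : (2 : ℝ) * (idx n).card ≤ n := by exact_mod_cast this
      linarith
    rw [one_div_mul_eq_div, div_le_iff₀ hn0]
    have := mul_le_mul_of_nonneg_right h2 hB
    linarith
  have hcs0 : 0 ≤ 1 / (n : ℝ) * σ ^ 2 := by positivity
  rw [vSq, hcum, mul_assoc]
  rcases le_or_gt 2 w with h2 | h2
  · have h3 : min 1 (w / 2) * BfSq A b n ≤ 1 * BfSq A b n :=
      mul_le_mul_of_nonneg_right (min_le_left _ _) hB
    have := mul_nonneg (sub_nonneg.mpr h2) hcs0
    linarith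
  · have h3 : min 1 (w / 2) * BfSq A b n ≤ w / 2 * BfSq A b n :=
      mul_le_mul_of_nonneg_right (min_le_right _ _) hB
    have := mul_le_mul_of_nonneg_left hcs (by linarith : 0 ≤ 2 - w)
    linarith

lemma isLittleO_vSq (hζ : IsStandardIID P ζ) (hζ4 : MemLp (ζ 0) 4 P)
    (hv : 0 < variance (fun ω => ζ 0 ω ^ 2) P) {b : ℕ → ℕ → ℝ} {f ε : ℕ → ℝ} (hf : ∀ n, 0 ≤ f n)
    (hε : Tendsto ε atTop (𝓝 0)) (h : ∀ᶠ n in atTop, f n ≤ ε n * BfSq A (b n) n) :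
    f =o[atTop] fun n => vSq P ζ A (b n) n := by
  obtain ⟨c, hc, hcv⟩ := exists_le_vSq hζ hζ4 hv A
  rw [isLittleO_iff]
  intro r hr
  have hsmall : ∀ᶠ n in atTop, ε n < r * c := hε.eventually_lt_const (by positivity)
  filter_upwards [h, hsmall] with n h1 h2
  have hB : 0 ≤ BfSq A (b n) n := Finset.sum_nonneg fun _ _ => sq_nonneg _
  rw [Real.norm_of_nonneg (hf n)]
  calc f n ≤ r * c * BfSq A (b n) n := h1.trans (mul_le_mul_of_nonneg_right h2.le hB)
    _ = r * (c * BfSq A (b n) n) := by ring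
    _ ≤ r * vSq P ζ A (b n) n := mul_le_mul_of_nonneg_left (hcv n (b n)) hr.le
    _ ≤ r * ‖vSq P ζ A (b n) n‖ := mul_le_mul_of_nonneg_left (Real.le_norm_self _) hr.le

lemma SpecBounded.exists_BSq_le (hs : SpecBounded A) :
    ∃ c : ℝ, 0 < c ∧ ∀ (n : ℕ) (b : ℕ → ℝ), BSq b n ≤ c * BfSq A b n := by
  obtain ⟨c₁, c₂, hc, hs⟩ := hs
  refine ⟨(c₁ ^ 2)⁻¹, by positivity, fun n b => ?_⟩
  rw [BSq, BfSq, Finset.mul_sum]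
  refine Finset.sum_le_sum fun j hj => ?_
  have h1 := pow_le_pow_left₀ hc.le
    (hs _ (mem_piInt_of_Ioo ⟨freq_pos hj, freq_lt_pi hj⟩)).1 2
  rw [inv_mul_eq_div, le_div_iff₀ (by positivity), mul_pow]
  exact mul_le_mul_of_nonneg_left h1 (sq_nonneg _)

/-- Consequences of `E r_n² ≤ C ε_n B_n²` when the spectral density is bounded away from zero. -/
lemma isLittleO_of_specBounded (hζ : IsStandardIID P ζ) (hζ4 : MemLp (ζ 0) 4 P)
    (hv : 0 < variance (fun ω => ζ 0 ω ^ 2) P) (hs : SpecBounded A) {ε : ℕ → ℝ}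
    (hε0 : ∀ n, 1 ≤ n → 0 ≤ ε n) (hε : Tendsto ε atTop (𝓝 0)) {C : ℝ}
    (hr : ∀ (n : ℕ) (b : ℕ → ℝ), 1 ≤ n → rMS P ζ X A b n ≤ C * ε n * BSq b n) (b : ℕ → ℕ → ℝ) :
    (fun n => ε n * BSq (b n) n) =o[atTop] (fun n => vSq P ζ A (b n) n) ∧
    (fun n => rMS P ζ X A (b n) n) =o[atTop] (fun n => vSq P ζ A (b n) n) := by
  obtain ⟨c, hc, hcB⟩ := hs.exists_BSq_le
  have hB : ∀ n, 0 ≤ BSq (b n) n := fun n => Finset.sum_nonneg fun _ _ => sq_nonneg _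
  -- The absolute value is needed because the sign of ε at n = 0 is not prescribed.
  have h1 : (fun n => |ε n| * BSq (b n) n) =o[atTop] (fun n => vSq P ζ A (b n) n) := by
    refine isLittleO_vSq hζ hζ4 hv (ε := fun n => |ε n| * c)
      (fun n => mul_nonneg (abs_nonneg _) (hB n)) ?_ (Eventually.of_forall fun n => ?_)
    · simpa using hε.abs.mul_const c
    · rw [mul_assoc]
      exact mul_le_mul_of_nonneg_left (hcB n (b n)) (abs_nonneg _)
  have h2 : (fun n => ε n * BSq (b n) n) =o[atTop] (fun n => vSq P ζ A (b n) n) := by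
    refine IsBigO.trans_isLittleO (IsBigO.of_bound 1 (Eventually.of_forall fun n => ?_)) h1
    simp
  refine ⟨h2, IsBigO.trans_isLittleO (IsBigO.of_bound |C| ?_) h2⟩
  filter_upwards [eventually_ge_atTop 1] with n hn
  rw [Real.norm_of_nonneg (rMS_nonneg _ _),
    Real.norm_of_nonneg (mul_nonneg (hε0 n hn) (hB n))]
  refine (hr n (b n) hn).trans ?_
  rw [mul_assoc]
  exact mul_le_mul_of_nonneg_right (le_abs_self C) (mul_nonneg (hε0 n hn) (hB n))

/-- The contribution of a Lipschitz factor is dominated by the singular one. -/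
lemma inv_mul_BfSq_le_minTerm (A : ℝ → ℂ) (b : ℕ → ℝ) {n : ℕ} (hn : 4 ≤ n) :
    (n : ℝ) ^ (-((1 : ℝ≥0) : ℝ)) * BfSq A b n ≤ minTerm A b n := by
  have hn0 : (0 : ℝ) < n := by exact_mod_cast (by omega : 0 < n)
  have hn1 : (1 : ℝ) ≤ n := by exact_mod_cast (by omega : 1 ≤ n)
  have hbf := bf_nonneg A b n
  have hB := BfSq_nonneg A b n
  -- At most n summands, each at most the squared maximum. This also gives B_{f,n} ≤ n b_{f,n}, used
  -- against the second entry of the minimum.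
  have h1 : BfSq A b n ≤ n * bf A b n ^ 2 := by
    have hle : ∀ j ∈ idx n, (b j * specDensity A (freq n j)) ^ 2 ≤ bf A b n ^ 2 := by
      intro j hj
      rw [← sq_abs, abs_mul, abs_of_nonneg (specDensity_nonneg A _)]
      exact pow_le_pow_left₀ (mul_nonneg (abs_nonneg _) (specDensity_nonneg _ _))
        (le_ciSup (f := fun j : idx n => |b j| * specDensity A (freq n j))
          (Set.finite_range _).bddAbove ⟨j, hj⟩) 2
    refine (Finset.sum_le_card_nsmul _ _ _ hle).trans ?_
    rw [nsmul_eq_mul]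
    have : (idx n).card ≤ n := by
      simp only [idx, Nat.card_Icc]
      omega
    have h2 : ((idx n).card : ℝ) ≤ n := by exact_mod_cast this
    gcongr
  rw [NNReal.coe_one, Real.rpow_neg_one, inv_mul_eq_div]
  refine le_min ?_ ?_
  · rw [div_le_iff₀ hn0]
    have h2 : 1 ≤ Real.log n ^ 3 := one_le_pow₀ (one_le_log hn)
    have h3 := mul_le_mul_of_nonneg_left h2 (by positivity : 0 ≤ n * bf A b n ^ 2)
    linarith
  · have hs : BfSq A b n = Bf A b n ^ 2 := (Real.sq_sqrt hB).symm
    have hBf : 0 ≤ Bf A b n := Real.sqrt_nonneg _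
    have h2 : Bf A b n ≤ n * bf A b n := by
      refine Real.sqrt_le_iff.mpr ⟨by positivity, h1.trans ?_⟩
      rw [mul_pow]
      exact mul_le_mul_of_nonneg_right (by nlinarith) (sq_nonneg _)
    rw [div_le_iff₀ hn0, hs]
    nlinarith

end Assembly

end Bartlett

/-! ### Deduction of the theorem -/

theorem lemma3p1 {Ω : Type*} [MeasurableSpace Ω] (P : Measure Ω) [IsProbabilityMeasure P]
    (a : ℕ → ℝ) (A : ℝ → ℂ) (ζ X : ℤ → Ω → ℝ)
    (hζ : Bartlett.IsStandardIID P ζ) (hζ4 : MemLp (ζ 0) 4 P)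
    (hX : Bartlett.IsLinearProcess P a ζ X) (hA : Bartlett.IsTransferFunction a A) :
    -- the second moments in question are finite
    (∀ (n : ℕ) (b : ℕ → ℝ), 1 ≤ n → MemLp (Bartlett.rErr P ζ X A b n) 2 P) ∧
    -- (i), `A ∈ Λ_β(Π)`
    (∀ β : ℝ≥0, 0 < β → β ≤ 1 → Bartlett.LipClass β A →
      (∃ C : ℝ, 0 < C ∧ ∀ (n : ℕ) (b : ℕ → ℝ), 1 ≤ n →
        Bartlett.rMS P ζ X A b n ≤ C * Bartlett.lipRate β n * Bartlett.BSq b n) ∧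
      (0 < variance (fun ω => ζ 0 ω ^ 2) P → Bartlett.SpecBounded A → ∀ b : ℕ → ℕ → ℝ,
        (fun n => Bartlett.lipRate β n * Bartlett.BSq (b n) n)
            =o[atTop] (fun n => Bartlett.vSq P ζ A (b n) n) ∧
        (fun n => Bartlett.rMS P ζ X A (b n) n)
            =o[atTop] (fun n => Bartlett.vSq P ζ A (b n) n))) ∧
    -- (i), `A` continuous on `Π`
    (ContinuousOn A Bartlett.PiInt →
      ∃ δ : ℕ → ℝ, Tendsto δ atTop (𝓝 0) ∧
      (∃ C : ℝ, 0 < C ∧ ∀ (n : ℕ) (b : ℕ → ℝ), 1 ≤ n →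
        Bartlett.rMS P ζ X A b n ≤ C * δ n * Bartlett.BSq b n) ∧
      (0 < variance (fun ω => ζ 0 ω ^ 2) P → Bartlett.SpecBounded A → ∀ b : ℕ → ℕ → ℝ,
        (fun n => δ n * Bartlett.BSq (b n) n)
            =o[atTop] (fun n => Bartlett.vSq P ζ A (b n) n) ∧
        (fun n => Bartlett.rMS P ζ X A (b n) n)
            =o[atTop] (fun n => Bartlett.vSq P ζ A (b n) n))) ∧
    -- (ii)
    (∀ (d : ℝ) (h G : ℝ → ℂ), |d| < 1 / 2 → Bartlett.PowerSingular d h →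
      (∀ u ∈ Bartlett.PiInt, u ≠ 0 → A u = h u * G u) →
      (∃ c : ℝ, 0 < c ∧ ∀ u ∈ Bartlett.PiInt, c ≤ ‖G u‖) →
      (∀ β : ℝ≥0, 0 < β → β ≤ 1 → Bartlett.LipClass β G →
        ∃ C : ℝ, 0 < C ∧ ∀ (n : ℕ) (b : ℕ → ℝ), 1 ≤ n →
          Bartlett.rMS P ζ X A b n
            ≤ C * (Bartlett.minTerm A b n + Bartlett.lipRate β n * Bartlett.BfSq A b n)) ∧
      (ContinuousOn G Bartlett.PiInt →
        ∃ δ : ℕ → ℝ, Tendsto δ atTop (𝓝 0) ∧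
        ∃ C : ℝ, 0 < C ∧ ∀ (n : ℕ) (b : ℕ → ℝ), 1 ≤ n →
          Bartlett.rMS P ζ X A b n
            ≤ C * (Bartlett.minTerm A b n + δ n * Bartlett.BfSq A b n)) ∧
      (Bartlett.LipClass 1 G →
        ∃ C : ℝ, 0 < C ∧ ∀ (n : ℕ) (b : ℕ → ℝ), 1 ≤ n →
          Bartlett.rMS P ζ X A b n ≤ C * Bartlett.minTerm A b n) ∧
      (ContinuousOn G Bartlett.PiInt → 0 < variance (fun ω => ζ 0 ω ^ 2) P →
        ∀ b : ℕ → ℕ → ℝ,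
          Tendsto (fun n => Bartlett.bf A (b n) n / Bartlett.Bf A (b n) n) atTop (𝓝 0) →
          (fun n => Bartlett.rMS P ζ X A (b n) n)
            =o[atTop] (fun n => Bartlett.vSq P ζ A (b n) n))) := by
  have hr1 := fun (hc : ContinuousOn A Bartlett.PiInt) {δ : ℕ → ℝ}
    (hδ : Bartlett.ModulusBound δ A) =>
      Bartlett.rMS_le_of_modulusBound hζ hζ4 hX hA hc hδ
  refine ⟨fun n b _ => ?_, fun β hβ hβ1 hLip => ?_, fun hc => ?_,
    fun d h G hd hh hAhG hG0 => ⟨fun β hβ hβ1 hLip => ?_, fun hc => ?_, fun hLip => ?_,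
      fun hc hv b hb => ?_⟩⟩
  · obtain ⟨V, hV⟩ := Bartlett.exists_sum_sq_kernelEntry_le
      (Bartlett.sqInt_of_periodic hA.periodic hA.memLp) b n
    exact (Bartlett.rErr_sq_le hζ hζ4 hX hA b n hV).1
  · obtain ⟨c, hc0, hmod⟩ := hLip.exists_modulusBound hβ1
    obtain ⟨C, hC, hr⟩ := hr1 (hLip.continuousOn hβ) hmod
    have hr' : ∀ (n : ℕ) (b : ℕ → ℝ), 1 ≤ n →
        Bartlett.rMS P ζ X A b n ≤ C * (c + 1) * Bartlett.lipRate β n * Bartlett.BSq b n := by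
      intro n b hn
      have hB : 0 ≤ Bartlett.BSq b n := Finset.sum_nonneg fun _ _ => sq_nonneg _
      have hl := Bartlett.lipRate_nonneg β n
      -- For n ≥ 4, log n ≥ 1 and n^{-β} is below the stated rate; for n < 4 there are no
      -- frequencies. The + 1 in c + 1 only secures positivity of the constant.
      rcases lt_or_ge n 4 with h4 | h4
      · rw [Bartlett.rMS_eq_zero h4]
        positivity
      · refine (hr n b hn).trans (mul_le_mul_of_nonneg_right ?_ hB)
        rw [mul_assoc]
        refine mul_le_mul_of_nonneg_left ?_ hC.le
        refine (mul_le_mul_of_nonneg_left (Bartlett.rpow_neg_le_lipRate h4) hc0).trans ?_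
        linarith
    exact ⟨⟨C * (c + 1), by positivity, hr'⟩, fun hv hs b =>
      Bartlett.isLittleO_of_specBounded hζ hζ4 hv hs (fun n _ => Bartlett.lipRate_nonneg β n)
        (Bartlett.tendsto_lipRate hβ) hr' b⟩
  · obtain ⟨δ, hδ, hmod⟩ := Bartlett.exists_modulusBound hc
    obtain ⟨C, hC, hr⟩ := hr1 hc hmod
    exact ⟨δ, hδ, ⟨C, hC, hr⟩, fun hv hs b =>
      Bartlett.isLittleO_of_specBounded hζ hζ4 hv hs (fun n hn => hmod.nonneg hn) hδ hr b⟩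
  · obtain ⟨c, hc0, hmod⟩ := hLip.exists_modulusBound hβ1
    obtain ⟨C, hC, hr⟩ := Bartlett.rMS_le_of_powerSingular hζ hζ4 hX hA hd hh hAhG hG0
      (hLip.continuousOn hβ) hmod
    refine ⟨C * (c + 1), by positivity, fun n b hn => ?_⟩
    have hB := Bartlett.BfSq_nonneg A b n
    have hm := Bartlett.minTerm_nonneg A b n
    have hl := Bartlett.lipRate_nonneg β n
    rcases lt_or_ge n 4 with h4 | h4
    · rw [Bartlett.rMS_eq_zero h4]
      positivity
    · refine (hr n b hn).trans ?_
      rw [mul_assoc C]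
      refine mul_le_mul_of_nonneg_left ?_ hC.le
      have h1 := mul_le_mul_of_nonneg_right
        (mul_le_mul_of_nonneg_left (Bartlett.rpow_neg_le_lipRate (β := β) h4) hc0) hB
      have h2 := mul_nonneg hc0 hm
      have h3 := mul_nonneg hl hB
      linarith
  · obtain ⟨δ, hδ, hmod⟩ := Bartlett.exists_modulusBound hc
    exact ⟨δ, hδ, Bartlett.rMS_le_of_powerSingular hζ hζ4 hX hA hd hh hAhG hG0 hc hmod⟩
  · obtain ⟨c, hc0, hmod⟩ := hLip.exists_modulusBound le_rfl
    obtain ⟨C, hC, hr⟩ := Bartlett.rMS_le_of_powerSingular hζ hζ4 hX hA hd hh hAhG hG0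
      (hLip.continuousOn one_pos) hmod
    refine ⟨C * (c + 1), by positivity, fun n b hn => ?_⟩
    have hm := Bartlett.minTerm_nonneg A b n
    rcases lt_or_ge n 4 with h4 | h4
    · rw [Bartlett.rMS_eq_zero h4]
      positivity
    · refine (hr n b hn).trans ?_
      rw [mul_assoc C]
      refine mul_le_mul_of_nonneg_left ?_ hC.le
      have h1 := mul_le_mul_of_nonneg_left (Bartlett.inv_mul_BfSq_le_minTerm A b h4) hc0
      linarith
  · obtain ⟨δ, hδ, hmod⟩ := Bartlett.exists_modulusBound hc
    obtain ⟨C, hC, hr⟩ := Bartlett.rMS_le_of_powerSingular hζ hζ4 hX hA hd hh hAhG hG0 hc hmod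
    refine Bartlett.isLittleO_vSq hζ hζ4 hv (fun n => Bartlett.rMS_nonneg _ _)
      (ε := fun n => C * (Bartlett.bf A (b n) n / Bartlett.Bf A (b n) n + δ n)) ?_ ?_
    · simpa using (hb.add hδ).const_mul C
    · filter_upwards [eventually_ge_atTop 1] with n hn
      refine (hr n (b n) hn).trans ?_
      rw [mul_assoc]
      refine mul_le_mul_of_nonneg_left ?_ hC.le
      have hB : Bartlett.BfSq A (b n) n = Bartlett.Bf A (b n) n ^ 2 :=
        (Real.sq_sqrt (Bartlett.BfSq_nonneg A (b n) n)).symm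
      -- The second entry of the minimum is (b_{f,n}/B_{f,n}) B_{f,n}², so the hypothesis on the
      -- ratio makes it o(B_{f,n}²). If B_{f,n} = 0, both sides of this identity vanish.
      have h1 : Bartlett.minTerm A (b n) n ≤
          Bartlett.bf A (b n) n * Bartlett.Bf A (b n) n := min_le_right _ _
      have h2 : Bartlett.bf A (b n) n * Bartlett.Bf A (b n) n =
          Bartlett.bf A (b n) n / Bartlett.Bf A (b n) n * Bartlett.BfSq A (b n) n := by
        rw [hB]
        rcases eq_or_ne (Bartlett.Bf A (b n) n) 0 with h0 | h0
        · simp [h0]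
        · field_simp
      rw [add_mul, ← h2]
      linarith
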